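/- For a finite simple graph $G$, the \emph{feedback edge set number} $\mathsf{fes}(G)$ is the minimum size of a set $X\subseteq E(G)$ such that $G-X$ is a forest. A set $S\subseteq V(G)$ is \emph{locating-dominating} if every vertex outside $S$ has a neighbour in $S$ and any two distinct vertices $u,v\in V(G)\setminus S$ satisfy $N(u)\cap S\neq N(v)\cap S$. The problem \textsc{Locating-Dominating Set} asks, given a finite simple graph $G$ and a number $k\in\mathbb N$, whether $G$ has a locating-dominating set of size $k$. Theorem. \textsc{Locating-Dominating Set}, parameterized by the feedback edge set number, admits a kernel with $\mathcal O(\mathsf{fes})$ vertices and edges. That is, there are a polynomial-time algorithm, a constant $C$ and a computable function $g:\mathbb N\to\mathbb N$ such that the algorithm maps every instance $(G,k)$ to an instance $(G',k')$ for which (i) $(G,k)$ is a yes-instance if and only if $(G',k')$ is a yes-instance; (ii) the encoding size of $(G',k')$ plus $\mathsf{fes}(G')$ is at most $g(\mathsf{fes}(G))$; (iii) $|V(G')|\le C\cdot\mathsf{fes}(G)$ and $|E(G')|\le C\cdot\mathsf{fes}(G)$. -/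

import Mathlib

/-!
Kernelization of the Locating-Dominating Set problem, parameterized by the feedback edge set
number: graph notions, a machine model with a running time, and kernelizations.
-/

namespace LocDom

section Graphs

variable {V : Type*}

/-- `S` is a dominating set of `G`: every vertex is in `S` or has a neighbour in `S`. -/
def IsDominating (G : SimpleGraph V) (S : Set V) : Prop :=
  ∀ v, v ∈ S ∨ ∃ u ∈ S, G.Adj v u

/-- `S` is a locating-dominating set of `G`: it is dominating, and any two different vertices
outside `S` have different neighbourhoods in `S`. -/
def IsLocatingDominating (G : SimpleGraph V) (S : Set V) : Prop :=
  IsDominating G S ∧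
    ∀ u v, u ∉ S → v ∉ S → u ≠ v → G.neighborSet u ∩ S ≠ G.neighborSet v ∩ S

/-- A set `X` of edges of `G` is a feedback edge set if `G - X` is a forest. -/
def IsFeedbackEdgeSet (G : SimpleGraph V) (X : Set (Sym2 V)) : Prop :=
  X ⊆ G.edgeSet ∧ (G.deleteEdges X).IsAcyclic

/-- The feedback edge set number: the minimum size of a feedback edge set. It is used for finite
graphs only, where the set of all edges is a finite feedback edge set, so that the infimum is a
minimum. -/
noncomputable def fes (G : SimpleGraph V) : ℕ :=
  sInf {m | ∃ X : Finset (Sym2 V), IsFeedbackEdgeSet G (X : Set (Sym2 V)) ∧ X.card = m}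

end Graphs

/-- An instance of Locating-Dominating Set: a finite graph, on the vertices `0, …, n - 1`, and a
number `k`. -/
structure Instance where
  /-- the number of vertices -/
  n : ℕ
  /-- the graph -/
  graph : SimpleGraph (Fin n)
  /-- the required size of the solution -/
  k : ℕ

/-- The yes-instances: `graph` has a locating-dominating set of size `k`. -/
def Instance.IsYes (I : Instance) : Prop :=
  ∃ S : Finset (Fin I.n), IsLocatingDominating I.graph (S : Set (Fin I.n)) ∧ S.card = I.k

/-! ### Machine model

While programs on one binary tree, the standard deterministic imperative model with `cons`, head,
tail and a test for `nil`. Each elementary operation is charged the full size of the tree on which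
it operates (not a constant, as in a pointer implementation). Hence no tree that occurs in a
computation is larger than the running time, and the model and multitape Turing machines simulate
each other with polynomial overhead. -/

/-- The data of the machine model: binary trees. -/
inductive Data : Type where
  | nil : Data
  | cons (a b : Data) : Data

namespace Data

/-- The number of nodes of a tree, leaves included. -/
def size : Data → ℕ
  | nil => 1
  | cons a b => a.size + b.size + 1

/-- The left subtree (`nil` for `nil`). -/
def head : Data → Data
  | nil => nil
  | cons a _ => a

/-- The right subtree (`nil` for `nil`). -/
def tail : Data → Data
  | nil => nil
  | cons _ b => b

/-- A bit as a tree. -/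
def ofBool : Bool → Data
  | false => nil
  | true => cons nil nil

/-- A list of trees as a tree. -/
def ofList : List Data → Data
  | [] => nil
  | a :: l => cons a (ofList l)

end Data

/-- Programs. Each acts on one tree, the current state. -/
inductive Prog : Type where
  /-- leave the state as it is -/
  | id : Prog
  /-- return `nil` -/
  | nil : Prog
  /-- return the left subtree -/
  | head : Prog
  /-- return the right subtree -/
  | tail : Prog
  /-- run `p` and `q` on the state and return the tree with these two results as subtrees -/
  | cons (p q : Prog) : Prog
  /-- run `p`, then `q` on the result -/
  | seq (p q : Prog) : Prog
  /-- run `p` if `c` returns a tree other than `nil` on the state, else run `q` -/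
  | cond (c p q : Prog) : Prog
  /-- as long as `c` returns a tree other than `nil` on the state, replace the state by the
  result of `p` -/
  | loop (c p : Prog) : Prog

/-- `Runs p x y t`: on the input `x` the program `p` halts with the output `y` after time `t`. -/
inductive Runs : Prog → Data → Data → ℕ → Prop where
  | id (x : Data) : Runs .id x x x.size
  | nil (x : Data) : Runs .nil x .nil x.size
  | head (x : Data) : Runs .head x x.head x.size
  | tail (x : Data) : Runs .tail x x.tail x.size
  | cons {p q : Prog} {x a b : Data} {s t : ℕ} (hp : Runs p x a s) (hq : Runs q x b t) :
      Runs (.cons p q) x (.cons a b) (s + t + 1)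
  | seq {p q : Prog} {x y z : Data} {s t : ℕ} (hp : Runs p x y s) (hq : Runs q y z t) :
      Runs (.seq p q) x z (s + t + 1)
  | condTrue {c p q : Prog} {x a b y : Data} {s t : ℕ} (hc : Runs c x (.cons a b) s)
      (hp : Runs p x y t) : Runs (.cond c p q) x y (s + t + 1)
  | condFalse {c p q : Prog} {x y : Data} {s t : ℕ} (hc : Runs c x .nil s)
      (hq : Runs q x y t) : Runs (.cond c p q) x y (s + t + 1)
  | loopStep {c p : Prog} {x a b y z : Data} {s t r : ℕ} (hc : Runs c x (.cons a b) s)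
      (hp : Runs p x y t) (hl : Runs (.loop c p) y z r) : Runs (.loop c p) x z (s + t + r + 1)
  | loopEnd {c p : Prog} {x : Data} {s : ℕ} (hc : Runs c x .nil s) :
      Runs (.loop c p) x x (s + 1)

/-! ### Kernelizations -/

/-- `f` is computable in polynomial time, inputs and outputs being encoded by `enc`: one program
computes `f`, in time at most a fixed polynomial in the size of the encoded input. -/
def PolyTimeComputable {α : Type*} (enc : α → Data) (f : α → α) : Prop :=
  ∃ (p : Prog) (q : Polynomial ℕ), ∀ x : α,
    ∃ t ≤ q.eval (enc x).size, Runs p (enc x) (enc (f x)) t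

/-- `f` is a kernelization of the problem with instances `α`, encoding `enc`, yes-instances `yes`
and parameter `κ`: it is computable in polynomial time (without being given the parameter), it
maps yes-instances to yes-instances and no-instances to no-instances, and the size and the
parameter of the output are bounded by a computable function of the parameter of the input. -/
structure IsKernelization {α : Type*} (enc : α → Data) (yes : α → Prop) (κ : α → ℕ)
    (f : α → α) : Prop where
  polyTime : PolyTimeComputable enc f
  yes_iff : ∀ x, yes x ↔ yes (f x)
  bounded : ∃ g : ℕ → ℕ, Computable g ∧ ∀ x, (enc (f x)).size + κ (f x) ≤ g (κ x)

open Classical in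
/-- The encoding of an instance: the adjacency matrix, row by row, and `k` in binary. -/
noncomputable def Instance.encode (I : Instance) : Data :=
  .cons
    (Data.ofList (List.ofFn fun i : Fin I.n =>
      Data.ofList (List.ofFn fun j : Fin I.n => Data.ofBool (decide (I.graph.Adj i j)))))
    (Data.ofList (I.k.bits.map Data.ofBool))

end LocDom

namespace LocDom

/-! A piece is a set X of vertices together with labelled boundary vertices, the only ones of X that
may have neighbours outside. All that the rest of the graph notices of a solution inside X is its
`state`: which boundary vertices it contains, and which coincidences of neighbourhoods involve the
boundary or subsets of it. Parts in the same state can be exchanged (`Twin.replace`). Moreover every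
valid part can be made independent of the outside at an extra cost of at most `slack`
(`exists_top`), so only sizes less than `slack` above the minimum matter. Hence pieces with two
labels have finitely many profiles, and pieces with equal profiles and the same coincidence of
labels can be exchanged, which changes the optimum by the difference of their minima
(`Twin.exists_isLocatingDominating`).

If X grows out of a smaller piece Y at a single vertex and both have the same profile, X is
collapsed to Y, and the vertices of X \ Y are left behind as isolated ones (`Grows.reduces`). The
vertex set stays the same, edges disappear, and the number of edges plus components does not
increase; so the cyclomatic number does not increase either, and initially it is at most the
feedback edge set number (`darts_add_comps_le_fes`).

Let F be a spanning forest and T the set of the ends of the other edges, so that |T| is at most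
twice the cyclomatic number. Building F up edge by edge produces chains of nested pieces
(`forest_pieces`): a subtree without T has size at most exponential in the length of a chain that it
contains, and a path between branchings towards T, with the trees attached to it, is a chain as
well. If nothing can be collapsed, the pigeonhole principle bounds all chains by the constant
`kinds`. Then the components of F without T are single vertices, and the others have O(|T|) vertices
in total.

All collapses needed are instances of finitely many rules of bounded size. The sound ones form a
fixed list that is written into the program, which tries them at all tuples of vertices. Each
application removes an edge, so a quadratic number of rounds suffices. In the end the isolated
vertices, which belong to every solution, are removed and k is adjusted. -/

theorem Runs.input_size_le {p : Prog} {x y : Data} {t : ℕ} (h : Runs p x y t) : x.size ≤ t := by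
  induction h <;> omega

/-- Every operation is charged the size of its tree, so a time bound is also a size bound. This is
what makes compositions of polynomial-time programs polynomial. -/
theorem Runs.output_size_le {p : Prog} {x y : Data} {t : ℕ} (h : Runs p x y t) : y.size ≤ t := by
  induction h with
  | id x => exact le_rfl
  | nil x => cases x <;> simp [Data.size]
  | head x => cases x <;> simp [Data.size, Data.head]; omega
  | tail x => cases x <;> simp [Data.size, Data.tail]; omega
  | cons hp hq ih1 ih2 => simp only [Data.size]; omega
  | seq _ _ _ ih => omega
  | condTrue _ _ _ ih => omega
  | condFalse _ _ _ ih => omega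
  | loopStep _ _ _ _ _ ih => omega
  | loopEnd hc => have := hc.input_size_le; omega

/-! ### Trees as lists and as truth values -/

namespace Data

/-- The list of which a tree is the encoding. -/
def toList : Data → List Data
  | nil => []
  | cons a b => a :: b.toList

@[simp] theorem toList_nil : toList nil = [] := rfl
@[simp] theorem toList_cons (a b : Data) : toList (cons a b) = a :: b.toList := rfl
@[simp] theorem ofList_nil : ofList [] = nil := rfl
@[simp] theorem ofList_cons (a : Data) (l : List Data) :
    ofList (a :: l) = cons a (ofList l) := rfl
@[simp] theorem head_cons (a b : Data) : head (cons a b) = a := rfl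
@[simp] theorem tail_cons (a b : Data) : tail (cons a b) = b := rfl
@[simp] theorem head_nil : head nil = nil := rfl
@[simp] theorem tail_nil : tail nil = nil := rfl

@[simp] theorem toList_ofList (l : List Data) : (ofList l).toList = l := by
  induction l with
  | nil => rfl
  | cons a l ih => simp [ih]

@[simp] theorem ofList_toList (x : Data) : ofList x.toList = x := by
  induction x with
  | nil => rfl
  | cons a b _ ih => simp [ih]

theorem ofList_injective : Function.Injective ofList :=
  Function.LeftInverse.injective toList_ofList

theorem size_ofList (l : List Data) : (ofList l).size = 1 + (l.map fun a => a.size + 1).sum := by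
  induction l with
  | nil => rfl
  | cons a l ih => simp [size, ih]; omega

theorem size_tail_le (x : Data) : x.tail.size ≤ x.size := by cases x <;> simp [size]; omega

theorem size_mem_lt {a x : Data} (h : a ∈ x.toList) : a.size < x.size := by
  induction x with
  | nil => simp at h
  | cons b c _ ih =>
    simp only [toList_cons, List.mem_cons] at h
    simp only [size]
    rcases h with rfl | h
    · omega
    · have := ih h; omega

theorem length_toList_lt (x : Data) : x.toList.length < x.size := by
  induction x with
  | nil => simp [size]
  | cons a b _ ih => simp [size]; omega

theorem size_ofList_le {l : List Data} {c : ℕ} (h : ∀ a ∈ l, a.size ≤ c) :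
    (ofList l).size ≤ 1 + l.length * (c + 1) := by
  have := List.sum_le_card_nsmul (l.map fun a => a.size + 1) (c + 1) (by
    intro x hx
    obtain ⟨a, ha, rfl⟩ := List.mem_map.1 hx
    have := h a ha
    omega)
  rw [size_ofList]
  rw [smul_eq_mul, List.length_map] at this
  omega

theorem size_ofList_sublist {l l' : List Data} (h : l.Sublist l') :
    (ofList l).size ≤ (ofList l').size := by
  rw [size_ofList, size_ofList]
  have := (h.map fun a => a.size + 1).sum_le_sum (by simp)
  omega

/-- The truth value of a proposition as a tree. -/
noncomputable def ofProp (P : Prop) : Data := open Classical in ofBool (decide P)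

theorem ofProp_of {P : Prop} (h : P) : ofProp P = cons nil nil := by simp [ofProp, h, ofBool]

theorem ofProp_of_not {P : Prop} (h : ¬P) : ofProp P = nil := by simp [ofProp, h, ofBool]

theorem size_ofProp_le (P : Prop) : (ofProp P).size ≤ 3 := by
  by_cases h : P
  · simp [ofProp_of h, size]
  · simp [ofProp_of_not h, size]

@[simp] theorem ofProp_ne_nil {P : Prop} : ofProp P ≠ nil ↔ P := by
  by_cases h : P
  · rw [ofProp_of h]
    simp [h]
  · rw [ofProp_of_not h]
    simp [h]

end Data

open Data

/-! ### Polynomial bounds -/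

/-- `f` is bounded by a polynomial in the size of the argument. -/
def PolyBdd (f : Data → ℕ) : Prop := ∃ q : Polynomial ℕ, ∀ x, f x ≤ q.eval x.size

theorem polynomial_eval_mono (q : Polynomial ℕ) : Monotone fun n => q.eval n := by
  intro a b h
  simp only [Polynomial.eval_eq_sum, Polynomial.sum]
  gcongr

namespace PolyBdd

theorem mono {f g : Data → ℕ} (hg : PolyBdd g) (h : ∀ x, f x ≤ g x) : PolyBdd f := by
  obtain ⟨q, hq⟩ := hg
  exact ⟨q, fun x => (h x).trans (hq x)⟩

theorem const (c : ℕ) : PolyBdd fun _ => c := ⟨Polynomial.C c, by simp⟩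

theorem size : PolyBdd Data.size := ⟨Polynomial.X, by simp⟩

theorem add {f g : Data → ℕ} (hf : PolyBdd f) (hg : PolyBdd g) : PolyBdd fun x => f x + g x := by
  obtain ⟨q, hq⟩ := hf
  obtain ⟨r, hr⟩ := hg
  exact ⟨q + r, fun x => by simpa using add_le_add (hq x) (hr x)⟩

theorem mul {f g : Data → ℕ} (hf : PolyBdd f) (hg : PolyBdd g) : PolyBdd fun x => f x * g x := by
  obtain ⟨q, hq⟩ := hf
  obtain ⟨r, hr⟩ := hg
  exact ⟨q * r, fun x => by simpa using Nat.mul_le_mul (hq x) (hr x)⟩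

theorem eval (q : Polynomial ℕ) {f : Data → ℕ} (hf : PolyBdd f) :
    PolyBdd fun x => q.eval (f x) := by
  obtain ⟨r, hr⟩ := hf
  exact ⟨q.comp r, fun x => by
    rw [Polynomial.eval_comp]
    exact polynomial_eval_mono q (hr x)⟩

theorem comp {f : Data → ℕ} (hf : PolyBdd f) {F : Data → Data} (hF : PolyBdd fun x => (F x).size) :
    PolyBdd fun x => f (F x) := by
  obtain ⟨q, hq⟩ := hf
  exact (hF.eval q).mono fun x => hq _

end PolyBdd

/-! ### Functions computable in polynomial time -/

/-- `F` is computable in polynomial time. -/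
def PT (F : Data → Data) : Prop :=
  ∃ (p : Prog) (t : Data → ℕ), PolyBdd t ∧ ∀ x, Runs p x (F x) (t x)

/-- `P` is decidable in polynomial time. -/
def PTP (P : Data → Prop) : Prop := PT fun x => ofProp (P x)

namespace PT

theorem polyBdd {F : Data → Data} (h : PT F) : PolyBdd fun x => (F x).size := by
  obtain ⟨p, t, ht, h⟩ := h
  exact ht.mono fun x => (h x).output_size_le

theorem id : PT fun x => x := ⟨.id, _, .size, .id⟩

theorem nil : PT fun _ => Data.nil := ⟨.nil, _, .size, .nil⟩

theorem cons {F G : Data → Data} (hF : PT F) (hG : PT G) : PT fun x => Data.cons (F x) (G x) := by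
  obtain ⟨p, s, hs, hp⟩ := hF
  obtain ⟨q, t, ht, hq⟩ := hG
  exact ⟨.cons p q, _, (hs.add ht).add (.const 1), fun x => .cons (hp x) (hq x)⟩

theorem comp {F G : Data → Data} (hG : PT G) (hF : PT F) : PT fun x => G (F x) := by
  have hFb := hF.polyBdd
  obtain ⟨p, s, hs, hp⟩ := hF
  obtain ⟨q, t, ht, hq⟩ := hG
  exact ⟨.seq p q, _, (hs.add (ht.comp hFb)).add (.const 1), fun x => .seq (hp x) (hq _)⟩

theorem head {F : Data → Data} (hF : PT F) : PT fun x => (F x).head :=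
  comp ⟨.head, _, .size, .head⟩ hF

theorem tail {F : Data → Data} (hF : PT F) : PT fun x => (F x).tail :=
  comp ⟨.tail, _, .size, .tail⟩ hF

theorem const (c : Data) : PT fun _ => c := by
  induction c with
  | nil => exact nil
  | cons a b iha ihb => exact cons iha ihb

theorem congr {F G : Data → Data} (hF : PT F) (h : ∀ x, F x = G x) : PT G := by
  rwa [funext h] at hF

open Classical in
theorem cond {C F G : Data → Data} (hC : PT C) (hF : PT F) (hG : PT G) :
    PT fun x => if C x ≠ Data.nil then F x else G x := by
  obtain ⟨c, r, hr, hc⟩ := hC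
  obtain ⟨p, s, hs, hp⟩ := hF
  obtain ⟨q, t, ht, hq⟩ := hG
  refine ⟨.cond c p q, fun x => if C x = Data.nil then r x + t x + 1 else r x + s x + 1,
    ((hr.add (hs.add ht)).add (.const 1)).mono fun x => ?_, fun x => ?_⟩
  · split_ifs <;> omega
  · have := hc x
    cases h : C x with
    | nil =>
      rw [h] at this
      simpa [h] using Runs.condFalse this (hq x)
    | cons a b =>
      rw [h] at this
      simpa [h] using Runs.condTrue this (hp x)

open Classical in
theorem ite {P : Data → Prop} {F G : Data → Data} (hP : PTP P) (hF : PT F) (hG : PT G) :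
    PT fun x => if P x then F x else G x :=
  (cond hP hF hG).congr fun x => by simp only [ofProp_ne_nil]

end PT

theorem Runs.iterate {p : Prog} {F : Data → Data} {t : Data → ℕ} (hp : ∀ x, Runs p x (F x) (t x))
    (N : ℕ) (s : Data) (h : ∀ k < N, (F^[k] s).head ≠ .nil) (hN : (F^[N] s).head = .nil) :
    Runs (.loop .head p) s (F^[N] s)
      (∑ k ∈ Finset.range N, ((F^[k] s).size + t (F^[k] s) + 1) + (F^[N] s).size + 1) := by
  induction N generalizing s with
  | zero =>
    have := Runs.head s
    rw [show s.head = .nil from hN] at this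
    simpa using Runs.loopEnd this
  | succ N ih =>
    have h0 := h 0 (by omega)
    have hr := ih (F s) (fun k hk => by
      simpa [Function.iterate_succ_apply] using h (k + 1) (by omega)) (by
      simpa [Function.iterate_succ_apply] using hN)
    have hc := Runs.head s
    simp only [Function.iterate_zero, id_eq] at h0
    cases hs : s.head with
    | nil => exact absurd hs h0
    | cons a b =>
      rw [hs] at hc
      have := Runs.loopStep hc (hp s) hr
      rw [Finset.sum_range_succ']
      simp only [Function.iterate_succ_apply, Function.iterate_zero, id_eq]
      convert this using 1
      ring

/-- One loop over states `cons rest (cons acc x)`, which stops when the rest of the list is `nil`.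
The bound `B` for the accumulator on all prefixes is essential: a polynomial-time step may double
its argument, and its iterates would then grow exponentially. -/
theorem PT.fold {step start lst : Data → Data} (hs : PT step) (hi : PT start) (hl : PT lst)
    {B : Data → ℕ} (hB : PolyBdd B)
    (h : ∀ x l, l <+: (lst x).toList →
      (l.foldl (fun acc a => step (.cons x (.cons acc a))) (start x)).size ≤ B x) :
    PT fun x => (lst x).toList.foldl (fun acc a => step (.cons x (.cons acc a))) (start x) := by
  let body : Data → Data := fun s => .cons s.head.tail
    (.cons (step (.cons s.tail.tail (.cons s.tail.head s.head.head))) s.tail.tail)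
  have hbody : PT body := PT.id.head.tail.cons
    ((hs.comp (PT.id.tail.tail.cons (PT.id.tail.head.cons PT.id.head.head))).cons PT.id.tail.tail)
  obtain ⟨pb, tb, ⟨qb, hqb⟩, hpb⟩ := hbody
  obtain ⟨p0, t0, ht0, hp0⟩ := hl.cons (hi.cons PT.id)
  let s0 : Data → Data := fun x => .cons (lst x) (.cons (start x) x)
  let st : Data → ℕ → Data := fun x k => .cons (.ofList ((lst x).toList.drop k))
    (.cons (((lst x).toList.take k).foldl (fun acc a => step (.cons x (.cons acc a))) (start x)) x)
  have hst : ∀ x k, k ≤ (lst x).toList.length → body^[k] (s0 x) = st x k := by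
    intro x k hk
    induction k with
    | zero => simp [s0, st]
    | succ k ih =>
      rw [Function.iterate_succ_apply', ih (by omega)]
      have hk' : k < (lst x).toList.length := by omega
      simp only [body, st, head_cons, tail_cons]
      rw [List.drop_eq_getElem_cons (l := (lst x).toList) (i := k) hk',
        List.take_succ_eq_append_getElem hk', List.foldl_append]
      simp only [ofList_cons, head_cons, tail_cons, List.foldl_cons, List.foldl_nil]
  let N : Data → ℕ := fun x => (lst x).toList.length
  let S : Data → ℕ := fun x => (lst x).size + B x + x.size + 2
  have hS : PolyBdd S := ((hl.polyBdd.add hB).add .size).add (.const 2)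
  have hstS : ∀ x k, (st x k).size ≤ S x := by
    intro x k
    have h1 := h x _ (List.take_prefix k _)
    have h2 := size_ofList_sublist (List.drop_sublist k (lst x).toList)
    simp only [ofList_toList] at h2
    simp only [st, S, Data.size]
    omega
  have hloop : ∀ x, Runs (.loop .head pb) (s0 x) (st x (N x))
      (∑ k ∈ Finset.range (N x), ((st x k).size + tb (st x k) + 1) + (st x (N x)).size + 1) := by
    intro x
    have := Runs.iterate hpb (N x) (s0 x) (fun k hk => by
      rw [hst x k hk.le]
      simp only [st, head_cons]
      rw [List.drop_eq_getElem_cons (l := (lst x).toList) (i := k) hk]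
      simp only [ofList_cons, ne_eq, reduceCtorEq, not_false_eq_true]) (by
      rw [hst x _ le_rfl]
      simp [st])
    rw [hst x _ le_rfl] at this
    rwa [Finset.sum_congr rfl fun k hk => by rw [hst x k (Finset.mem_range.1 hk).le]] at this
  have hcomp : PT fun x => st x (N x) := by
    refine ⟨.seq p0 (.loop .head pb), _, ?_, fun x => .seq (hp0 x) (hloop x)⟩
    have hb : PolyBdd fun x =>
        t0 x + ((lst x).size * (S x + qb.eval (S x) + 1) + S x + 1) + 1 :=
      (ht0.add (((hl.polyBdd.mul ((hS.add (hS.eval qb)).add (.const 1))).add hS).add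
        (.const 1))).add (.const 1)
    refine hb.mono fun x => ?_
    have h1 : ∑ k ∈ Finset.range (N x), ((st x k).size + tb (st x k) + 1) ≤
        (lst x).size * (S x + qb.eval (S x) + 1) := by
      calc _ ≤ (Finset.range (N x)).card • (S x + qb.eval (S x) + 1) := by
            refine Finset.sum_le_card_nsmul _ _ _ fun k _ => ?_
            have h1 := hstS x k
            have h2 := (hqb (st x k)).trans (polynomial_eval_mono qb h1)
            simp only at h2
            omega
        _ ≤ _ := by
            rw [smul_eq_mul, Finset.card_range]
            exact Nat.mul_le_mul_right _ (length_toList_lt _).le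
    have h2 := hstS x (N x)
    omega
  exact hcomp.tail.head.congr fun x => by simp [st, N]

namespace PTP

theorem congr {P Q : Data → Prop} (hP : PTP P) (h : ∀ x, P x ↔ Q x) : PTP Q := by
  rwa [funext fun x => propext (h x)] at hP

theorem comp {P : Data → Prop} (hP : PTP P) {F : Data → Data} (hF : PT F) :
    PTP fun x => P (F x) := PT.comp hP hF

theorem ne_nil {F : Data → Data} (hF : PT F) : PTP fun x => F x ≠ .nil :=
  (PT.cond hF (.const (ofProp True)) (.const (ofProp False))).congr fun x => by
    by_cases h : F x = .nil <;> simp [h]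

theorem const (P : Prop) : PTP fun _ => P := PT.const _

theorem not {P : Data → Prop} (hP : PTP P) : PTP fun x => ¬P x :=
  (PT.ite hP (.const (ofProp False)) (.const (ofProp True))).congr fun x => by
    by_cases h : P x <;> simp [h]

theorem and {P Q : Data → Prop} (hP : PTP P) (hQ : PTP Q) : PTP fun x => P x ∧ Q x :=
  (PT.ite hP hQ (.const (ofProp False))).congr fun x => by
    by_cases h : P x <;> simp [h]

theorem or {P Q : Data → Prop} (hP : PTP P) (hQ : PTP Q) : PTP fun x => P x ∨ Q x :=
  (PT.ite hP (.const (ofProp True)) hQ).congr fun x => by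
    by_cases h : P x <;> simp [h]

theorem imp {P Q : Data → Prop} (hP : PTP P) (hQ : PTP Q) : PTP fun x => P x → Q x :=
  (hP.not.or hQ).congr fun x => by tauto

theorem iff_const {P : Data → Prop} (hP : PTP P) (Q : Prop) : PTP fun x => P x ↔ Q :=
  ((hP.imp (.const Q)).and ((PTP.const Q).imp hP)).congr fun x => by tauto

/-- The index set is fixed, so the quantifier is unrolled into the program instead of running over a
part of the input. -/
theorem forall_finite {ι : Type*} [Finite ι] {P : ι → Data → Prop} (hP : ∀ i, PTP (P i)) :
    PTP fun x => ∀ i, P i x := by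
  have := Fintype.ofFinite ι
  have h : ∀ s : Finset ι, PTP fun x => ∀ i ∈ s, P i x := by
    classical
    intro s
    induction s using Finset.induction_on with
    | empty => exact (PTP.const True).congr fun x => by simp
    | insert a s _ ih => exact ((hP a).and ih).congr fun x => by simp
  exact (h Finset.univ).congr fun x => by simp

theorem exists_finite {ι : Type*} [Finite ι] {P : ι → Data → Prop} (hP : ∀ i, PTP (P i)) :
    PTP fun x => ∃ i, P i x :=
  (forall_finite fun i => (hP i).not).not.congr fun x => by simp

end PTP

namespace PT

theorem reverse {F : Data → Data} (hF : PT F) : PT fun x => .ofList (F x).toList.reverse := by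
  have key : ∀ (l : List Data) (x : Data), l.foldl (fun acc a => Data.cons a acc) x =
      .ofList (l.reverse ++ x.toList) := by
    intro l
    induction l with
    | nil => simp
    | cons a l ih => intro x; simp [ih]
  have := fold (step := fun y => .cons y.tail.tail y.tail.head) (start := fun _ => .nil)
    (PT.id.tail.tail.cons PT.id.tail.head) nil hF hF.polyBdd (by
      intro x l hl
      simp only [tail_cons, head_cons, key]
      have h1 := size_ofList_sublist hl.sublist
      rw [ofList_toList] at h1
      simp only [size_ofList, toList_nil, List.append_nil, List.map_reverse, List.sum_reverse]
        at h1 ⊢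
      exact h1)
  refine this.congr fun x => ?_
  simp [key]

theorem append {F G : Data → Data} (hF : PT F) (hG : PT G) :
    PT fun x => .ofList ((F x).toList ++ (G x).toList) := by
  have key : ∀ (l : List Data) (x : Data), l.foldl (fun acc a => Data.cons a acc) x =
      .ofList (l.reverse ++ x.toList) := by
    intro l
    induction l with
    | nil => simp
    | cons a l ih => intro x; simp [ih]
  have := fold (step := fun y => .cons y.tail.tail y.tail.head) (start := G)
    (PT.id.tail.tail.cons PT.id.tail.head) hG hF.reverse (hF.reverse.polyBdd.add hG.polyBdd) (by
      intro x l hl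
      simp only [tail_cons, head_cons, key]
      have h1 := size_ofList_sublist hl.sublist
      have h2 : (G x).size = 1 + ((G x).toList.map fun a => a.size + 1).sum := by
        rw [← size_ofList, ofList_toList]
      rw [ofList_toList] at h1
      simp only [size_ofList, List.map_append, List.sum_append, List.map_reverse,
        List.sum_reverse] at h1 h2 ⊢
      omega)
  refine this.congr fun x => ?_
  simp [key]

theorem map {f lst : Data → Data} (hf : PT f) (hl : PT lst) :
    PT fun x => .ofList ((lst x).toList.map fun a => f (.cons x a)) := by
  have key : ∀ (x : Data) (l : List Data) (y : Data),
      l.foldl (fun acc a => Data.cons (f (.cons x a)) acc) y =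
      .ofList ((l.map fun a => f (.cons x a)).reverse ++ y.toList) := by
    intro x l
    induction l with
    | nil => simp
    | cons a l ih => intro y; simp [ih]
  obtain ⟨q, hq⟩ := hf.polyBdd
  have hB : PolyBdd fun x => 1 + (lst x).size * (q.eval (x.size + (lst x).size + 1) + 1) :=
    (PolyBdd.const 1).add (hl.polyBdd.mul
      (((((PolyBdd.size).add hl.polyBdd).add (.const 1)).eval q).add (.const 1)))
  have := fold (step := fun y => .cons (f (.cons y.head y.tail.tail)) y.tail.head)
    (start := fun _ => .nil)
    ((hf.comp (PT.id.head.cons PT.id.tail.tail)).cons PT.id.tail.head) nil hl hB (by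
      intro x l hlx
      simp only [tail_cons, head_cons, key, toList_nil, List.append_nil]
      refine (size_ofList_le (c := q.eval (x.size + (lst x).size + 1)) ?_).trans ?_
      · intro b hb
        simp only [List.mem_reverse, List.mem_map] at hb
        obtain ⟨a, ha, rfl⟩ := hb
        refine (hq _).trans (polynomial_eval_mono q ?_)
        have := size_mem_lt (hlx.subset ha)
        simp only [Data.size]
        omega
      · have := hlx.length_le
        have h2 := length_toList_lt (lst x)
        simp only [List.length_reverse, List.length_map]
        gcongr
        omega)
  refine this.reverse.congr fun x => ?_
  simp [key]

open Classical in
theorem filter {P : Data → Prop} {lst : Data → Data} (hP : PTP P) (hl : PT lst) :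
    PT fun x => .ofList ((lst x).toList.filter fun a => P (.cons x a)) := by
  classical
  have key : ∀ (x : Data) (l : List Data) (y : Data),
      l.foldl (fun acc a => if P (.cons x a) then Data.cons a acc else acc) y =
      .ofList ((l.filter fun a => P (.cons x a)).reverse ++ y.toList) := by
    intro x l
    induction l with
    | nil => simp
    | cons a l ih =>
      intro y
      by_cases h : P (.cons x a) <;> simp [ih, h]
  have := fold (step := fun y => if P (.cons y.head y.tail.tail) then .cons y.tail.tail y.tail.head
      else y.tail.head) (start := fun _ => .nil)
    (PT.ite (P := fun y => P (.cons y.head y.tail.tail)) (hP.comp (PT.id.head.cons PT.id.tail.tail))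
      (PT.id.tail.tail.cons PT.id.tail.head) PT.id.tail.head)
    nil hl hl.polyBdd (by
      intro x l hlx
      refine (congrArg Data.size (key x l .nil)).trans_le ?_
      have h1 := size_ofList_sublist hlx.sublist
      have h2 := size_ofList_sublist
        (List.filter_sublist (p := fun a => decide (P (.cons x a))) (l := l))
      rw [ofList_toList] at h1
      refine le_trans ?_ (h2.trans h1)
      simp [size_ofList])
  refine this.reverse.congr fun x => ?_
  refine (congrArg (fun d => Data.ofList (toList d).reverse) (key x _ _)).trans ?_
  simp

theorem flatten {F : Data → Data} (hF : PT F) :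
    PT fun x => .ofList ((F x).toList.map toList).flatten := by
  have key : ∀ (l : List Data) (y : Data),
      l.foldl (fun acc a => Data.ofList (acc.toList ++ a.toList)) y =
      .ofList (y.toList ++ (l.map toList).flatten) := by
    intro l
    induction l with
    | nil => simp
    | cons a l ih => intro x; simp [ih]
  have hsz : ∀ l : List Data, (Data.ofList (l.map toList).flatten).size ≤ (Data.ofList l).size := by
    intro l
    induction l with
    | nil => simp
    | cons a l ih =>
      have h2 : a.size = 1 + (a.toList.map fun a => a.size + 1).sum := by
        rw [← size_ofList, ofList_toList]
      rw [size_ofList] at ih ⊢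
      simp only [List.map_cons, List.flatten_cons, List.map_append, List.sum_append, ofList_cons,
        Data.size]
      omega
  have := fold (step := fun y => .ofList (y.tail.head.toList ++ y.tail.tail.toList))
    (start := fun _ => .nil)
    (append PT.id.tail.head PT.id.tail.tail) nil hF hF.polyBdd (by
      intro x l hl
      simp only [tail_cons, head_cons, key, toList_nil, List.nil_append]
      refine (hsz l).trans ?_
      simpa using size_ofList_sublist hl.sublist)
  refine this.congr fun x => ?_
  simp [key]

end PT

namespace PTP

theorem exists_mem {P : Data → Prop} {lst : Data → Data} (hP : PTP P) (hl : PT lst) :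
    PTP fun x => ∃ a ∈ (lst x).toList, P (.cons x a) := by
  classical
  refine (ne_nil (PT.filter hP hl)).congr fun x => ?_
  rw [← Data.ofList_nil, Data.ofList_injective.ne_iff]
  simp

theorem forall_mem {P : Data → Prop} {lst : Data → Data} (hP : PTP P) (hl : PT lst) :
    PTP fun x => ∀ a ∈ (lst x).toList, P (.cons x a) :=
  (exists_mem hP.not hl).not.congr fun x => by simp

end PTP

/-! ### Pieces with a boundary, their states and profiles -/

section Pieces

variable {V W ι : Type*}

/-- The neighbours of `v` in `X ∩ S`. -/
def trace (G : SimpleGraph V) (X S : Set V) (v : V) : Set V := {u | u ∈ X ∧ u ∈ S ∧ G.Adj v u}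

theorem trace_eq_iff_parts {G : SimpleGraph V} {S : Set V} (X : Set V) {u v : V} :
    G.neighborSet u ∩ S = G.neighborSet v ∩ S ↔
      trace G X S u = trace G X S v ∧ trace G Xᶜ S u = trace G Xᶜ S v := by
  simp only [Set.ext_iff, trace, Set.mem_inter_iff, SimpleGraph.mem_neighborSet, Set.mem_ofPred_eq,
    Set.mem_compl_iff]
  constructor
  · intro h
    exact ⟨fun x => by have := h x; tauto, fun x => by have := h x; tauto⟩
  · rintro ⟨h1, h2⟩ x
    have := h1 x
    have := h2 x
    tauto

/-- The neighbourhood in `S` is split into its parts inside and outside of `X`, so that a change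
inside of `X` can be examined one part at a time. -/
theorem isLocatingDominating_iff {G : SimpleGraph V} {S : Set V} (X : Set V) :
    IsLocatingDominating G S ↔
      (∀ v, v ∉ S → trace G X S v = ∅ → trace G Xᶜ S v = ∅ → False) ∧
      ∀ u v, u ∉ S → v ∉ S → trace G X S u = trace G X S v → trace G Xᶜ S u = trace G Xᶜ S v →
        u = v := by
  refine and_congr ⟨fun h v hv h1 h2 => ?_, fun h v => ?_⟩
    ⟨fun h u v hu hv h1 h2 => ?_, fun h u v hu hv huv he => ?_⟩
  · obtain h | ⟨u, hu, huv⟩ := h v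
    · exact hv h
    · by_cases hX : u ∈ X
      · exact Set.eq_empty_iff_forall_notMem.1 h1 u ⟨hX, hu, huv⟩
      · exact Set.eq_empty_iff_forall_notMem.1 h2 u ⟨hX, hu, huv⟩
  · by_contra hc
    push Not at hc
    refine h v hc.1 ?_ ?_ <;>
    · refine Set.eq_empty_iff_forall_notMem.2 fun u hu => hc.2 u hu.2.1 hu.2.2
  · by_contra huv
    exact h u v hu hv huv ((trace_eq_iff_parts X).2 ⟨h1, h2⟩)
  · obtain ⟨h1, h2⟩ := (trace_eq_iff_parts X).1 he
    exact huv (h u v hu hv h1 h2)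

/-- What the outside of a piece with vertex set `X` and labelled boundary `b` can see of `S ∩ X`. -/
abbrev State (ι : Type*) : Type _ :=
  (ι → Prop) × (Set ι → Prop) × (ι → Set ι → Prop) × (ι → Prop) × (ι → ι → Prop)

/-- The state of a set `S` on a piece. -/
def state (G : SimpleGraph V) (X : Set V) (b : ι → V) (S : Set V) : State ι :=
  -- The components answer, in this order: what an outside vertex sees of the boundary; outside
  -- against interior vertices; outside against boundary vertices, and domination of the latter
  -- (with J empty); interior against boundary vertices; boundary vertices against each other.
  (fun i => b i ∈ S,
   fun J => ∃ v ∈ X, v ∉ Set.range b ∧ v ∉ S ∧ trace G X S v = b '' J,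
   fun i J => trace G X S (b i) = b '' J,
   fun i => ∃ v ∈ X, v ∉ Set.range b ∧ v ∉ S ∧ trace G X S v = trace G X S (b i),
   fun i j => trace G X S (b i) = trace G X S (b j))

/-- The interior vertices of a piece are dominated and located by `S`. -/
def Valid (G : SimpleGraph V) (X : Set V) (b : ι → V) (S : Set V) : Prop :=
  (∀ v ∈ X, v ∉ Set.range b → v ∉ S → trace G X S v ≠ ∅) ∧
  ∀ u ∈ X, ∀ v ∈ X, u ∉ Set.range b → v ∉ Set.range b → u ∉ S → v ∉ S →
    trace G X S u = trace G X S v → u = v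

/-- Two graphs on `V` that differ only inside of `X`, the boundary vertices `b` in the first one
playing the role of `b'` in the second one. -/
structure Twin (G G' : SimpleGraph V) (X : Set V) (b b' : ι → V) : Prop where
  mem : ∀ i, b i ∈ X
  mem' : ∀ i, b' i ∈ X
  out : ∀ u v, u ∉ X → v ∉ X → (G.Adj u v ↔ G'.Adj u v)
  boundary : ∀ w, w ∉ X → ∀ i, G.Adj w (b i) ↔ G'.Adj w (b' i)
  closed : ∀ v ∈ X, v ∉ Set.range b → ∀ w, w ∉ X → ¬G.Adj v w
  closed' : ∀ v ∈ X, v ∉ Set.range b' → ∀ w, w ∉ X → ¬G'.Adj v w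
  -- Labels may coincide. Boundary sets are written as images of sets of labels, and this field
  -- makes equality of such images mean the same on both sides.
  eq_iff : ∀ i j, b i = b j ↔ b' i = b' j

theorem trace_congr {G : SimpleGraph V} {X S S' : Set V} (h : ∀ v ∈ X, v ∈ S ↔ v ∈ S') (v : V) :
    trace G X S v = trace G X S' v := by
  ext u
  simp only [trace, Set.mem_ofPred_eq]
  have := h u
  tauto

theorem image_eq_image_of_eq_iff {b : ι → V} {b' : ι → W} (h : ∀ i j, b i = b j ↔ b' i = b' j)
    {J J' : Set ι} (hJ : b' '' J = b' '' J') : b '' J = b '' J' := by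
  have key : ∀ J J' : Set ι, b' '' J ⊆ b' '' J' → b '' J ⊆ b '' J' := by
    rintro J J' hs _ ⟨i, hi, rfl⟩
    obtain ⟨j, hj, hji⟩ := hs ⟨i, hi, rfl⟩
    exact ⟨j, hj, (h j i).2 hji⟩
  exact (key _ _ hJ.subset).antisymm (key _ _ hJ.symm.subset)

variable {G G' : SimpleGraph V} {X : Set V} {b b' : ι → V} {S S' : Set V}

theorem trace_outside (hmem : ∀ i, b i ∈ X)
    (hc : ∀ v ∈ X, v ∉ Set.range b → ∀ w, w ∉ X → ¬G.Adj v w)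
    {w : V} (hw : w ∉ X) : trace G X S w = b '' {i | G.Adj w (b i) ∧ b i ∈ S} := by
  ext u
  simp only [trace, Set.mem_ofPred_eq, Set.mem_image]
  constructor
  · rintro ⟨hu, huS, hwu⟩
    by_cases hr : u ∈ Set.range b
    · obtain ⟨i, rfl⟩ := hr
      exact ⟨i, ⟨hwu, huS⟩, rfl⟩
    · exact absurd hwu.symm (hc u hu hr w hw)
  · rintro ⟨i, ⟨h1, h2⟩, rfl⟩
    exact ⟨hmem i, h2, h1⟩

theorem trace_compl_interior (hc : ∀ v ∈ X, v ∉ Set.range b → ∀ w, w ∉ X → ¬G.Adj v w) {v : V}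
    (hv : v ∈ X) (hvb : v ∉ Set.range b) : trace G Xᶜ S v = ∅ :=
  Set.eq_empty_iff_forall_notMem.2 fun u hu => hc v hv hvb u hu.1 hu.2.2

theorem valid_of_isLocatingDominating
    (hc : ∀ v ∈ X, v ∉ Set.range b → ∀ w, w ∉ X → ¬G.Adj v w) (h : IsLocatingDominating G S) :
    Valid G X b S := by
  rw [isLocatingDominating_iff X] at h
  refine ⟨fun v hv hvb hvS h0 => h.1 v hvS h0 (trace_compl_interior hc hv hvb),
    fun u hu v hv hub hvb huS hvS he => h.2 u v huS hvS he ?_⟩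
  rw [trace_compl_interior hc hu hub, trace_compl_interior hc hv hvb]

theorem valid_congr (h : ∀ v ∈ X, v ∈ S ↔ v ∈ S') : Valid G X b S ↔ Valid G X b S' := by
  simp only [Valid, trace_congr h]
  refine and_congr ?_ ?_
  · refine forall₂_congr fun v hv => ?_
    rw [h v hv]
  · refine forall₂_congr fun u hu => forall₂_congr fun v hv => ?_
    rw [h v hv, h u hu]

theorem state_congr (hb : ∀ i, b i ∈ X) (h : ∀ v ∈ X, v ∈ S ↔ v ∈ S') :
    state G X b S = state G X b S' := by
  have hv : ∀ P : V → Prop, (∃ v ∈ X, v ∉ Set.range b ∧ v ∉ S ∧ P v) ↔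
      ∃ v ∈ X, v ∉ Set.range b ∧ v ∉ S' ∧ P v := by
    intro P
    refine exists_congr fun v => and_congr_right fun hv => ?_
    rw [h v hv]
  simp only [state, trace_congr h, hv, fun i => h (b i) (hb i)]

namespace Twin

theorem symm (h : Twin G G' X b b') : Twin G' G X b' b :=
  ⟨h.mem', h.mem, fun u v hu hv => (h.out u v hu hv).symm, fun w hw i => (h.boundary w hw i).symm,
    h.closed', h.closed, fun i j => (h.eq_iff i j).symm⟩

theorem trace_compl_outside (h : Twin G G' X b b') (hS' : S' ⊆ X) {w : V} (hw : w ∉ X) :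
    trace G' Xᶜ (S \ X ∪ S') w = trace G Xᶜ S w := by
  ext u
  simp only [trace, Set.mem_ofPred_eq, Set.mem_compl_iff, Set.mem_union, Set.mem_sdiff]
  refine and_congr_right fun hu => ?_
  rw [h.out w u hw hu]
  have := @hS' u
  tauto

theorem trace_compl_boundary (h : Twin G G' X b b') (hS' : S' ⊆ X) (i : ι) :
    trace G' Xᶜ (S \ X ∪ S') (b' i) = trace G Xᶜ S (b i) := by
  ext u
  simp only [trace, Set.mem_ofPred_eq, Set.mem_compl_iff, Set.mem_union, Set.mem_sdiff]
  refine and_congr_right fun hu => ?_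
  rw [G.adj_comm, G'.adj_comm, h.boundary u hu]
  have := @hS' u
  tauto

/-- A part of a locating-dominating set can be replaced by one in the same state. -/
theorem replace (h : Twin G G' X b b') (hS : IsLocatingDominating G S) (hS' : S' ⊆ X)
    (hv : Valid G' X b' S') (hst : state G X b S = state G' X b' S') :
    IsLocatingDominating G' (S \ X ∪ S') := by
  simp only [state, Prod.mk.injEq, funext_iff, eq_iff_iff] at hst
  obtain ⟨e1, e2, e3, e4, e5⟩ := hst
  rw [isLocatingDominating_iff X] at hS ⊢
  have hX : ∀ v, trace G' X (S \ X ∪ S') v = trace G' X S' v :=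
    fun v => trace_congr (fun v hv => by simp [hv]) v
  have hmemX : ∀ v ∈ X, v ∉ S \ X ∪ S' → v ∉ S' := fun v _ h h' => h (Or.inr h')
  have hmemO : ∀ v, v ∉ X → v ∉ S \ X ∪ S' → v ∉ S := fun v h1 h2 h3 => h2 (Or.inl ⟨h3, h1⟩)
  have hJ : ∀ w, w ∉ X → ∀ T, (∀ i, b i ∈ S ↔ b' i ∈ T) →
      trace G' X T w = b' '' {i | G.Adj w (b i) ∧ b i ∈ S} := by
    intro w hw T hT
    rw [trace_outside h.mem' h.closed' hw]
    congr 1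
    ext i
    simp [h.boundary w hw, hT]
  simp only [hX]
  refine ⟨fun v hvS h1 h2 => ?_, fun u v huS hvS h1 h2 => ?_⟩
  · by_cases hvX : v ∈ X
    · by_cases hvb : v ∈ Set.range b'
      · obtain ⟨i, rfl⟩ := hvb
        rw [h.trace_compl_boundary hS'] at h2
        refine hS.1 (b i) ((e1 i).not.2 (hmemX _ hvX hvS)) ?_ h2
        simpa using (e3 i ∅).2 (by simpa using h1)
      · exact hv.1 v hvX hvb (hmemX v hvX hvS) h1
    · rw [h.trace_compl_outside hS' hvX] at h2
      refine hS.1 v (hmemO v hvX hvS) ?_ h2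
      rw [hJ v hvX S' e1] at h1
      rw [trace_outside h.mem h.closed hvX]
      simpa using h1
  · -- the cases that are not symmetric
    have OI : ∀ w v, w ∉ X → v ∈ X → v ∉ Set.range b' → w ∉ S \ X ∪ S' → v ∉ S \ X ∪ S' →
        trace G' X S' w = trace G' X S' v →
        trace G' Xᶜ (S \ X ∪ S') w = trace G' Xᶜ (S \ X ∪ S') v → False := by
      intro w v hw hvX hvb hwS hvS h1 h2
      rw [hJ w hw S' e1] at h1
      -- The trace of an outside vertex is a set of boundary vertices. The state therefore provides
      -- an interior vertex of the old piece with the corresponding trace, which `S` would not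
      -- separate from `w`.
      obtain ⟨v0, hv0X, hv0b, hv0S, hv0⟩ := (e2 _).2 ⟨v, hvX, hvb, hmemX v hvX hvS, h1.symm⟩
      rw [h.trace_compl_outside hS' hw, trace_compl_interior h.closed' hvX hvb] at h2
      have := hS.2 w v0 (hmemO w hw hwS) hv0S
        (by rw [hv0, trace_outside h.mem h.closed hw])
        (by rw [h2, trace_compl_interior h.closed hv0X hv0b])
      exact hw (this ▸ hv0X)
    have OB : ∀ w i, w ∉ X → w ∉ S \ X ∪ S' → b' i ∉ S \ X ∪ S' →
        trace G' X S' w = trace G' X S' (b' i) →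
        trace G' Xᶜ (S \ X ∪ S') w = trace G' Xᶜ (S \ X ∪ S') (b' i) → False := by
      intro w i hw hwS hiS h1 h2
      rw [hJ w hw S' e1] at h1
      have h3 := (e3 i _).2 h1.symm
      rw [h.trace_compl_outside hS' hw, h.trace_compl_boundary hS'] at h2
      have := hS.2 w (b i) (hmemO w hw hwS) ((e1 i).not.2 (hmemX _ (h.mem' i) hiS))
        (by rw [h3, trace_outside h.mem h.closed hw]) h2
      exact hw (this ▸ h.mem i)
    have IB : ∀ v i, v ∈ X → v ∉ Set.range b' → v ∉ S \ X ∪ S' → b' i ∉ S \ X ∪ S' →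
        trace G' X S' v = trace G' X S' (b' i) →
        trace G' Xᶜ (S \ X ∪ S') v = trace G' Xᶜ (S \ X ∪ S') (b' i) → False := by
      intro v i hvX hvb hvS hiS h1 h2
      obtain ⟨v0, hv0X, hv0b, hv0S, hv0⟩ := (e4 i).2 ⟨v, hvX, hvb, hmemX v hvX hvS, h1⟩
      rw [trace_compl_interior h.closed' hvX hvb, h.trace_compl_boundary hS'] at h2
      have := hS.2 v0 (b i) hv0S ((e1 i).not.2 (hmemX _ (h.mem' i) hiS)) hv0
        (by rw [← h2, trace_compl_interior h.closed hv0X hv0b])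
      exact hv0b ⟨i, this.symm⟩
    by_cases huX : u ∈ X
    · by_cases hub : u ∈ Set.range b'
      · obtain ⟨i, rfl⟩ := hub
        by_cases hvX : v ∈ X
        · by_cases hvb : v ∈ Set.range b'
          · obtain ⟨j, rfl⟩ := hvb
            rw [h.trace_compl_boundary hS', h.trace_compl_boundary hS'] at h2
            exact (h.eq_iff i j).1 (hS.2 _ _ ((e1 i).not.2 (hmemX _ huX huS))
              ((e1 j).not.2 (hmemX _ hvX hvS)) ((e5 i j).2 h1) h2)
          · exact (IB v i hvX hvb hvS huS h1.symm h2.symm).elim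
        · exact (OB v i hvX hvS huS h1.symm h2.symm).elim
      · by_cases hvX : v ∈ X
        · by_cases hvb : v ∈ Set.range b'
          · obtain ⟨j, rfl⟩ := hvb
            exact (IB u j huX hub huS hvS h1 h2).elim
          · exact hv.2 u huX v hvX hub hvb (hmemX u huX huS) (hmemX v hvX hvS) h1
        · exact (OI v u hvX huX hub hvS huS h1.symm h2.symm).elim
    · by_cases hvX : v ∈ X
      · by_cases hvb : v ∈ Set.range b'
        · obtain ⟨j, rfl⟩ := hvb
          exact (OB u j huX huS hvS h1 h2).elim
        · exact (OI u v huX hvX hvb huS hvS h1 h2).elim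
      · rw [h.trace_compl_outside hS' huX, h.trace_compl_outside hS' hvX] at h2
        rw [hJ u huX S' e1, hJ v hvX S' e1] at h1
        refine hS.2 u v (hmemO u huX huS) (hmemO v hvX hvS) ?_ h2
        rw [trace_outside h.mem h.closed huX, trace_outside h.mem h.closed hvX]
        exact image_eq_image_of_eq_iff h.eq_iff h1

/-- A part of a locating-dominating set can be replaced by one that contains the boundary and does
not interfere with the outside. -/
theorem replace_top (h : Twin G G' X b b') (hS : IsLocatingDominating G S) (hS' : S' ⊆ X)
    (hv : Valid G' X b' S') (hb : Set.range b' ⊆ S')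
    (ht : ∀ v ∈ X, v ∉ S' → ¬trace G' X S' v ⊆ Set.range b') :
    IsLocatingDominating G' (S \ X ∪ S') := by
  rw [isLocatingDominating_iff X] at hS ⊢
  have hX : ∀ v, trace G' X (S \ X ∪ S') v = trace G' X S' v :=
    fun v => trace_congr (fun v hv => by simp [hv]) v
  have hmemX : ∀ v, v ∉ S \ X ∪ S' → v ∉ S' := fun v h h' => h (Or.inr h')
  have hmemO : ∀ v, v ∉ X → v ∉ S \ X ∪ S' → v ∉ S := fun v h1 h2 h3 => h2 (Or.inl ⟨h3, h1⟩)
  have hJ : ∀ w, w ∉ X → trace G' X S' w = b' '' {i | G.Adj w (b i)} := by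
    intro w hw
    rw [trace_outside h.mem' h.closed' hw]
    congr 1
    ext i
    simp [h.boundary w hw, hb ⟨i, rfl⟩]
  have hO : ∀ w, w ∉ X → trace G X S w = b '' {i | G.Adj w (b i)} ∩ S := by
    intro w hw
    rw [trace_outside h.mem h.closed hw]
    ext u
    simp only [Set.mem_image, Set.mem_ofPred_eq, Set.mem_inter_iff]
    constructor
    · rintro ⟨i, ⟨h1, h2⟩, rfl⟩
      exact ⟨⟨i, h1, rfl⟩, h2⟩
    · rintro ⟨⟨i, h1, rfl⟩, h2⟩
      exact ⟨i, ⟨h1, h2⟩, rfl⟩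
  simp only [hX]
  refine ⟨fun v hvS h1 h2 => ?_, fun u v huS hvS h1 h2 => ?_⟩
  · by_cases hvX : v ∈ X
    · exact ht v hvX (hmemX v hvS) (by simp [h1])
    · rw [h.trace_compl_outside hS' hvX] at h2
      refine hS.1 v (hmemO v hvX hvS) ?_ h2
      rw [hJ v hvX, Set.image_eq_empty] at h1
      simp [hO v hvX, h1]
  -- Inside `X` an outside vertex sees boundary vertices only, and `ht` excludes such a trace for
  -- the vertices of `X` outside `S'`. No information on the state is needed.
  · have OI : ∀ w v, w ∉ X → v ∈ X → v ∉ S \ X ∪ S' →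
        trace G' X S' w = trace G' X S' v → False := by
      intro w v hw hvX hvS h1
      refine ht v hvX (hmemX v hvS) ?_
      rw [← h1, hJ w hw]
      exact Set.image_subset_range _ _
    by_cases huX : u ∈ X
    · by_cases hvX : v ∈ X
      · exact hv.2 u huX v hvX (fun h => hmemX u huS (hb h)) (fun h => hmemX v hvS (hb h))
          (hmemX u huS) (hmemX v hvS) h1
      · exact (OI v u hvX huX huS h1.symm).elim
    · by_cases hvX : v ∈ X
      · exact (OI u v huX hvX hvS h1).elim
      · rw [h.trace_compl_outside hS' huX, h.trace_compl_outside hS' hvX] at h2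
        -- The whole boundary is in the new set, so the new traces of outside vertices determine the
        -- old ones.
        rw [hJ u huX, hJ v hvX] at h1
        refine hS.2 u v (hmemO u huX huS) (hmemO v hvX hvS) ?_ h2
        rw [hO u huX, hO v hvX, image_eq_image_of_eq_iff h.eq_iff h1]

end Twin

/-- The extra cost of a set that does not interfere with the outside of a piece. -/
abbrev slack (ι : Type*) [Fintype ι] : ℕ := Fintype.card ι + 2 ^ Fintype.card ι

/-- Add the boundary, and then all vertices whose trace is contained in the boundary. Validity
survives because the traces for a smaller set are restrictions of those for a larger one. The
vertices added last are separated by `S`, hence by their traces in the boundary, so there are at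
most `2 ^ Fintype.card ι` of them. -/
theorem exists_top [Finite V] [Fintype ι] (hb : ∀ i, b i ∈ X) (hS : S ⊆ X) (hv : Valid G X b S) :
    ∃ S' ⊆ X, Valid G X b S' ∧ Set.range b ⊆ S' ∧
      (∀ v ∈ X, v ∉ S' → ¬trace G X S' v ⊆ Set.range b) ∧ S'.ncard ≤ S.ncard + slack ι := by
  classical
  let T : Set V := S ∪ Set.range b
  let Y : Set V := {v | v ∈ X ∧ v ∉ T ∧ trace G X T v ⊆ Set.range b}
  have mono : ∀ {A B : Set V} (v : V), A ⊆ B → trace G X A v = trace G X B v ∩ A := by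
    intro A B v hAB
    ext u
    simp only [trace, Set.mem_ofPred_eq, Set.mem_inter_iff]
    have := @hAB u
    tauto
  have hST : S ⊆ T := Set.subset_union_left
  have hTY : T ⊆ T ∪ Y := Set.subset_union_left
  have hSY : S ⊆ T ∪ Y := hST.trans hTY
  have hTb : ∀ v, v ∉ T → v ∉ Set.range b := fun v h h' => h (Or.inr h')
  refine ⟨T ∪ Y, ?_, ⟨?_, ?_⟩, Set.subset_union_right.trans hTY, ?_, ?_⟩
  · rintro v ((hv | ⟨i, rfl⟩) | hv)
    exacts [hS hv, hb i, hv.1]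
  · intro v hvX hvb hvS h0
    refine hv.1 v hvX hvb (fun h => hvS (hSY h)) ?_
    rw [mono v hSY, h0, Set.empty_inter]
  · intro u hu v hvX hub hvb huS hvS he
    refine hv.2 u hu v hvX hub hvb (fun h => huS (hSY h)) (fun h => hvS (hSY h)) ?_
    rw [mono u hSY, he, ← mono v hSY]
  · intro v hvX hvS hsub
    refine hvS (Or.inr ⟨hvX, fun h => hvS (hTY h), ?_⟩)
    rw [mono v hTY]
    exact Set.inter_subset_left.trans hsub
  · have h1 : Y.ncard ≤ 2 ^ Fintype.card ι := by
      rw [← Fintype.card_set, ← Nat.card_eq_fintype_card, ← Set.ncard_univ]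
      refine Set.ncard_le_ncard_of_injOn (fun v => {i | b i ∈ trace G X T v}) (fun _ _ => trivial)
        ?_ (Set.toFinite _)
      intro u hu v hvY he
      have hsub : ∀ u ∈ Y, trace G X T u = b '' {i | b i ∈ trace G X T u} := by
        intro u hu
        refine Set.Subset.antisymm ?_ ?_
        · intro x hx
          obtain ⟨i, rfl⟩ := hu.2.2 hx
          exact ⟨i, hx, rfl⟩
        · rintro _ ⟨i, hi, rfl⟩
          exact hi
      refine hv.2 u hu.1 v hvY.1 (hTb u hu.2.1) (hTb v hvY.2.1) (fun h => hu.2.1 (hST h))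
        (fun h => hvY.2.1 (hST h)) ?_
      simp only at he
      rw [mono u hST, mono v hST, hsub u hu, hsub v hvY, he]
    have h2 : (Set.range b).ncard ≤ Fintype.card ι := by
      rw [← Set.image_univ, ← Nat.card_eq_fintype_card, ← Set.ncard_univ]
      exact Set.ncard_image_le (Set.toFinite _)
    have h3 : T.ncard ≤ _ := Set.ncard_union_le S (Set.range b)
    have h4 := Set.ncard_union_le T Y
    simp only [slack]
    omega

/-- The least size of a valid set. -/
noncomputable def minValid (G : SimpleGraph V) (X : Set V) (b : ι → V) : ℕ :=
  sInf {m | ∃ S ⊆ X, Valid G X b S ∧ S.ncard = m}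

theorem exists_minValid (G : SimpleGraph V) (X : Set V) (b : ι → V) :
    ∃ S ⊆ X, Valid G X b S ∧ S.ncard = minValid G X b :=
  Nat.sInf_mem (s := {m | ∃ S ⊆ X, Valid G X b S ∧ S.ncard = m})
    ⟨X.ncard, X, subset_rfl, ⟨fun _ hv _ h => absurd hv h, fun _ hu _ _ _ _ h => absurd hu h⟩, rfl⟩

theorem minValid_le (hS : S ⊆ X) (hv : Valid G X b S) : minValid G X b ≤ S.ncard :=
  Nat.sInf_le ⟨S, hS, hv, rfl⟩

theorem minValid_le_ncard [Finite V] (G : SimpleGraph V) (X : Set V) (b : ι → V) :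
    minValid G X b ≤ X.ncard := by
  obtain ⟨S, hS, -, h⟩ := exists_minValid G X b
  rw [← h]
  exact Set.ncard_le_ncard hS

/-- The states of the valid sets, and their sizes up to a shift and to `slack`. -/
def profile [Fintype ι] (G : SimpleGraph V) (X : Set V) (b : ι → V) :
    State ι → Fin (slack ι) → Prop :=
  fun σ j => ∃ S ⊆ X, Valid G X b S ∧ state G X b S = σ ∧ S.ncard = minValid G X b + j

/-- If the part of `S` in `X` is less than `slack` above the minimum, the equal profiles provide a
part of the other piece in the same state and equally far from its minimum. Otherwise a minimum
valid set of the other piece, made independent of the outside by `exists_top`, is cheap enough. -/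
theorem Twin.exists_isLocatingDominating [Finite V] [Fintype ι] (h : Twin G G' X b b')
    (hp : profile G X b = profile G' X b') (hS : IsLocatingDominating G S) :
    ∃ S', IsLocatingDominating G' S' ∧
      S'.ncard + minValid G X b ≤ S.ncard + minValid G' X b' := by
  have hc : ∀ v ∈ X, v ∈ S ↔ v ∈ S ∩ X := fun v hv => by simp [hv]
  have hval : Valid G X b (S ∩ X) :=
    (valid_congr hc).1 (valid_of_isLocatingDominating h.closed hS)
  have hmin := minValid_le Set.inter_subset_right hval
  have hcard : S.ncard = (S \ X).ncard + (S ∩ X).ncard := by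
    rw [← Set.ncard_sdiff_add_ncard_of_subset (Set.inter_subset_left : S ∩ X ⊆ S)]
    simp
  have hle : ∀ S' : Set V, (S \ X ∪ S').ncard ≤ (S \ X).ncard + S'.ncard :=
    fun S' => Set.ncard_union_le _ _
  by_cases hj : (S ∩ X).ncard - minValid G X b < slack ι
  · have : profile G X b (state G X b (S ∩ X)) ⟨_, hj⟩ :=
      ⟨S ∩ X, Set.inter_subset_right, hval, rfl, by simp only; omega⟩
    rw [hp] at this
    obtain ⟨S', hS', hv', hst, hc'⟩ := this
    refine ⟨S \ X ∪ S', h.replace hS hS' hv' ((state_congr h.mem hc).trans hst.symm), ?_⟩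
    have := hle S'
    simp only at hc'
    omega
  · obtain ⟨S0, hS0, hv0, hc0⟩ := exists_minValid G' X b'
    obtain ⟨S', hS', hv', hb', ht', hc'⟩ := exists_top h.mem' hS0 hv0
    refine ⟨S \ X ∪ S', h.replace_top hS hS' hv' hb' ht', ?_⟩
    have := hle S'
    omega

end Pieces

/-! ### Transport of profiles along copies of pieces -/

section Copies

variable {V W ι : Type*}

/-- The map `f` embeds the piece `X` of `G` into the piece `Y` of `H`, the vertices of `Y` outside
of the image forming a set `Z` of isolated vertices of the piece. -/
structure IsCopy (G : SimpleGraph V) (X : Set V) (H : SimpleGraph W) (Y : Set W) (f : V → W)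
    (Z : Set W) : Prop where
  injOn : Set.InjOn f X
  eq : Y = f '' X ∪ Z
  disj : Disjoint (f '' X) Z
  adj : ∀ u ∈ X, ∀ v ∈ X, H.Adj (f u) (f v) ↔ G.Adj u v
  isolated : ∀ z ∈ Z, ∀ u ∈ Y, ¬H.Adj z u

namespace IsCopy

variable {G : SimpleGraph V} {X : Set V} {H : SimpleGraph W} {Y : Set W} {f : V → W} {Z : Set W}
  {b : ι → V} {S : Set V}

theorem trace_eq (h : IsCopy G X H Y f Z) (hS : S ⊆ X) {v : V} (hv : v ∈ X) :
    trace H Y (f '' S ∪ Z) (f v) = f '' trace G X S v := by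
  ext u
  simp only [trace, Set.mem_ofPred_eq, Set.mem_image]
  constructor
  · rintro ⟨hu, hu' | hu', huv⟩
    · obtain ⟨w, hw, rfl⟩ := hu'
      exact ⟨w, ⟨hS hw, hw, (h.adj v hv w (hS hw)).1 huv⟩, rfl⟩
    · exact absurd huv.symm (h.isolated u hu' _ (h.eq ▸ Or.inl ⟨v, hv, rfl⟩))
  · rintro ⟨w, ⟨hw, hwS, hvw⟩, rfl⟩
    exact ⟨h.eq ▸ Or.inl ⟨w, hw, rfl⟩, Or.inl ⟨w, hwS, rfl⟩, (h.adj v hv w hw).2 hvw⟩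

theorem mem_iff (h : IsCopy G X H Y f Z) (hS : S ⊆ X) {v : V} (hv : v ∈ X) :
    f v ∈ f '' S ∪ Z ↔ v ∈ S := by
  constructor
  · rintro (⟨w, hw, hwv⟩ | hz)
    · exact h.injOn (hS hw) hv hwv ▸ hw
    · exact (Set.disjoint_left.1 h.disj ⟨v, hv, rfl⟩ hz).elim
  · exact fun hv => Or.inl ⟨v, hv, rfl⟩

theorem image_trace_inj (h : IsCopy G X H Y f Z) {A B : Set V} (hA : A ⊆ X) (hB : B ⊆ X) :
    f '' A = f '' B ↔ A = B :=
  h.injOn.image_eq_image_iff hA hB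

theorem trace_subset (v : V) : trace G X S v ⊆ X := fun _ hu => hu.1

theorem range_iff (h : IsCopy G X H Y f Z) (hb : ∀ i, b i ∈ X) {v : V} (hv : v ∈ X) :
    f v ∈ Set.range (f ∘ b) ↔ v ∈ Set.range b := by
  constructor
  · rintro ⟨i, hi⟩
    exact ⟨i, h.injOn (hb i) hv hi⟩
  · rintro ⟨i, rfl⟩
    exact ⟨i, rfl⟩

/-- The vertices outside of a set that contains the isolated ones come from the first piece. -/
theorem exists_iff (h : IsCopy G X H Y f Z) (hb : ∀ i, b i ∈ X) (hS : S ⊆ X) (P : W → Prop) :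
    (∃ v ∈ Y, v ∉ Set.range (f ∘ b) ∧ v ∉ f '' S ∪ Z ∧ P v) ↔
      ∃ v ∈ X, v ∉ Set.range b ∧ v ∉ S ∧ P (f v) := by
  constructor
  · rintro ⟨w, hw, h1, h2, h3⟩
    rw [h.eq] at hw
    obtain ⟨v, hv, rfl⟩ | hw := hw
    · exact ⟨v, hv, (h.range_iff hb hv).not.1 h1, (h.mem_iff hS hv).not.1 h2, h3⟩
    · exact absurd (Or.inr hw) h2
  · rintro ⟨v, hv, h1, h2, h3⟩
    exact ⟨f v, h.eq ▸ Or.inl ⟨v, hv, rfl⟩, (h.range_iff hb hv).not.2 h1,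
      (h.mem_iff hS hv).not.2 h2, h3⟩

theorem state_eq (h : IsCopy G X H Y f Z) (hb : ∀ i, b i ∈ X) (hS : S ⊆ X) :
    state H Y (f ∘ b) (f '' S ∪ Z) = state G X b S := by
  have hJ : ∀ J, b '' J ⊆ X := by
    rintro J _ ⟨i, -, rfl⟩
    exact hb i
  simp only [state, h.exists_iff hb hS, Prod.mk.injEq, funext_iff, eq_iff_iff, Function.comp_apply]
  refine ⟨fun i => h.mem_iff hS (hb i), fun J => ?_, fun i J => ?_, fun i => ?_, fun i j => ?_⟩
  · refine exists_congr fun v => and_congr_right fun hv => ?_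
    rw [h.trace_eq hS hv, ← Set.image_image f b, h.image_trace_inj (trace_subset v) (hJ J)]
  · rw [h.trace_eq hS (hb i), ← Set.image_image f b, h.image_trace_inj (trace_subset _) (hJ J)]
  · refine exists_congr fun v => and_congr_right fun hv => ?_
    rw [h.trace_eq hS hv, h.trace_eq hS (hb i),
      h.image_trace_inj (trace_subset v) (trace_subset _)]
  · rw [h.trace_eq hS (hb i), h.trace_eq hS (hb j),
      h.image_trace_inj (trace_subset _) (trace_subset _)]

theorem valid_iff (h : IsCopy G X H Y f Z) (hb : ∀ i, b i ∈ X) (hS : S ⊆ X) :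
    Valid H Y (f ∘ b) (f '' S ∪ Z) ↔ Valid G X b S := by
  have hY : ∀ v ∈ X, f v ∈ Y := fun v hv => h.eq ▸ Or.inl ⟨v, hv, rfl⟩
  constructor
  · intro hv
    refine ⟨fun v hvX hvb hvS h0 => ?_, fun u hu v hvX hub hvb huS hvS he => ?_⟩
    · refine hv.1 _ (hY v hvX) ((h.range_iff hb hvX).not.2 hvb) ((h.mem_iff hS hvX).not.2 hvS) ?_
      rw [h.trace_eq hS hvX, h0, Set.image_empty]
    · refine h.injOn hu hvX (hv.2 _ (hY u hu) _ (hY v hvX) ((h.range_iff hb hu).not.2 hub)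
        ((h.range_iff hb hvX).not.2 hvb) ((h.mem_iff hS hu).not.2 huS)
        ((h.mem_iff hS hvX).not.2 hvS) ?_)
      rw [h.trace_eq hS hu, h.trace_eq hS hvX, he]
  · intro hv
    refine ⟨fun w hwY hwb hwS h0 => ?_, fun u' hu v' hvX hub hvb huS hvS he => ?_⟩
    · rw [h.eq] at hwY
      obtain ⟨v, hvX, rfl⟩ | hw := hwY
      · refine hv.1 v hvX ((h.range_iff hb hvX).not.1 hwb) ((h.mem_iff hS hvX).not.1 hwS) ?_
        rwa [h.trace_eq hS hvX, Set.image_eq_empty] at h0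
      · exact hwS (Or.inr hw)
    · rw [h.eq] at hu hvX
      obtain ⟨u, hu, rfl⟩ | hu := hu
      swap
      · exact absurd (Or.inr hu) huS
      obtain ⟨v, hvX, rfl⟩ | hvX := hvX
      swap
      · exact absurd (Or.inr hvX) hvS
      rw [h.trace_eq hS hu, h.trace_eq hS hvX,
        h.image_trace_inj (trace_subset _) (trace_subset _)] at he
      rw [hv.2 u hu v hvX ((h.range_iff hb hu).not.1 hub) ((h.range_iff hb hvX).not.1 hvb)
        ((h.mem_iff hS hu).not.1 huS) ((h.mem_iff hS hvX).not.1 hvS) he]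

theorem ncard_eq [Finite V] [Finite W] (h : IsCopy G X H Y f Z) (hS : S ⊆ X) :
    (f '' S ∪ Z).ncard = S.ncard + Z.ncard := by
  rw [Set.ncard_union_eq (h.disj.mono_left (Set.image_mono hS)),
    (h.injOn.mono hS).ncard_image]

/-- Nothing dominates the isolated vertices `Z` of the piece, and none of them is a boundary vertex,
so every valid set contains them. -/
theorem exists_of_valid (h : IsCopy G X H Y f Z) (hb : ∀ i, b i ∈ X) {T : Set W} (hT : T ⊆ Y)
    (hv : Valid H Y (f ∘ b) T) : ∃ S ⊆ X, T = f '' S ∪ Z := by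
  have hZ : Z ⊆ T := by
    intro z hz
    by_contra hzT
    refine hv.1 z (h.eq ▸ Or.inr hz) ?_ hzT ?_
    · rintro ⟨i, rfl⟩
      exact Set.disjoint_left.1 h.disj ⟨b i, hb i, rfl⟩ hz
    · exact Set.eq_empty_iff_forall_notMem.2 fun u hu => h.isolated z hz u hu.1 hu.2.2
  refine ⟨{v | v ∈ X ∧ f v ∈ T}, fun v hv => hv.1, Set.Subset.antisymm ?_ ?_⟩
  · intro w hw
    have := hT hw
    rw [h.eq] at this
    obtain ⟨v, hv, rfl⟩ | hz := this
    · exact Or.inl ⟨v, ⟨hv, hw⟩, rfl⟩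
    · exact Or.inr hz
  · rintro _ (⟨v, hv, rfl⟩ | hz)
    exacts [hv.2, hZ hz]

theorem minValid_eq [Finite V] [Finite W] (h : IsCopy G X H Y f Z) (hb : ∀ i, b i ∈ X) :
    minValid H Y (f ∘ b) = minValid G X b + Z.ncard := by
  apply le_antisymm
  · obtain ⟨S, hS, hv, hc⟩ := exists_minValid G X b
    rw [← hc, ← h.ncard_eq hS]
    refine minValid_le ?_ ((h.valid_iff hb hS).2 hv)
    rw [h.eq]
    exact Set.union_subset_union_left _ (Set.image_mono hS)
  · obtain ⟨T, hT, hv, hc⟩ := exists_minValid H Y (f ∘ b)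
    obtain ⟨S, hS, rfl⟩ := h.exists_of_valid hb hT hv
    rw [← hc, h.ncard_eq hS]
    exact Nat.add_le_add_right (minValid_le hS ((h.valid_iff hb hS).1 hv)) _

theorem profile_eq [Finite V] [Finite W] [Fintype ι] (h : IsCopy G X H Y f Z)
    (hb : ∀ i, b i ∈ X) : profile H Y (f ∘ b) = profile G X b := by
  funext σ j
  rw [eq_iff_iff]
  simp only [profile, h.minValid_eq hb]
  constructor
  · rintro ⟨T, hT, hv, hst, hc⟩
    obtain ⟨S, hS, rfl⟩ := h.exists_of_valid hb hT hv
    rw [h.state_eq hb hS] at hst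
    rw [h.ncard_eq hS] at hc
    exact ⟨S, hS, (h.valid_iff hb hS).1 hv, hst, by omega⟩
  · rintro ⟨S, hS, hv, hst, hc⟩
    refine ⟨f '' S ∪ Z, ?_, (h.valid_iff hb hS).2 hv, (h.state_eq hb hS).trans hst, ?_⟩
    · rw [h.eq]
      exact Set.union_subset_union_left _ (Set.image_mono hS)
    · rw [h.ncard_eq hS]
      omega

end IsCopy

/-- All valid sets are in the same state if the boundary is empty. -/
theorem profile_isEmpty [IsEmpty ι] [Fintype ι] {G : SimpleGraph V} {H : SimpleGraph W} (X : Set V)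
    (Y : Set W) (b : ι → V) (b' : ι → W) : profile G X b = profile H Y b' := by
  have key : ∀ {S : Set V} {S' : Set W}, Valid G X b S → Valid H Y b' S' →
      state G X b S = state H Y b' S' := by
    intro S S' h h'
    simp only [state, Prod.mk.injEq, funext_iff, IsEmpty.forall_iff, and_true, true_and,
      eq_iff_iff]
    intro J
    -- The only boundary set is empty, and validity says that no interior vertex outside the set has
    -- the empty trace.
    rw [Set.eq_empty_of_isEmpty J, Set.image_empty, Set.image_empty]
    constructor
    · rintro ⟨v, h1, h2, h3, h4⟩
      exact absurd h4 (h.1 v h1 h2 h3)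
    · rintro ⟨v, h1, h2, h3, h4⟩
      exact absurd h4 (h'.1 v h1 h2 h3)
  funext σ j
  -- Here `slack` is `0 + 2 ^ 0 = 1`, so a profile records minimum sets only.
  have hj : (j : ℕ) = 0 := by
    have h1 := j.2
    simp only [slack, Fintype.card_eq_zero, pow_zero] at h1
    omega
  rw [eq_iff_iff]
  simp only [profile, hj, add_zero]
  constructor
  · rintro ⟨S, -, hv, rfl, -⟩
    obtain ⟨S', h1, h2, h3⟩ := exists_minValid H Y b'
    exact ⟨S', h1, h2, (key hv h2).symm, h3⟩
  · rintro ⟨S, -, hv, rfl, -⟩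
    obtain ⟨S', h1, h2, h3⟩ := exists_minValid G X b
    exact ⟨S', h1, h2, key h2 hv, h3⟩

end Copies

/-! ### Collapsing a piece to a smaller one -/

section Collapse

variable {V W ι : Type*}

/-- The number of ordered pairs of adjacent vertices in `X`. -/
noncomputable def innerDarts (G : SimpleGraph V) (X : Set V) : ℕ :=
  {p : V × V | p.1 ∈ X ∧ p.2 ∈ X ∧ G.Adj p.1 p.2}.ncard

/-- The number of ordered pairs of adjacent vertices. -/
noncomputable def darts (G : SimpleGraph V) : ℕ := {p : V × V | G.Adj p.1 p.2}.ncard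

/-- The number of connected components. -/
noncomputable def comps (G : SimpleGraph V) : ℕ := Nat.card G.ConnectedComponent

open Classical in
/-- The map that sends `X \ Y` to `r`. -/
noncomputable def collapseMap (X Y : Set V) (r v : V) : V := if v ∈ X ∧ v ∉ Y then r else v

/-- The part `X \ Y` of the piece `X` is shrunk to the vertex `r` of `Y`. The vertices of `X \ Y`
stay as isolated vertices. -/
def collapse (G : SimpleGraph V) (X Y : Set V) (r : V) : SimpleGraph V where
  -- Edges inside `X` survive only if both ends are in `Y`. Edges from `X \ Y` to the outside are
  -- attached to `r`.
  Adj u v := u ≠ v ∧ ∃ u' v', G.Adj u' v' ∧ (u' ∈ X → v' ∈ X → u' ∈ Y ∧ v' ∈ Y) ∧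
    collapseMap X Y r u' = u ∧ collapseMap X Y r v' = v
  symm := ⟨fun _ _ ⟨h, u', v', h1, h2, h3, h4⟩ =>
    ⟨h.symm, v', u', h1.symm, fun a b => (h2 b a).symm, h4, h3⟩⟩
  loopless := ⟨fun _ h => h.1 rfl⟩

variable {G : SimpleGraph V} {X Y : Set V} {r : V} {b b' : ι → V}

theorem collapseMap_of_mem {v : V} (h : v ∈ X) (h' : v ∉ Y) : collapseMap X Y r v = r := by
  simp [collapseMap, h, h']

theorem collapseMap_of_mem_right {v : V} (h : v ∈ Y) : collapseMap X Y r v = v := by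
  simp [collapseMap, h]

theorem collapseMap_of_notMem {v : V} (h : v ∉ X) : collapseMap X Y r v = v := by
  simp [collapseMap, h]

theorem collapseMap_notMem (hr : r ∈ Y) {v : V} : ¬(collapseMap X Y r v ∈ X ∧
    collapseMap X Y r v ∉ Y) := by
  unfold collapseMap
  split_ifs with h
  · exact fun h => h.2 hr
  · exact h

theorem collapseMap_mem (hYX : Y ⊆ X) (hr : r ∈ Y) {v : V} : collapseMap X Y r v ∈ X ↔ v ∈ X := by
  unfold collapseMap
  split_ifs with h
  · simp [h.1, hYX hr]
  · rfl

theorem collapse_isolated (hr : r ∈ Y) {z u : V} (hz : z ∈ X) (hz' : z ∉ Y) :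
    ¬(collapse G X Y r).Adj z u := by
  rintro ⟨-, u', v', -, -, rfl, -⟩
  exact collapseMap_notMem hr ⟨hz, hz'⟩

theorem collapse_adj_inner (hYX : Y ⊆ X) (hr : r ∈ Y) {u v : V} (hu : u ∈ Y) (hv : v ∈ Y) :
    (collapse G X Y r).Adj u v ↔ G.Adj u v := by
  constructor
  · rintro ⟨-, u', v', h, hk, rfl, rfl⟩
    obtain ⟨h1, h2⟩ := hk ((collapseMap_mem hYX hr).1 (hYX hu))
      ((collapseMap_mem hYX hr).1 (hYX hv))
    rwa [collapseMap_of_mem_right h1, collapseMap_of_mem_right h2]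
  · exact fun h => ⟨h.ne, u, v, h, fun _ _ => ⟨hu, hv⟩, collapseMap_of_mem_right hu,
      collapseMap_of_mem_right hv⟩

theorem collapse_adj_outside (hYX : Y ⊆ X) (hr : r ∈ Y) {w u : V} (hw : w ∉ X) :
    (collapse G X Y r).Adj w u ↔ ∃ v, G.Adj w v ∧ collapseMap X Y r v = u := by
  constructor
  · rintro ⟨-, u', v', h, hk, rfl, rfl⟩
    rw [collapseMap_mem hYX hr] at hw
    exact ⟨v', by rwa [collapseMap_of_notMem hw], rfl⟩
  · rintro ⟨v, h, rfl⟩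
    refine ⟨?_, w, v, h, fun h => absurd h hw, collapseMap_of_notMem hw, rfl⟩
    by_cases hv : v ∈ X
    · rintro rfl
      exact hw ((collapseMap_mem hYX hr).2 hv)
    · rw [collapseMap_of_notMem hv]
      exact h.ne

/-- The labelled piece `(X, b)` is obtained from `(Y, b')` by growing trees at the vertex `r`. -/
structure Grows (G : SimpleGraph V) (Y X : Set V) (b' b : ι → V) (r : V) : Prop where
  subset : Y ⊆ X
  root : r ∈ Y
  nonempty : (X \ Y).Nonempty
  mem : ∀ i, b i ∈ X
  mem' : ∀ i, b' i ∈ Y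
  cut : ∀ u ∈ Y, ∀ v ∈ X, v ∉ Y → G.Adj u v → u = r
  label : ∀ i, collapseMap X Y r (b i) = b' i
  -- One edge, that is two darts, for each vertex of `X \ Y`. This pays for the component that the
  -- vertex forms after the collapse, and it is all that is needed of the connectedness of what is
  -- attached.
  count : innerDarts G Y + 2 * (X \ Y).ncard ≤ innerDarts G X

/-- The vertices of the piece `(X, b)` other than the boundary vertices have no neighbours
outside. -/
def Closed (G : SimpleGraph V) (X : Set V) (b : ι → V) : Prop :=
  ∀ v ∈ X, v ∉ Set.range b → ∀ w, w ∉ X → ¬G.Adj v w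

/-- Passing from `G` to `G'` changes the least size of a locating-dominating set by `q - p`, removes
edges and does not increase the cyclomatic number. -/
structure Reduces (G G' : SimpleGraph V) (p q : ℕ) : Prop where
  forth : ∀ S, IsLocatingDominating G S → ∃ S', IsLocatingDominating G' S' ∧
    S'.ncard + p ≤ S.ncard + q
  back : ∀ S, IsLocatingDominating G' S → ∃ S', IsLocatingDominating G S' ∧
    S'.ncard + q ≤ S.ncard + p
  darts_lt : darts G' < darts G
  darts_add_comps_le : darts G' + 2 * comps G' ≤ darts G + 2 * comps G

namespace Grows

/-- An edge that leaves `X` starts at a boundary vertex, and the collapse moves its end as it moves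
the label: `b i` goes to `b' i`. -/
theorem twin (h : Grows G Y X b' b r) (hc : Closed G X b) (he : ∀ i j, b i = b j ↔ b' i = b' j) :
    Twin G (collapse G X Y r) X b b' where
  mem := h.mem
  mem' i := h.subset (h.mem' i)
  out u v hu hv := by
    rw [collapse_adj_outside h.subset h.root hu]
    constructor
    · exact fun ha => ⟨v, ha, collapseMap_of_notMem hv⟩
    · rintro ⟨v', ha, rfl⟩
      rw [collapseMap_mem h.subset h.root] at hv
      rwa [collapseMap_of_notMem hv]
  boundary w hw i := by
    rw [collapse_adj_outside h.subset h.root hw]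
    constructor
    · exact fun ha => ⟨b i, ha, h.label i⟩
    · rintro ⟨v, ha, hv⟩
      have hvX : v ∈ X := (collapseMap_mem h.subset h.root).1 (hv ▸ h.subset (h.mem' i))
      by_cases hvb : v ∈ Set.range b
      · obtain ⟨j, rfl⟩ := hvb
        rw [h.label, ← he] at hv
        rwa [← hv]
      · exact absurd ha.symm (hc v hvX hvb w hw)
  closed := hc
  closed' v hv hvb w hw ha := by
    rw [SimpleGraph.adj_comm, collapse_adj_outside h.subset h.root hw] at ha
    obtain ⟨u, ha, rfl⟩ := ha
    have huX : u ∈ X := (collapseMap_mem h.subset h.root).1 hv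
    by_cases hub : u ∈ Set.range b
    · obtain ⟨j, rfl⟩ := hub
      exact hvb ⟨j, (h.label j).symm⟩
    · exact absurd ha.symm (hc u huX hub w hw)
  eq_iff := he

theorem isCopy (h : Grows G Y X b' b r) : IsCopy G Y (collapse G X Y r) X id (X \ Y) where
  injOn := Set.injOn_id _
  eq := by rw [Set.image_id, Set.union_sdiff_cancel h.subset]
  disj := by
    rw [Set.image_id]
    exact Set.disjoint_sdiff_right
  adj _ hu _ hv := collapse_adj_inner h.subset h.root hu hv
  isolated _ hz _ _ := collapse_isolated h.root hz.1 hz.2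

variable [Finite V]

/-- All edges of the collapsed graph are images of edges that do not lie in `X` or do lie in `Y`.
The edges lost are those counted by `count`. -/
theorem darts_collapse (h : Grows G Y X b' b r) :
    darts (collapse G X Y r) + 2 * (X \ Y).ncard ≤ darts G := by
  let A : Set (V × V) := {p | p.1 ∈ X ∧ p.2 ∈ X ∧ G.Adj p.1 p.2}
  let B : Set (V × V) := {p | p.1 ∈ Y ∧ p.2 ∈ Y ∧ G.Adj p.1 p.2}
  let D : Set (V × V) := {p | G.Adj p.1 p.2}
  have hBA : B ⊆ A := fun p hp => ⟨h.subset hp.1, h.subset hp.2.1, hp.2.2⟩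
  have hAD : A ⊆ D := fun p hp => hp.2.2
  have h1 : darts (collapse G X Y r) ≤ (D \ (A \ B)).ncard := by
    refine le_trans (Set.ncard_le_ncard (t := Prod.map (collapseMap X Y r) (collapseMap X Y r) ''
      (D \ (A \ B))) ?_) (Set.ncard_image_le (Set.toFinite _))
    rintro ⟨u, v⟩ ⟨-, u', v', ha, hk, rfl, rfl⟩
    refine ⟨(u', v'), ⟨ha, fun hAB => ?_⟩, rfl⟩
    obtain ⟨h1, h2⟩ := hk hAB.1.1 hAB.1.2.1
    exact hAB.2 ⟨h1, h2, ha⟩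
  have h2 := Set.ncard_sdiff_add_ncard_of_subset (Set.sdiff_subset.trans hAD : A \ B ⊆ D)
  have h3 := Set.ncard_sdiff_add_ncard_of_subset hBA
  have h4 := h.count
  change B.ncard + _ ≤ A.ncard at h4
  change _ ≤ D.ncard
  omega

/-- By `cut`, the collapse map contracts the edges that are deleted and preserves the connection
along all others. So it acts on components, and the only new components it misses are the isolated
vertices `X \ Y`. -/
theorem comps_collapse (h : Grows G Y X b' b r) :
    comps (collapse G X Y r) ≤ comps G + (X \ Y).ncard := by
  have hadj : ∀ u v, G.Adj u v →
      (collapse G X Y r).Reachable (collapseMap X Y r u) (collapseMap X Y r v) := by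
    intro u v huv
    by_cases he : collapseMap X Y r u = collapseMap X Y r v
    · rw [he]
    by_cases hk : u ∈ X → v ∈ X → u ∈ Y ∧ v ∈ Y
    · exact SimpleGraph.Adj.reachable ⟨he, u, v, huv, hk, rfl, rfl⟩
    · exfalso
      push Not at hk
      obtain ⟨hu, hv, hk⟩ := hk
      by_cases huY : u ∈ Y
      · apply he
        rw [collapseMap_of_mem_right huY, collapseMap_of_mem hv (hk huY),
          h.cut u huY v hv (hk huY) huv]
      · apply he
        by_cases hvY : v ∈ Y
        · rw [collapseMap_of_mem hu huY, collapseMap_of_mem_right hvY,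
            h.cut v hvY u hu huY huv.symm]
        · rw [collapseMap_of_mem hu huY, collapseMap_of_mem hv hvY]
  have hreach : ∀ u v, G.Reachable u v →
      (collapse G X Y r).Reachable (collapseMap X Y r u) (collapseMap X Y r v) := by
    rintro u v ⟨p⟩
    induction p with
    | nil => rfl
    | cons ha _ ih => exact (hadj _ _ ha).trans ih
  let F : G.ConnectedComponent ⊕ (X \ Y : Set V) → (collapse G X Y r).ConnectedComponent :=
    Sum.elim (SimpleGraph.ConnectedComponent.lift
      (fun v => (collapse G X Y r).connectedComponentMk (collapseMap X Y r v))
      fun u v p _ => SimpleGraph.ConnectedComponent.sound (hreach u v ⟨p⟩))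
      fun v => (collapse G X Y r).connectedComponentMk v
  have hF : Function.Surjective F := by
    intro c
    induction c using SimpleGraph.ConnectedComponent.ind with
    | h v =>
      by_cases hv : v ∈ X ∧ v ∉ Y
      · exact ⟨Sum.inr ⟨v, hv⟩, rfl⟩
      · refine ⟨Sum.inl (G.connectedComponentMk v), ?_⟩
        change (collapse G X Y r).connectedComponentMk (collapseMap X Y r v) = _
        rw [collapseMap, if_neg hv]
  have := Nat.card_le_card_of_surjective F hF
  rwa [Nat.card_sum, Nat.card_coe_set_eq] at this

/-- A piece can be replaced by a smaller one with the same profile. -/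
theorem reduces [Fintype ι] (h : Grows G Y X b' b r) (hc : Closed G X b)
    (he : ∀ i j, b i = b j ↔ b' i = b' j) (hp : profile G X b = profile G Y b') :
    Reduces G (collapse G X Y r) (minValid G X b) (minValid G Y b' + (X \ Y).ncard) := by
  have ht := h.twin hc he
  have h1 : profile (collapse G X Y r) X b' = _ := h.isCopy.profile_eq h.mem'
  have h2 : minValid (collapse G X Y r) X b' = _ := h.isCopy.minValid_eq h.mem'
  rw [← h2]
  have h3 := h.darts_collapse
  have h4 := h.comps_collapse
  have h5 : 0 < (X \ Y).ncard := (Set.ncard_pos).2 h.nonempty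
  exact ⟨fun S hS => ht.exists_isLocatingDominating (hp.trans h1.symm) hS,
    fun S hS => ht.symm.exists_isLocatingDominating (h1.trans hp.symm) hS, by omega, by omega⟩

end Grows

theorem IsCopy.image {H : SimpleGraph W} {f : V → W} (hf : Set.InjOn f X)
    (ha : ∀ u ∈ X, ∀ v ∈ X, H.Adj (f u) (f v) ↔ G.Adj u v) : IsCopy G X H (f '' X) f ∅ where
  injOn := hf
  eq := by simp
  disj := by simp
  adj := ha
  isolated := by simp

theorem innerDarts_image [Finite V] {H : SimpleGraph W} {f : V → W} (hf : Set.InjOn f X)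
    (ha : ∀ u ∈ X, ∀ v ∈ X, H.Adj (f u) (f v) ↔ G.Adj u v) :
    innerDarts H (f '' X) = innerDarts G X := by
  unfold innerDarts
  rw [← Set.InjOn.ncard_image (f := Prod.map f f) (s := {p | p.1 ∈ X ∧ p.2 ∈ X ∧ G.Adj p.1 p.2})]
  · congr 1
    ext ⟨u, v⟩
    constructor
    · rintro ⟨⟨u, hu, rfl⟩, ⟨v, hv, rfl⟩, huv⟩
      exact ⟨(u, v), ⟨hu, hv, (ha u hu v hv).1 huv⟩, rfl⟩
    · rintro ⟨⟨u, v⟩, ⟨hu, hv, huv⟩, he⟩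
      obtain ⟨rfl, rfl⟩ := Prod.mk.inj he
      exact ⟨⟨u, hu, rfl⟩, ⟨v, hv, rfl⟩, (ha u hu v hv).2 huv⟩
  · rintro ⟨u, v⟩ hp ⟨u', v'⟩ hp' he
    obtain ⟨h1, h2⟩ := Prod.mk.inj he
    exact Prod.ext (hf hp.1 hp'.1 h1) (hf hp.2.1 hp'.2.1 h2)

/-- Used for the soundness of rules: the situation depends on the graph induced on `X` only, so it
recurs wherever the pattern occurs. -/
theorem Grows.image [Finite V] {H : SimpleGraph W} {f : V → W} (h : Grows G Y X b' b r)
    (hf : Set.InjOn f X) (ha : ∀ u ∈ X, ∀ v ∈ X, H.Adj (f u) (f v) ↔ G.Adj u v) :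
    Grows H (f '' Y) (f '' X) (f ∘ b') (f ∘ b) (f r) := by
  have hmem : ∀ v ∈ X, f v ∈ f '' Y ↔ v ∈ Y := fun v hv => by
    rw [hf.mem_image_iff h.subset hv]
  refine ⟨Set.image_mono h.subset, ⟨r, h.root, rfl⟩, ?_, fun i => ⟨b i, h.mem i, rfl⟩,
    fun i => ⟨b' i, h.mem' i, rfl⟩, ?_, fun i => ?_, ?_⟩
  · obtain ⟨v, hv, hvY⟩ := h.nonempty
    exact ⟨f v, ⟨v, hv, rfl⟩, (hmem v hv).not.2 hvY⟩
  · rintro _ ⟨u, hu, rfl⟩ _ ⟨v, hv, rfl⟩ hvY huv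
    rw [hmem v hv] at hvY
    rw [h.cut u hu v hv hvY ((ha u (h.subset hu) v hv).1 huv)]
  · have h2 := h.label i
    rw [Function.comp_apply, Function.comp_apply, ← h2]
    by_cases hY : b i ∈ Y
    · rw [collapseMap_of_mem_right hY, collapseMap_of_mem_right (Set.mem_image_of_mem f hY)]
    · rw [collapseMap_of_mem (h.mem i) hY,
        collapseMap_of_mem (Set.mem_image_of_mem f (h.mem i)) ((hmem _ (h.mem i)).not.2 hY)]
  · rw [innerDarts_image hf ha, innerDarts_image (hf.mono h.subset) fun u hu v hv =>
      ha u (h.subset hu) v (h.subset hv), ← hf.image_sdiff_subset h.subset,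
      (hf.mono Set.sdiff_subset).ncard_image]
    exact h.count

end Collapse

/-! ### The cyclomatic number and feedback edge sets -/

section Forests

variable {V : Type*} [Finite V]

theorem darts_eq_two_mul (G : SimpleGraph V) : darts G = 2 * G.edgeSet.ncard := by
  classical
  have := Fintype.ofFinite V
  have h1 := G.dart_card_eq_twice_card_edges
  rw [← SimpleGraph.coe_edgeFinset G, Set.ncard_coe_finset, ← h1, darts, ← Nat.card_coe_set_eq,
    ← Nat.card_eq_fintype_card]
  exact Nat.card_congr ⟨fun p => ⟨p.1, p.2⟩, fun d => ⟨d.toProd, d.adj⟩, fun _ => rfl, fun _ => rfl⟩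

/-- The components of `G` are mapped injectively to those of `F`, the one that contains the bridge
being sent to the component of `u`. Exactly the component of `v` is missed. -/
theorem comps_deleteEdges {G : SimpleGraph V} {u v : V}
    (hb : ¬(G.deleteEdges {s(u, v)}).Reachable u v) (huv : G.Adj u v) :
    comps (G.deleteEdges {s(u, v)}) = comps G + 1 := by
  classical
  set F := G.deleteEdges {s(u, v)} with hF
  let ψ : V → F.ConnectedComponent := fun a =>
    if F.Reachable a v then F.connectedComponentMk u else F.connectedComponentMk a
  have hle : F ≤ G := G.deleteEdges_le _
  have hu : ψ u = F.connectedComponentMk u := by simp [ψ]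
  have hv : ψ v = F.connectedComponentMk u := by simp [ψ]
  have hadj : ∀ a b, G.Adj a b → ψ a = ψ b := by
    intro a b hab
    by_cases he : s(a, b) = s(u, v)
    · rcases Sym2.eq_iff.1 he with ⟨rfl, rfl⟩ | ⟨rfl, rfl⟩
      · rw [hu, hv]
      · rw [hu, hv]
    · have hF' : F.Adj a b := by
        rw [hF, SimpleGraph.deleteEdges_adj]
        exact ⟨hab, he⟩
      have h1 : F.Reachable a v ↔ F.Reachable b v :=
        ⟨fun h => hF'.reachable.symm.trans h, fun h => hF'.reachable.trans h⟩
      have h2 : F.connectedComponentMk a = F.connectedComponentMk b :=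
        SimpleGraph.ConnectedComponent.sound hF'.reachable
      simp only [ψ, h1, h2]
  have hreach : ∀ a b, G.Reachable a b → ψ a = ψ b := by
    rintro a b ⟨p⟩
    induction p with
    | nil => rfl
    | cons h _ ih => exact (hadj _ _ h).trans ih
  have hself : ∀ a c, ψ a = F.connectedComponentMk c → G.Reachable a c := by
    intro a c h
    simp only [ψ] at h
    split_ifs at h with hav
    · have h1 := (SimpleGraph.ConnectedComponent.exact h).mono hle
      exact ((hav.mono hle).trans huv.symm.reachable).trans h1
    · exact (SimpleGraph.ConnectedComponent.exact h).mono hle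
  let Ψ : G.ConnectedComponent → F.ConnectedComponent :=
    SimpleGraph.ConnectedComponent.lift ψ fun a b p _ => hreach a b ⟨p⟩
  have hinj : Function.Injective Ψ := by
    intro c d
    induction c using SimpleGraph.ConnectedComponent.ind with | h a =>
    induction d using SimpleGraph.ConnectedComponent.ind with | h b =>
    intro h
    change ψ a = ψ b at h
    apply SimpleGraph.ConnectedComponent.sound
    by_cases hbv : F.Reachable b v
    · have h1 : ψ b = F.connectedComponentMk u := by simp [ψ, hbv]
      exact (hself a u (h.trans h1)).trans (hself b u h1).symm
    · exact hself a b (h.trans (by simp [ψ, hbv]))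
  have hrange : Set.range Ψ = {F.connectedComponentMk v}ᶜ := by
    ext c
    induction c using SimpleGraph.ConnectedComponent.ind with | h a =>
    simp only [Set.mem_range, Set.mem_compl_iff, Set.mem_singleton_iff,
      SimpleGraph.ConnectedComponent.eq]
    constructor
    · rintro ⟨c, hc⟩ hav
      induction c using SimpleGraph.ConnectedComponent.ind with | h b =>
      change ψ b = _ at hc
      simp only [ψ] at hc
      split_ifs at hc with hbv
      · exact hb ((SimpleGraph.ConnectedComponent.exact hc).trans hav)
      · exact hbv ((SimpleGraph.ConnectedComponent.exact hc).trans hav)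
    · intro hav
      exact ⟨G.connectedComponentMk a, by change ψ a = _; simp [ψ, hav]⟩
  have h1 := Set.ncard_compl {F.connectedComponentMk v}
  rw [← hrange, Set.ncard_singleton, ← Set.image_univ, Set.ncard_image_of_injective _ hinj,
    Set.ncard_univ] at h1
  have h2 : 0 < Nat.card F.ConnectedComponent :=
    Nat.card_pos_iff.2 ⟨⟨F.connectedComponentMk v⟩, inferInstance⟩
  unfold comps
  omega

theorem edges_add_comps_of_isAcyclic {G : SimpleGraph V} (h : G.IsAcyclic) :
    G.edgeSet.ncard + comps G = Nat.card V := by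
  induction hn : G.edgeSet.ncard generalizing G with
  | zero =>
    rw [Set.ncard_eq_zero, SimpleGraph.edgeSet_eq_empty] at hn
    subst hn
    rw [zero_add]
    refine (Nat.card_congr (Equiv.ofBijective (SimpleGraph.connectedComponentMk ⊥)
      ⟨fun a b hab => ?_, Quot.mk_surjective⟩)).symm
    simpa using hab
  | succ n ih =>
    obtain ⟨e, he⟩ := Set.nonempty_of_ncard_ne_zero (s := G.edgeSet) (by omega)
    induction e with | h u v =>
    have hb := SimpleGraph.isAcyclic_iff_forall_adj_isBridge.1 h he
    rw [SimpleGraph.isBridge_iff] at hb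
    have h1 : comps (G.deleteEdges {s(u, v)}) = comps G + 1 := comps_deleteEdges hb he
    have h2 := ih (G := G.deleteEdges {s(u, v)}) (h.anti (G.deleteEdges_le _)) (by
      rw [SimpleGraph.edgeSet_deleteEdges, Set.ncard_sdiff_singleton_of_mem he]
      omega)
    omega

/-- The feedback edge set number is at least the cyclomatic number. -/
theorem darts_add_comps_le_fes (G : SimpleGraph V) :
    darts G + 2 * comps G ≤ 2 * fes G + 2 * Nat.card V := by
  classical
  have := Fintype.ofFinite V
  have hne : {m | ∃ X : Finset (Sym2 V), IsFeedbackEdgeSet G (X : Set (Sym2 V)) ∧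
      X.card = m}.Nonempty := by
    refine ⟨_, G.edgeFinset, ⟨by simp, ?_⟩, rfl⟩
    rw [SimpleGraph.coe_edgeFinset, SimpleGraph.deleteEdges_eq_bot.2 subset_rfl]
    exact SimpleGraph.isAcyclic_bot
  obtain ⟨X, ⟨hX, hac⟩, hcard⟩ := Nat.sInf_mem hne
  -- Without a minimum feedback edge set the graph is a forest with at least as many components as
  -- before.
  have h1 := edges_add_comps_of_isAcyclic hac
  have h2 : comps G ≤ comps (G.deleteEdges X) :=
    SimpleGraph.ConnectedComponent.card_le_card_of_le (G.deleteEdges_le _)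
  have h3 := Set.ncard_sdiff_add_ncard_of_subset hX
  rw [Set.ncard_coe_finset, ← SimpleGraph.edgeSet_deleteEdges, hcard] at h3
  rw [darts_eq_two_mul]
  change _ + fes G = _ at h3
  omega

theorem fes_le_edges (G : SimpleGraph V) : fes G ≤ G.edgeSet.ncard := by
  classical
  have := Fintype.ofFinite V
  refine Nat.sInf_le ⟨G.edgeFinset, ⟨by simp, ?_⟩, ?_⟩
  · rw [SimpleGraph.coe_edgeFinset, SimpleGraph.deleteEdges_eq_bot.2 subset_rfl]
    exact SimpleGraph.isAcyclic_bot
  · rw [← SimpleGraph.coe_edgeFinset, Set.ncard_coe_finset]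

end Forests

/-! ### Chains of nested pieces -/

section Chains

variable {V : Type*}

/-- A piece with two labelled boundary vertices. -/
structure LabelledPiece (V : Type*) where
  /-- the vertices of the piece -/
  X : Set V
  /-- the boundary vertices, of which `b true` is the one where the piece grows -/
  b : Bool → V

/-- The piece `Q` is obtained from `P` by growing trees at the vertex `P.b true`. -/
def Below (G : SimpleGraph V) (Q P : LabelledPiece V) : Prop :=
  Grows G P.X Q.X P.b Q.b (P.b true)

/-- The point is `cut`: an edge from `P.X` to a vertex of `R.X` outside of `Q.X` starts at the root
of `Q`. If this root lies in `P.X`, its label shows that it is the root of `P`. -/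
theorem Below.trans [Finite V] {G : SimpleGraph V} {P Q R : LabelledPiece V} (h2 : Below G R Q)
    (h1 : Below G Q P) : Below G R P := by
  have hroot : P.b true ∈ P.X := h1.root
  have hQ : Q.b true ∈ P.X → Q.b true = P.b true := fun h => by
    have := h1.label true
    rwa [collapseMap_of_mem_right h] at this
  refine ⟨h1.subset.trans h2.subset, hroot, ?_, h2.mem, h1.mem', fun u hu v hv hvP ha => ?_,
    fun i => ?_, ?_⟩
  · exact h1.nonempty.mono (Set.sdiff_subset_sdiff_left h2.subset)
  · by_cases hvQ : v ∈ Q.X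
    · exact h1.cut u hu v hvQ hvP ha
    · have := h2.cut u (h1.subset hu) v hv hvQ ha
      rw [this]
      exact hQ (this ▸ hu)
  · have l1 := h1.label i
    have l2 := h2.label i
    by_cases hP : R.b i ∈ P.X
    · rw [collapseMap_of_mem_right (h1.subset hP)] at l2
      rw [collapseMap_of_mem_right hP, l2]
      rwa [← l2, collapseMap_of_mem_right hP, l2] at l1
    · rw [collapseMap_of_mem (h2.mem i) hP]
      by_cases hQX : R.b i ∈ Q.X
      · rw [collapseMap_of_mem_right hQX] at l2
        rw [← l2, collapseMap_of_mem hQX hP] at l1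
        exact l1
      · rw [collapseMap_of_mem (h2.mem i) hQX] at l2
        by_cases hQP : Q.b i ∈ P.X
        · rw [collapseMap_of_mem_right hQP] at l1
          rw [← l1, ← l2]
          exact (hQ (l2 ▸ hQP)).symm
        · rw [collapseMap_of_mem (h1.mem i) hQP] at l1
          exact l1
  · have c1 := h1.count
    have c2 := h2.count
    have e1 := Set.ncard_sdiff_add_ncard_of_subset h1.subset
    have e2 := Set.ncard_sdiff_add_ncard_of_subset h2.subset
    have e3 := Set.ncard_sdiff_add_ncard_of_subset (h1.subset.trans h2.subset)
    omega

/-- A list of closed pieces with at most `m` vertices, each growing out of all later ones. -/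
def IsPieceChain (G : SimpleGraph V) (m : ℕ) (l : List (LabelledPiece V)) : Prop :=
  l.Pairwise (Below G) ∧ ∀ P ∈ l, Closed G P.X P.b ∧ P.X.ncard ≤ m

theorem IsPieceChain.cons [Finite V] {G : SimpleGraph V} {m : ℕ} {P Q : LabelledPiece V}
    {l : List (LabelledPiece V)} (h : IsPieceChain G m (P :: l)) (hQ : Below G Q P)
    (hc : Closed G Q.X Q.b) (hm : Q.X.ncard ≤ m) : IsPieceChain G m (Q :: P :: l) := by
  refine ⟨List.pairwise_cons.2 ⟨fun R hR => ?_, h.1⟩, fun R hR => ?_⟩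
  · rcases List.mem_cons.1 hR with rfl | hR
    · exact hQ
    · exact hQ.trans ((List.pairwise_cons.1 h.1).1 R hR)
  · rcases List.mem_cons.1 hR with rfl | hR
    · exact ⟨hc, hm⟩
    · exact h.2 R hR

theorem IsPieceChain.singleton {G : SimpleGraph V} {m : ℕ} {P : LabelledPiece V}
    (hc : Closed G P.X P.b) (hm : P.X.ncard ≤ m) : IsPieceChain G m [P] :=
  ⟨List.pairwise_singleton _ _, by simpa using ⟨hc, hm⟩⟩

theorem innerDarts_union [Finite V] {G : SimpleGraph V} {Z Y : Set V} (hd : Disjoint Z Y) {z y : V}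
    (hz : z ∈ Z) (hy : y ∈ Y) (ha : G.Adj z y) :
    innerDarts G Z + innerDarts G Y + 2 ≤ innerDarts G (Z ∪ Y) := by
  let A : Set V → Set (V × V) := fun X => {p | p.1 ∈ X ∧ p.2 ∈ X ∧ G.Adj p.1 p.2}
  have hne : z ≠ y := ha.ne
  have hzY : z ∉ Y := Set.disjoint_left.1 hd hz
  have hyZ : y ∉ Z := Set.disjoint_right.1 hd hy
  have h1 : (A Z ∪ A Y ∪ {(z, y), (y, z)}).ncard = (A Z).ncard + (A Y).ncard + 2 := by
    rw [Set.ncard_union_eq, Set.ncard_union_eq, Set.ncard_pair]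
    · intro h
      exact hne (Prod.mk.inj h).1
    · rw [Set.disjoint_left]
      rintro ⟨u, v⟩ h h'
      exact Set.disjoint_left.1 hd h.1 h'.1
    · rw [Set.disjoint_left]
      rintro p (h | h) (rfl | rfl)
      exacts [hyZ h.2.1, hyZ h.1, hzY h.1, hzY h.2.1]
  refine h1.symm.trans_le (Set.ncard_le_ncard ?_)
  rintro p ((h | h) | (rfl | rfl))
  exacts [⟨Or.inl h.1, Or.inl h.2.1, h.2.2⟩, ⟨Or.inr h.1, Or.inr h.2.1, h.2.2⟩,
    ⟨Or.inl hz, Or.inr hy, ha⟩, ⟨Or.inr hy, Or.inl hz, ha.symm⟩]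

/-- Hypothesis `ht` says that `Y` spans at least `Y.ncard - 1` edges; together with the edge between
`z` and `y` they yield `count`. A label may lie in `Y` if its counterpart is the vertex `z` to which
`Y` is shrunk. -/
theorem Grows.union [Finite V] {ι : Type*} {G : SimpleGraph V} {Z Y : Set V} {b' b : ι → V}
    (hd : Disjoint Z Y) {z y : V} (hz : z ∈ Z) (hy : y ∈ Y) (ha : G.Adj z y)
    (hcut : ∀ u ∈ Z, ∀ v ∈ Y, G.Adj u v → u = z) (ht : 2 * Y.ncard ≤ innerDarts G Y + 2)
    (hb' : ∀ i, b' i ∈ Z) (hb : ∀ i, b i = b' i ∨ b i ∈ Y ∧ b' i = z) :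
    Grows G Z (Z ∪ Y) b' b z := by
  have hdiff : (Z ∪ Y) \ Z = Y := by
    rw [Set.union_sdiff_left]
    exact hd.symm.sdiff_eq_left
  refine ⟨Set.subset_union_left, hz, ?_, fun i => ?_, hb', fun u hu v hv hvZ huv => ?_, fun i => ?_,
    ?_⟩
  · rw [hdiff]
    exact ⟨y, hy⟩
  · rcases hb i with h | h
    · exact Or.inl (h ▸ hb' i)
    · exact Or.inr h.1
  · exact hcut u hu v (hv.resolve_left hvZ) huv
  · rcases hb i with h | h
    · rw [h, collapseMap_of_mem_right (hb' i)]
    · rw [collapseMap_of_mem (show b i ∈ Z ∪ Y from Or.inr h.1) (Set.disjoint_right.1 hd h.1), h.2]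
  · rw [hdiff]
    have := innerDarts_union hd hz hy ha
    omega

end Chains

/-! ### Decomposition of a forest into pieces -/

section Forest

variable {V : Type*}

/-- The set of vertices of the component of `c`. -/
def reach (F : SimpleGraph V) (c : V) : Set V := {v | F.Reachable c v}

theorem reach_deleteEdges {F : SimpleGraph V} {c d : V} (h : F.Adj c d) :
    reach F c = reach (F.deleteEdges {s(c, d)}) c ∪ reach (F.deleteEdges {s(c, d)}) d := by
  apply Set.Subset.antisymm
  · have key : ∀ u v, F.Reachable u v →
        u ∈ reach (F.deleteEdges {s(c, d)}) c ∪ reach (F.deleteEdges {s(c, d)}) d →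
        v ∈ reach (F.deleteEdges {s(c, d)}) c ∪ reach (F.deleteEdges {s(c, d)}) d := by
      rintro u v ⟨p⟩
      induction p with
      | nil => exact fun h => h
      | @cons a b w hab _ ih =>
        intro hu
        apply ih
        by_cases he : s(a, b) = s(c, d)
        · rcases Sym2.eq_iff.1 he with ⟨rfl, rfl⟩ | ⟨rfl, rfl⟩
          · exact Or.inr (SimpleGraph.Reachable.refl _)
          · exact Or.inl (SimpleGraph.Reachable.refl _)
        · have hab' : (F.deleteEdges {s(c, d)}).Adj a b := by
            rw [SimpleGraph.deleteEdges_adj]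
            exact ⟨hab, he⟩
          rcases hu with hu | hu
          · exact Or.inl (SimpleGraph.Reachable.trans hu hab'.reachable)
          · exact Or.inr (SimpleGraph.Reachable.trans hu hab'.reachable)
    exact fun v hv => key c v hv (Or.inl (SimpleGraph.Reachable.refl _))
  · rintro v (hv | hv)
    · exact SimpleGraph.Reachable.mono (F.deleteEdges_le _) hv
    · exact h.reachable.trans (SimpleGraph.Reachable.mono (F.deleteEdges_le _) hv)

variable [Finite V]

/-- A forest is decomposed at an edge of the root `c` of a component. As long as all chains of
pieces of `G` have at most `M` members, the components without a vertex of `T` are small, and the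
size of the others is linear in the number of their vertices in `T`. -/
theorem forest_pieces {G F : SimpleGraph V} {T : Set V} {M m : ℕ} (hF : F.IsAcyclic) (hFG : F ≤ G)
    (hT : ∀ v, v ∉ T → ∀ w, G.Adj v w → F.Adj v w)
    (hM : ∀ l, IsPieceChain G m l → l.length ≤ M) (hm : (M + 2) * 2 ^ M ≤ m)
    (F₀ : SimpleGraph V) (hF₀ : F₀ ≤ F) (c : V)
    (hc : ∀ v ∈ reach F₀ c, v ≠ c → ∀ w, F.Adj v w → F₀.Adj v w) :
    (reach F₀ c ∩ T = ∅ → ∃ l, IsPieceChain G m (⟨reach F₀ c, fun _ => c⟩ :: l) ∧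
      (reach F₀ c).ncard ≤ 2 ^ (l.length + 1) ∧
      2 * (reach F₀ c).ncard ≤ innerDarts G (reach F₀ c) + 2) ∧
    ((reach F₀ c ∩ T).Nonempty → ∃ a Z l, Z ⊆ reach F₀ c ∧ a ∈ Z ∧ c ∈ Z ∧
      IsPieceChain G m (⟨Z, fun i => if i then c else a⟩ :: l) ∧
      Z.ncard ≤ (l.length + 1) * 2 ^ M ∧
      (c ≠ a → c ∉ T ∧ ∀ w, F₀.Adj c w → w ∈ Z) ∧
      (reach F₀ c).ncard + 2 * (M * 2 ^ M) ≤
        2 * (M * 2 ^ M) * (reach F₀ c ∩ T).ncard + Z.ncard) := by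
  -- Deleting an edge of `F₀` at the root `c` leaves two rooted trees, of which only the roots may
  -- lack edges of `F`. In the second claim `Z` is the piece still open: it reaches from the root
  -- `c` to the vertex `a` where it was started. All vertices outside of `Z` are paid for by the
  -- vertices of `T` but one, at `2 * (M * 2 ^ M)` each.
  induction hn : F₀.edgeSet.ncard using Nat.strong_induction_on generalizing F₀ c with
  | _ n ih =>
  subst hn
  have hP : 0 < 2 ^ M := by positivity
  -- The chain bound `hM` applies to a new piece only after its size is known to be at most `m`.
  -- There is room for an open piece of `M * 2 ^ M` vertices with a tree of `2 ^ M`, and for two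
  -- such trees.
  have hm' : M * 2 ^ M + 2 * 2 ^ M ≤ m := by rwa [← add_mul]
  by_cases hnbr : ∃ d, F₀.Adj c d
  swap
  · have hY : reach F₀ c = {c} := by
      apply Set.Subset.antisymm
      · rintro v ⟨p⟩
        cases p with
        | nil => rfl
        | cons h _ => exact absurd ⟨_, h⟩ hnbr
      · rintro _ rfl
        exact SimpleGraph.Reachable.refl _
    have hcl : ∀ b : Bool → V, (b true = c) → Closed G {c} b := by
      rintro b hb v rfl hv
      exact absurd ⟨true, hb⟩ hv
    rw [hY]
    refine ⟨fun _ => ⟨[], IsPieceChain.singleton (hcl _ rfl) ?_, by simp, by simp⟩, fun hne =>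
      ⟨c, {c}, [], subset_rfl, rfl, rfl, IsPieceChain.singleton (hcl _ rfl) ?_, ?_,
        fun h => absurd rfl h, ?_⟩⟩
    · simp only [Set.ncard_singleton]; omega
    · simp only [Set.ncard_singleton]; omega
    · simp only [Set.ncard_singleton, List.length_nil]; omega
    · have h1 : 1 ≤ ({c} ∩ T : Set V).ncard := (Set.ncard_pos).2 hne
      have h2 := Nat.mul_le_mul_left (2 * (M * 2 ^ M)) h1
      simp only [Set.ncard_singleton]; omega
  obtain ⟨d, hd⟩ := hnbr
  set F₁ := F₀.deleteEdges {s(c, d)} with hF₁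
  have hle : F₁ ≤ F₀ := F₀.deleteEdges_le _
  have hbr : ¬F₁.Reachable c d := by
    have := SimpleGraph.isAcyclic_iff_forall_adj_isBridge.1 (hF.anti hF₀) hd
    rwa [SimpleGraph.isBridge_iff] at this
  have hadj : ∀ u v, F₀.Adj u v → F₁.Adj u v ∨ u = c ∧ v = d ∨ u = d ∧ v = c := by
    intro u v huv
    by_cases he : s(u, v) = s(c, d)
    · exact Or.inr (Sym2.eq_iff.1 he)
    · left
      rw [hF₁, SimpleGraph.deleteEdges_adj]
      exact ⟨huv, he⟩
  have hY : reach F₀ c = reach F₁ c ∪ reach F₁ d := reach_deleteEdges hd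
  set Y := reach F₀ c
  set Y₁ := reach F₁ c with hY₁
  set Y₂ := reach F₁ d with hY₂
  have hdisj : Disjoint Y₁ Y₂ := Set.disjoint_left.2 fun v h1 h2 =>
    hbr (SimpleGraph.Reachable.trans h1 (SimpleGraph.Reachable.symm h2))
  have hcY₁ : c ∈ Y₁ := SimpleGraph.Reachable.refl _
  have hdY₂ : d ∈ Y₂ := SimpleGraph.Reachable.refl _
  have hcY₂ : c ∉ Y₂ := Set.disjoint_left.1 hdisj hcY₁
  have hdY₁ : d ∉ Y₁ := Set.disjoint_right.1 hdisj hdY₂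
  have hY₁Y : Y₁ ⊆ Y := hY ▸ Set.subset_union_left
  have hY₂Y : Y₂ ⊆ Y := hY ▸ Set.subset_union_right
  have hst₁ : ∀ u ∈ Y₁, ∀ v, F₁.Adj u v → v ∈ Y₁ := fun u hu v huv =>
    SimpleGraph.Reachable.trans hu huv.reachable
  have hst₂ : ∀ u ∈ Y₂, ∀ v, F₁.Adj u v → v ∈ Y₂ := fun u hu v huv =>
    SimpleGraph.Reachable.trans hu huv.reachable
  have hnb₁ : ∀ v ∈ Y₁, v ≠ c → ∀ w, F.Adj v w → F₁.Adj v w := by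
    intro v hv hvc w hvw
    rcases hadj v w (hc v (hY₁Y hv) hvc w hvw) with h | ⟨rfl, -⟩ | ⟨rfl, -⟩
    exacts [h, absurd rfl hvc, absurd hv hdY₁]
  have hnb₂ : ∀ v ∈ Y₂, v ≠ d → ∀ w, F.Adj v w → F₁.Adj v w := by
    intro v hv hvd w hvw
    have hvc : v ≠ c := fun h => hcY₂ (h ▸ hv)
    rcases hadj v w (hc v (hY₂Y hv) hvc w hvw) with h | ⟨rfl, -⟩ | ⟨rfl, -⟩
    exacts [h, absurd rfl hvc, absurd rfl hvd]
  have hnbd : ∀ w, F.Adj d w → w ∈ Y₂ ∧ F₁.Adj d w ∨ w = c := by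
    intro w hdw
    rcases hadj d w (hc d (hY₂Y hdY₂) (fun h => hcY₂ (h ▸ hdY₂)) w hdw) with h | ⟨rfl, -⟩ | ⟨-, h⟩
    exacts [Or.inl ⟨hst₂ d hdY₂ w h, h⟩, absurd hdY₂ hcY₂, Or.inr h]
  have hcross : ∀ u ∈ Y₁, ∀ v ∈ Y₂, F.Adj u v → u = c ∧ v = d := by
    intro u hu v hv huv
    by_cases hvd : v = d
    · subst hvd
      rcases hnbd u huv.symm with h | h
      · exact absurd h.1 (Set.disjoint_left.1 hdisj hu)
      · exact ⟨h, rfl⟩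
    · exact absurd (hst₂ v hv u (hnb₂ v hv hvd u huv.symm)) (Set.disjoint_left.1 hdisj hu)
  have hGcd : G.Adj c d := hFG (hF₀ hd)
  have hcardY : Y.ncard = Y₁.ncard + Y₂.ncard := by rw [hY, Set.ncard_union_eq hdisj]
  have hcardT : (Y ∩ T).ncard = (Y₁ ∩ T).ncard + (Y₂ ∩ T).ncard := by
    rw [hY, Set.union_inter_distrib_right, Set.ncard_union_eq
      (hdisj.mono Set.inter_subset_left Set.inter_subset_left)]
  have hlt : F₁.edgeSet.ncard < F₀.edgeSet.ncard := by
    rw [hF₁, SimpleGraph.edgeSet_deleteEdges]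
    exact Set.ncard_sdiff_singleton_lt_of_mem hd
  obtain ⟨ih₁, ih₁'⟩ := ih _ hlt F₁ (hle.trans hF₀) c hnb₁ rfl
  obtain ⟨ih₂, ih₂'⟩ := ih _ hlt F₁ (hle.trans hF₀) d hnb₂ rfl
  clear ih
  rw [← hY₁] at ih₁ ih₁'
  rw [← hY₂] at ih₂ ih₂'
  have hpow : ∀ {l : List (LabelledPiece V)} {P}, IsPieceChain G m (P :: l) →
      2 ^ (l.length + 1) ≤ 2 ^ M := fun h => Nat.pow_le_pow_right (by norm_num) (hM _ h)
  refine ⟨fun h0 => ?_, fun hne => ?_⟩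
  · have hYT : ∀ v ∈ Y, v ∉ T := fun v hv hvT => Set.eq_empty_iff_forall_notMem.1 h0 v ⟨hv, hvT⟩
    obtain ⟨l₁, hl₁, hs₁, ht₁⟩ := ih₁ (Set.eq_empty_of_subset_empty
      (h0 ▸ Set.inter_subset_inter_left _ hY₁Y))
    obtain ⟨l₂, hl₂, hs₂, ht₂⟩ := ih₂ (Set.eq_empty_of_subset_empty
      (h0 ▸ Set.inter_subset_inter_left _ hY₂Y))
    have hp₁ := hpow hl₁
    have hp₂ := hpow hl₂
    have hb₁ : Below G ⟨Y, fun _ => c⟩ ⟨Y₁, fun _ => c⟩ := by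
      unfold Below
      rw [hY]
      exact Grows.union hdisj hcY₁ hdY₂ hGcd
        (fun u hu v hv huv => (hcross u hu v hv (hT u (hYT u (hY₁Y hu)) v huv)).1) ht₂
        (fun _ => hcY₁) (fun _ => Or.inl rfl)
    -- The tree at `d` may serve as the smaller piece too: `c` lies in the part that is shrunk to
    -- `d`, so the label moves from `c` to `d`.
    have hb₂ : Below G ⟨Y, fun _ => c⟩ ⟨Y₂, fun _ => d⟩ := by
      unfold Below
      rw [hY, Set.union_comm]
      exact Grows.union hdisj.symm hdY₂ hcY₁ hGcd.symm
        (fun u hu v hv huv =>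
          (hcross v hv u hu (hT u (hYT u (hY₂Y hu)) v huv).symm).2) ht₁
        (fun _ => hdY₂) (fun _ => Or.inr ⟨hcY₁, rfl⟩)
    have hcl : Closed G Y fun _ : Bool => c := by
      intro v hv hvb w hw hvw
      have hvc : v ≠ c := fun h => hvb ⟨true, h.symm⟩
      exact hw (SimpleGraph.Reachable.trans hv (hc v hv hvc w (hT v (hYT v hv) w hvw)).reachable)
    have hsz : Y.ncard ≤ m := by omega
    have hct := hb₁.count
    have hdf := Set.ncard_sdiff_add_ncard_of_subset hY₁Y
    simp only at hct
    -- The longer chain is prolonged. Both trees obey the size bound of the longer chain, so their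
    -- union obeys the doubled bound, as for Strahler numbers.
    by_cases hl : l₁.length ≤ l₂.length
    · refine ⟨_, hl₂.cons hb₂ hcl hsz, ?_, by omega⟩
      have := Nat.pow_le_pow_right (show 1 ≤ 2 by norm_num) (Nat.succ_le_succ hl)
      rw [List.length_cons, pow_succ]
      simp only [Nat.succ_eq_add_one] at this
      omega
    · refine ⟨_, hl₁.cons hb₁ hcl hsz, ?_, by omega⟩
      have := Nat.pow_le_pow_right (show 1 ≤ 2 by norm_num)
        (Nat.succ_le_succ (le_of_not_ge hl))
      rw [List.length_cons, pow_succ]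
      simp only [Nat.succ_eq_add_one] at this
      omega
  · have hmulM : ∀ {l : List (LabelledPiece V)} {P}, IsPieceChain G m (P :: l) →
        (l.length + 1) * 2 ^ M ≤ M * 2 ^ M := fun h => Nat.mul_le_mul_right _ (hM _ h)
    rcases Set.eq_empty_or_nonempty (Y₁ ∩ T) with h1 | h1
    · rcases Set.eq_empty_or_nonempty (Y₂ ∩ T) with h2 | h2
      · exfalso
        rw [hY, Set.union_inter_distrib_right, h1, h2, Set.union_empty] at hne
        exact Set.not_nonempty_empty hne
      · obtain ⟨l₁, hl₁, hs₁, ht₁⟩ := ih₁ h1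
        obtain ⟨a, Z, l, hZ, haZ, hdZ, hl, hs, hcl, hbd⟩ := ih₂' h2
        have hp₁ := hpow hl₁
        have hmul := hmulM hl
        have hYT : ∀ v ∈ Y₁, v ∉ T := fun v hv hvT =>
          Set.eq_empty_iff_forall_notMem.1 h1 v ⟨hv, hvT⟩
        have hZd : Disjoint Z Y₁ := (hdisj.mono_right hZ).symm
        have hcardZ := Set.ncard_union_eq hZd
        -- The open piece grows by the tree at `c`, and its root moves up from `d` to `c`; the other
        -- label `a` stays.
        refine ⟨a, Z ∪ Y₁, _ :: l, ?_, Or.inl haZ, Or.inr hcY₁, hl.cons ?_ ?_ ?_, ?_, ?_, ?_⟩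
        · exact Set.union_subset (hZ.trans hY₂Y) hY₁Y
        · refine Grows.union hZd hdZ hcY₁ hGcd.symm (fun u hu v hv huv => ?_) ht₁ ?_ ?_
          · exact (hcross v hv u (hZ hu) (hT v (hYT v hv) u huv.symm)).2
          · rintro (_ | _)
            exacts [haZ, hdZ]
          · rintro (_ | _)
            exacts [Or.inl rfl, Or.inr ⟨hcY₁, rfl⟩]
        · intro v hv hvb w hw hvw
          have hvc : v ≠ c := fun h => hvb ⟨true, h.symm⟩
          have hva : v ≠ a := fun h => hvb ⟨false, h.symm⟩
          rcases hv with hv | hv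
          · by_cases hvd : v = d
            · subst hvd
              -- The old root `d` becomes an interior vertex unless it is `a`. For this the
              -- induction carries that a root other than `a` is not in `T` and has its neighbours
              -- in `Z`.
              obtain ⟨hvT, hvZ⟩ := hcl hva
              rcases hnbd w (hT v hvT w hvw) with h | rfl
              · exact hw (Or.inl (hvZ w h.2))
              · exact hw (Or.inr hcY₁)
            · refine (hl.2 _ List.mem_cons_self).1 v hv ?_ w (fun h => hw (Or.inl h)) hvw
              rintro ⟨_ | _, h⟩
              exacts [hva h.symm, hvd h.symm]
          · exact hw (Or.inr (hst₁ v hv w (hnb₁ v hv hvc w (hT v (hYT v hv) w hvw))))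
        · simp only
          omega
        · rw [List.length_cons, add_mul _ 1]
          omega
        · refine fun _ => ⟨hYT c hcY₁, fun w hw => ?_⟩
          rcases hadj c w hw with h | ⟨-, rfl⟩ | ⟨rfl, -⟩
          exacts [Or.inr (hst₁ c hcY₁ w h), Or.inl hdZ, absurd hcY₁ hdY₁]
        · rw [hcardT, h1, Set.ncard_empty, zero_add]
          omega
    · rcases Set.eq_empty_or_nonempty (Y₂ ∩ T) with h2 | h2
      · obtain ⟨l₂, hl₂, hs₂, ht₂⟩ := ih₂ h2
        obtain ⟨a, Z, l, hZ, haZ, hcZ, hl, hs, hcl, hbd⟩ := ih₁' h1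
        have hp₂ := hpow hl₂
        have hmul := hmulM hl
        have hYT : ∀ v ∈ Y₂, v ∉ T := fun v hv hvT =>
          Set.eq_empty_iff_forall_notMem.1 h2 v ⟨hv, hvT⟩
        have hZd : Disjoint Z Y₂ := hdisj.mono_left hZ
        have hcardZ := Set.ncard_union_eq hZd
        -- The tree at `d` is attached to the root `c` of the open piece, and both labels stay.
        refine ⟨a, Z ∪ Y₂, _ :: l, ?_, Or.inl haZ, Or.inl hcZ, hl.cons ?_ ?_ ?_, ?_, ?_, ?_⟩
        · exact Set.union_subset (hZ.trans hY₁Y) hY₂Y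
        · refine Grows.union hZd hcZ hdY₂ hGcd (fun u hu v hv huv => ?_) ht₂ ?_ ?_
          · exact (hcross u (hZ hu) v hv (hT v (hYT v hv) u huv.symm).symm).1
          · rintro (_ | _)
            exacts [haZ, hcZ]
          · exact fun _ => Or.inl rfl
        · intro v hv hvb w hw hvw
          rcases hv with hv | hv
          · exact (hl.2 _ List.mem_cons_self).1 v hv hvb w (fun h => hw (Or.inl h)) hvw
          · by_cases hvd : v = d
            · subst hvd
              rcases hnbd w (hT v (hYT v hv) w hvw) with h | rfl
              · exact hw (Or.inr h.1)
              · exact hw (Or.inl hcZ)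
            · exact hw (Or.inr (hst₂ v hv w (hnb₂ v hv hvd w (hT v (hYT v hv) w hvw))))
        · simp only
          omega
        · rw [List.length_cons, add_mul _ 1]
          omega
        · intro hca
          obtain ⟨hcT, hcw⟩ := hcl hca
          refine ⟨hcT, fun w hw => ?_⟩
          rcases hadj c w hw with h | ⟨-, rfl⟩ | ⟨rfl, -⟩
          exacts [Or.inl (hcw w h), Or.inr hdY₂, absurd hcY₁ hdY₁]
        · rw [hcardT, h2, Set.ncard_empty, add_zero]
          omega
      · obtain ⟨a₁, Z₁, l₁, -, -, -, hl₁, hs₁, -, hbd₁⟩ := ih₁' h1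
        obtain ⟨a₂, Z₂, l₂, -, -, -, hl₂, hs₂, -, hbd₂⟩ := ih₂' h2
        have hmul₁ := hmulM hl₁
        have hmul₂ := hmulM hl₂
        -- Two branches with vertices of `T` meet, and `c` starts a new open piece. The two old ones
        -- have at most `M * 2 ^ M` vertices each, which is covered by the allowance `2 * (M * 2 ^
        -- M)` that occurs in both bounds but is needed only once.
        refine ⟨c, {c}, [], by simpa using hY₁Y hcY₁, rfl, rfl, IsPieceChain.singleton ?_ ?_, ?_,
          fun h => absurd rfl h, ?_⟩
        · rintro v rfl hv
          exact absurd ⟨true, rfl⟩ hv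
        · simp only [Set.ncard_singleton]; omega
        · simp only [Set.ncard_singleton, List.length_nil]; omega
        · rw [hcardT, Nat.mul_add, Set.ncard_singleton]
          omega

/-- If all chains of pieces have at most `M` members and there is no small component, the number of
vertices that are not isolated is linear in the number of vertices whose edges are not all in a
given forest. -/
theorem ncard_not_isolated_le {G F : SimpleGraph V} {T : Set V} {M m : ℕ} (hF : F.IsAcyclic)
    (hFG : F ≤ G) (hT : ∀ v, v ∉ T → ∀ w, G.Adj v w → F.Adj v w)
    (hM : ∀ l, IsPieceChain G m l → l.length ≤ M) (hm : (M + 2) * 2 ^ M ≤ m)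
    (hcomp : ∀ (X : Set V) (r : V), Grows G {r} X Empty.elim Empty.elim r →
      Closed G X Empty.elim → ¬X.ncard ≤ m) :
    {v | ∃ w, G.Adj v w}.ncard ≤ 2 * (M * 2 ^ M) * T.ncard := by
  classical
  have := Fintype.ofFinite V
  have key : ∀ c, ({v | ∃ w, G.Adj v w} ∩ reach F c).ncard ≤
      2 * (M * 2 ^ M) * (T ∩ reach F c).ncard := by
    intro c
    obtain ⟨h1, h2⟩ := forest_pieces hF hFG hT hM hm F le_rfl c fun _ _ _ _ h => h
    rcases Set.eq_empty_or_nonempty (reach F c ∩ T) with h | h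
    · rw [Set.inter_comm T, h, Set.ncard_empty, mul_zero, Nat.le_zero, Set.ncard_eq_zero]
      by_contra hne
      obtain ⟨v, ⟨w, hvw⟩, hv⟩ := Set.nonempty_iff_ne_empty.2 hne
      obtain ⟨l, hl, hs, ht⟩ := h1 h
      have hYT : ∀ v ∈ reach F c, v ∉ T := fun v hv hvT =>
        Set.eq_empty_iff_forall_notMem.1 h v ⟨hv, hvT⟩
      have hst : ∀ u ∈ reach F c, ∀ x, G.Adj u x → x ∈ reach F c := fun u hu x hux =>
        SimpleGraph.Reachable.trans hu (hT u (hYT u hu) x hux).reachable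
      have hw := hst v hv w hvw
      have hc : c ∈ reach F c := SimpleGraph.Reachable.refl _
      have hsub : ({c} : Set V) ⊆ reach F c := by simpa using hc
      -- Without vertices of `T` this is a component of `G` as well. Its boundary is empty, so it
      -- grows out of the single vertex `c` as a piece excluded by `hcomp`.
      refine hcomp (reach F c) c ⟨hsub, rfl, ?_, fun i => i.elim, fun i => i.elim,
        fun u hu _ _ _ _ => hu, fun i => i.elim, ?_⟩ (fun u hu _ x hx hux => hx (hst u hu x hux))
        (hl.2 _ List.mem_cons_self).2
      · by_cases hvc : v = c
        · exact ⟨w, hw, fun h => hvw.ne (hvc.trans (Set.mem_singleton_iff.1 h).symm)⟩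
        · exact ⟨v, hv, hvc⟩
      · have h3 := Set.ncard_sdiff_add_ncard_of_subset hsub
        have h4 : innerDarts G {c} = 0 := by
          rw [innerDarts, Set.ncard_eq_zero]
          refine Set.eq_empty_iff_forall_notMem.2 ?_
          rintro ⟨x, y⟩ ⟨hx, hy, hxy⟩
          exact hxy.ne (hx.trans hy.symm)
        rw [Set.ncard_singleton] at h3
        omega
    · obtain ⟨a, Z, l, hZ, -, -, hl, hs, -, hb⟩ := h2 h
      have h3 := Nat.mul_le_mul_right (2 ^ M) (hM _ hl)
      have h4 : ({v | ∃ w, G.Adj v w} ∩ reach F c).ncard ≤ (reach F c).ncard :=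
        Set.ncard_le_ncard Set.inter_subset_right
      rw [Set.inter_comm T]
      simp only [List.length_cons] at h3
      omega
  have hsum : ∀ A : Set V, A.ncard = ∑ C : F.ConnectedComponent, (A ∩ C.supp).ncard := by
    intro A
    rw [Set.ncard_eq_toFinset_card', Finset.card_eq_sum_card_fiberwise
      (f := F.connectedComponentMk) (t := Finset.univ)
        (fun _ _ => Finset.mem_coe.2 (Finset.mem_univ _))]
    refine Finset.sum_congr rfl fun C _ => ?_
    rw [Set.ncard_eq_toFinset_card']
    congr 1
    ext v
    simp
  rw [hsum, hsum T, Finset.mul_sum]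
  refine Finset.sum_le_sum fun C _ => ?_
  induction C using SimpleGraph.ConnectedComponent.ind with | h c =>
  have hC : (F.connectedComponentMk c).supp = reach F c := by
    ext v
    simp only [SimpleGraph.ConnectedComponent.mem_supp_iff, SimpleGraph.ConnectedComponent.eq]
    exact ⟨fun h => h.symm, fun h => SimpleGraph.Reachable.symm h⟩
  rw [hC]
  exact key c

end Forest

/-! ### Local reduction rules and irreducible graphs -/

/-- A local reduction rule: a pattern graph on `s ≤ m` vertices, the set of those of its vertices
that may have neighbours outside, the set of the vertices to which the pattern is collapsed, the
vertex to which the others are sent, and two numbers whose difference is the change of the least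
size of a locating-dominating set. -/
structure Rule (m : ℕ) where
  /-- the number of vertices of the pattern -/
  s : Fin (m + 1)
  /-- the pattern -/
  pattern : SimpleGraph (Fin s)
  /-- the boundary of the pattern -/
  boundary : Set (Fin s)
  /-- the vertices that are kept -/
  kept : Set (Fin s)
  /-- the vertex to which the others are sent -/
  root : Fin s
  /-- the gain -/
  p : Fin (m + 1)
  /-- the loss -/
  q : Fin (m + 1)

/-- Finiteness allows the list of the sound rules to be a constant of the program; soundness itself
is never decided by it. -/
instance (m : ℕ) : Finite (Rule m) := by
  let e : Rule m → Σ s : Fin (m + 1), SimpleGraph (Fin s) × Set (Fin s) × Set (Fin s) × Fin s ×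
      Fin (m + 1) × Fin (m + 1) :=
    fun R => ⟨R.s, R.pattern, R.boundary, R.kept, R.root, R.p, R.q⟩
  refine Finite.of_injective e ?_
  rintro ⟨s, a, b, c, d, p, q⟩ ⟨s', a', b', c', d', p', q'⟩ h
  obtain ⟨rfl, h⟩ := Sigma.mk.inj_iff.1 h
  simp only [heq_eq_eq, Prod.mk.injEq] at h
  obtain ⟨rfl, rfl, rfl, rfl, rfl, rfl⟩ := h
  rfl

namespace Rule

variable {m : ℕ}

/-- The rule `R` is applicable to `G` at the vertices `x`. -/
structure Matches (R : Rule m) {n : ℕ} (G : SimpleGraph (Fin n)) (x : Fin R.s → Fin n) : Prop where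
  injective : Function.Injective x
  adj : ∀ i j, G.Adj (x i) (x j) ↔ R.pattern.Adj i j
  closed : ∀ i, i ∉ R.boundary → ∀ w, w ∉ Set.range x → ¬G.Adj (x i) w

/-- The result of an application of the rule `R` at the vertices `x`. -/
def apply (R : Rule m) {n : ℕ} (G : SimpleGraph (Fin n)) (x : Fin R.s → Fin n) :
    SimpleGraph (Fin n) :=
  collapse G (Set.range x) (x '' R.kept) (x R.root)

/-- All applications of the rule are correct. -/
def Sound (R : Rule m) : Prop :=
  ∀ (n : ℕ) (G : SimpleGraph (Fin n)) (x : Fin R.s → Fin n), R.Matches G x →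
    Reduces G (R.apply G x) R.p R.q

end Rule

/-- No sound rule is applicable. -/
def Irreducible (m : ℕ) {n : ℕ} (G : SimpleGraph (Fin n)) : Prop :=
  ∀ R : Rule m, R.Sound → ∀ x, ¬R.Matches G x

/-- The graph induced on `X`, with the boundary, `Y` and `r`, is taken as a rule. It is sound
because `profile` and `minValid` are invariant under copies, so at each match the two pieces again
have equal profiles. -/
theorem Grows.exists_rule {m n : ℕ} {ι : Type*} [Fintype ι] {G : SimpleGraph (Fin n)}
    {X Y : Set (Fin n)} {b b' : ι → Fin n} {r : Fin n} (h : Grows G Y X b' b r)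
    (hc : Closed G X b) (he : ∀ i j, b i = b j ↔ b' i = b' j)
    (hp : profile G X b = profile G Y b') (hm : X.ncard ≤ m) : ¬Irreducible m G := by
  classical
  have hmin₁ := minValid_le_ncard G X b
  have hmin₂ := minValid_le_ncard G Y b'
  have hdiff := Set.ncard_sdiff_add_ncard_of_subset h.subset
  let e : X ≃ Fin X.ncard := Finite.equivFinOfCardEq (Nat.card_coe_set_eq X)
  let x : Fin X.ncard → Fin n := fun i => e.symm i
  let root : Fin X.ncard := e ⟨r, h.subset h.root⟩
  let g : Fin n → Fin X.ncard := fun v => if hv : v ∈ X then e ⟨v, hv⟩ else root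
  have hxg : ∀ v ∈ X, x (g v) = v := fun v hv => by simp [x, g, hv]
  have hxX : ∀ i, x i ∈ X := fun i => (e.symm i).2
  have hgx : ∀ i, g (x i) = i := fun i => by simp [x, g]
  -- Both numbers are at most `X.ncard`, since a minimum valid set has no more vertices than its
  -- piece.
  let R : Rule m := ⟨⟨X.ncard, by omega⟩, G.comap x, x ⁻¹' Set.range b, x ⁻¹' Y, root,
    ⟨minValid G X b, by omega⟩, ⟨minValid G Y b' + (X \ Y).ncard, by omega⟩⟩
  have hR : R.Sound := by
    intro n' G' x' hx'
    change Fin X.ncard → Fin n' at x'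
    let f : Fin n → Fin n' := fun v => x' (g v)
    have hf : Set.InjOn f X := by
      intro u hu v hv huv
      rw [← hxg u hu, ← hxg v hv, hx'.injective huv]
    have ha : ∀ u ∈ X, ∀ v ∈ X, G'.Adj (f u) (f v) ↔ G.Adj u v := by
      intro u hu v hv
      refine (hx'.adj _ _).trans ?_
      change G.Adj (x (g u)) (x (g v)) ↔ _
      rw [hxg u hu, hxg v hv]
    have hfX : f '' X = Set.range x' := by
      apply Set.Subset.antisymm
      · rintro _ ⟨v, -, rfl⟩
        exact ⟨_, rfl⟩
      · rintro _ ⟨i, rfl⟩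
        exact ⟨x i, hxX i, by simp only [f, hgx]⟩
    have hfY : f '' Y = x' '' R.kept := by
      apply Set.Subset.antisymm
      · rintro _ ⟨v, hv, rfl⟩
        exact ⟨g v, show x (g v) ∈ Y by rwa [hxg v (h.subset hv)], rfl⟩
      · rintro _ ⟨i, hi, rfl⟩
        exact ⟨x i, hi, by simp only [f, hgx]⟩
    have hfr : f r = x' R.root := by
      simp only [f, g, h.subset h.root, dite_true]
      rfl
    have hcl : Closed G' (f '' X) (f ∘ b) := by
      rintro _ ⟨v, hv, rfl⟩ hvb w hw
      rw [hfX] at hw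
      refine hx'.closed (g v) ?_ w hw
      intro hvb'
      change x (g v) ∈ Set.range b at hvb'
      rw [hxg v hv] at hvb'
      obtain ⟨i, rfl⟩ := hvb'
      exact hvb ⟨i, rfl⟩
    have hcX := IsCopy.image hf ha
    have hcY := IsCopy.image (hf.mono h.subset) fun u hu v hv =>
      ha u (h.subset hu) v (h.subset hv)
    have hred := (h.image hf ha).reduces hcl (fun i j => ?_) (by
      rw [hcX.profile_eq h.mem, hcY.profile_eq h.mem', hp])
    · rw [hcX.minValid_eq h.mem, hcY.minValid_eq h.mem', Set.ncard_empty, add_zero, add_zero,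
        ← hf.image_sdiff_subset h.subset, (hf.mono Set.sdiff_subset).ncard_image, hfX, hfY,
        hfr] at hred
      exact hred
    · simp only [Function.comp_apply]
      rw [hf.eq_iff (h.mem i) (h.mem j),
        hf.eq_iff (h.subset (h.mem' i)) (h.subset (h.mem' j)), he]
  refine fun hirr => hirr R hR x ⟨fun i j hij => ?_, fun i j => Iff.rfl, fun i hi w hw => ?_⟩
  · have := congrArg g hij
    rwa [hgx, hgx] at this
  · refine hc (x i) (hxX i) hi w fun hwX => hw ⟨g w, hxg w hwX⟩

/-- The number of kinds of pieces with two labelled boundary vertices. -/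
noncomputable def kinds : ℕ := Nat.card ((State Bool → Fin (slack Bool) → Prop) × Prop)

/-- The size of the pieces to which rules have to be applied. -/
noncomputable def ruleSize : ℕ := (kinds + 2) * 2 ^ kinds

/-- An irreducible graph has few vertices that are not isolated. -/
theorem Irreducible.ncard_not_isolated_le {n : ℕ} {G : SimpleGraph (Fin n)}
    (h : Irreducible ruleSize G) :
    {v | ∃ w, G.Adj v w}.ncard + 2 * (kinds * 2 ^ kinds) * (2 * n) ≤
      2 * (kinds * 2 ^ kinds) * (darts G + 2 * comps G) := by
  classical
  obtain ⟨F, hFG, hF, hreach⟩ := G.exists_isAcyclic_reachable_eq_le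
  -- Pigeonhole principle: two members of a chain that agree in their profile and in the coincidence
  -- of their labels would make a sound rule applicable.
  have hchain : ∀ l, IsPieceChain G ruleSize l → l.length ≤ kinds := by
    intro l hl
    let τ : LabelledPiece (Fin n) → (State Bool → Fin (slack Bool) → Prop) × Prop :=
      fun P => (profile G P.X P.b, P.b false = P.b true)
    have hnd : (l.map τ).Nodup := by
      rw [List.Nodup, List.pairwise_map]
      refine hl.1.imp_of_mem fun {P Q} hP hQ hPQ he => ?_
      obtain ⟨h1, h2⟩ := Prod.mk.inj he
      refine hPQ.exists_rule (hl.2 P hP).1 ?_ h1 (hl.2 P hP).2 h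
      have h2' := h2.to_iff
      rintro (_ | _) (_ | _)
      exacts [by simp, h2', by rw [eq_comm, h2', eq_comm], by simp]
    have := Fintype.ofFinite ((State Bool → Fin (slack Bool) → Prop) × Prop)
    have := hnd.length_le_card
    rwa [List.length_map, ← Nat.card_eq_fintype_card] at this
  let T : Set (Fin n) := {v | ∃ w, G.Adj v w ∧ ¬F.Adj v w}
  have hle := LocDom.ncard_not_isolated_le (T := T) hF hFG
    (fun v hv w hvw => by_contra fun hF => hv ⟨w, hvw, hF⟩) hchain le_rfl
    (fun X r hX hc hm => hX.exists_rule hc (fun i => i.elim) (profile_isEmpty _ _ _ _) hm h)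
  -- Each vertex of `T` is the start of a dart outside of `F`. The spanning forest `F` has the
  -- components of `G`, hence `2 * (n - comps G)` darts.
  have hT : T.ncard + 2 * n ≤ darts G + 2 * comps G := by
    let A : Set (Fin n × Fin n) := {p | G.Adj p.1 p.2}
    let B : Set (Fin n × Fin n) := {p | F.Adj p.1 p.2}
    have h1 : T.ncard ≤ (A \ B).ncard := by
      refine le_trans (Set.ncard_le_ncard (t := Prod.fst '' (A \ B)) ?_)
        (Set.ncard_image_le (Set.toFinite _))
      rintro v ⟨w, h1, h2⟩
      exact ⟨(v, w), ⟨h1, h2⟩, rfl⟩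
    have h2 : (A \ B).ncard + B.ncard = A.ncard :=
      Set.ncard_sdiff_add_ncard_of_subset fun p hp => hFG hp
    have h3 := edges_add_comps_of_isAcyclic hF
    have h4 := darts_eq_two_mul F
    have h5 : comps F = comps G := by
      unfold comps SimpleGraph.ConnectedComponent
      rw [hreach]
    rw [Nat.card_eq_fintype_card, Fintype.card_fin] at h3
    change B.ncard = _ at h4
    change _ ≤ A.ncard + _
    omega
  have := Nat.mul_le_mul_left (2 * (kinds * 2 ^ kinds)) hT
  rw [mul_add] at this
  omega

/-! ### Further functions computable in polynomial time -/

/-- Growth by a polynomial summand in each step, in contrast to growth by a factor, keeps the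
accumulator polynomial. The invariant serves to bound the summand in terms of the input. -/
theorem PT.fold_of_size_add {step start lst : Data → Data} (hs : PT step) (hi : PT start)
    (hl : PT lst) {C : Data → ℕ} (hC : PolyBdd C) (Inv : Data → Data → Prop)
    (h0 : ∀ x, Inv x (start x))
    (h : ∀ x acc a, Inv x acc → Inv x (step (.cons x (.cons acc a))) ∧
      (step (.cons x (.cons acc a))).size ≤ acc.size + C x) :
    PT fun x => (lst x).toList.foldl (fun acc a => step (.cons x (.cons acc a))) (start x) := by
  have key : ∀ x (l : List Data) acc, Inv x acc →
      (l.foldl (fun acc a => step (.cons x (.cons acc a))) acc).size ≤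
        acc.size + l.length * C x := by
    intro x l
    induction l with
    | nil => simp
    | cons a l ih =>
      intro acc hacc
      obtain ⟨h1, h2⟩ := h x acc a hacc
      have := ih _ h1
      rw [List.foldl_cons, List.length_cons, add_mul]
      omega
  refine fold hs hi hl (hi.polyBdd.add (hl.polyBdd.mul hC)) fun x l hlx => ?_
  refine (key x l _ (h0 x)).trans ?_
  have h1 := hlx.length_le
  have h2 := length_toList_lt (lst x)
  gcongr
  omega

namespace PT

theorem map₂ {f : Data → Data → Data} {lst : Data → Data} (hf : PT fun y => f y.head y.tail)
    (hl : PT lst) : PT fun x => .ofList ((lst x).toList.map (f x)) :=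
  map hf hl

open Classical in
theorem filter₂ {P : Data → Data → Prop} {lst : Data → Data} (hP : PTP fun y => P y.head y.tail)
    (hl : PT lst) : PT fun x => .ofList ((lst x).toList.filter fun a => P x a) :=
  filter hP hl

theorem drop {F U : Data → Data} (hF : PT F) (hU : PT U) :
    PT fun x => .ofList ((F x).toList.drop (U x).toList.length) := by
  have key : ∀ (l : List Data) (y : Data),
      l.foldl (fun acc _ => acc.tail) y = .ofList (y.toList.drop l.length) := by
    intro l
    induction l with
    | nil => simp
    | cons a l ih =>
      intro y
      cases y with
      | nil => simpa using ih Data.nil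
      | cons b c => simpa using ih c
  refine (fold_of_size_add (step := fun y => y.tail.head.tail) PT.id.tail.head.tail hF hU
    (.const 0) (fun _ _ => True) (fun _ => trivial) fun _ acc _ _ => ⟨trivial, ?_⟩).congr
    fun _ => key _ _
  simpa using size_tail_le acc

theorem product {F G : Data → Data} (hF : PT F) (hG : PT G) :
    PT fun x => .ofList ((F x).toList.flatMap fun a => (G x).toList.map fun b => .cons a b) := by
  have h1 : PT fun y => .ofList ((G y.head).toList.map fun b => .cons y.tail b) :=
    map₂ (f := fun y b => .cons y.tail b) (PT.id.head.tail.cons PT.id.tail) (hG.comp PT.id.head)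
  have h2 := map₂ (f := fun x a => .ofList ((G x).toList.map fun b => .cons a b)) h1 hF
  refine h2.flatten.congr fun x => ?_
  simp [List.flatMap_def, Function.comp_def]

theorem iterate {F start lst : Data → Data} (hF : PT F) (hi : PT start) (hl : PT lst)
    {C : Data → ℕ} (hC : PolyBdd C) (Inv : Data → Data → Prop) (h0 : ∀ x, Inv x (start x))
    (h : ∀ x acc, Inv x acc → Inv x (F acc) ∧ (F acc).size ≤ acc.size + C x) :
    PT fun x => F^[(lst x).toList.length] (start x) := by
  refine (fold_of_size_add (step := fun y => F y.tail.head) (hF.comp PT.id.tail.head) hi hl hC Inv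
    h0 fun x acc _ hacc => h x acc hacc).congr fun _ => ?_
  simp only [tail_cons, head_cons]
  exact List.foldl_const _ _ _

end PT

namespace PTP

theorem exists_mem₂ {P : Data → Data → Prop} {lst : Data → Data} (hP : PTP fun y => P y.head y.tail)
    (hl : PT lst) : PTP fun x => ∃ a ∈ (lst x).toList, P x a :=
  exists_mem hP hl

theorem forall_mem₂ {P : Data → Data → Prop} {lst : Data → Data} (hP : PTP fun y => P y.head y.tail)
    (hl : PT lst) : PTP fun x => ∀ a ∈ (lst x).toList, P x a :=
  forall_mem hP hl

theorem length_le {F G : Data → Data} (hF : PT F) (hG : PT G) :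
    PTP fun x => (F x).toList.length ≤ (G x).toList.length :=
  (ne_nil (hF.drop hG)).not.congr fun x => by
    rw [ne_eq, not_not, ← ofList_nil, ofList_injective.eq_iff, List.drop_eq_nil_iff]

theorem length_eq {F G : Data → Data} (hF : PT F) (hG : PT G) :
    PTP fun x => (F x).toList.length = (G x).toList.length :=
  ((length_le hF hG).and (length_le hG hF)).congr fun _ => le_antisymm_iff.symm

end PTP

/-! ### Natural numbers -/

/-- A natural number in unary. -/
def num (i : ℕ) : Data := .ofList (List.replicate i .nil)

@[simp] theorem length_toList_num (i : ℕ) : (num i).toList.length = i := by simp [num]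

theorem num_succ (i : ℕ) : num (i + 1) = .cons .nil (num i) := by simp [num, List.replicate_succ]

theorem size_num (i : ℕ) : (num i).size = 2 * i + 1 := by
  simp [num, size_ofList, Data.size]; omega

theorem num_add (i j : ℕ) : Data.ofList ((num i).toList ++ (num j).toList) = num (i + j) := by
  simp [num, List.replicate_append_replicate]

/-- The value of a list of binary digits, capped at the first value that exceeds `N`. -/
def cappedValue (N : ℕ) (l : List Bool) : ℕ :=
  l.foldr (fun b a => if N < a then a else a + a + b.toNat) 0

/-- A number in binary may be exponential in the size of the input and cannot be written in unary.
Stopping the doubling beyond `N` keeps all values up to `N` and the comparison with `N`. -/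
theorem cappedValue_spec (N : ℕ) (l : List Bool) :
    let v := l.foldr (fun b a => a + a + b.toNat) 0
    (v ≤ N → cappedValue N l = v) ∧ (N < v → N < cappedValue N l) := by
  induction l with
  | nil => simp [cappedValue]
  | cons b l ih =>
    simp only [cappedValue, List.foldr_cons] at ih ⊢
    have hb : b.toNat ≤ 1 := Bool.toNat_le b
    split_ifs with h <;> constructor <;> intro h' <;> omega

theorem value_bits (k : ℕ) : k.bits.foldr (fun b a => a + a + b.toNat) 0 = k := by
  induction k using Nat.binaryRec' with
  | zero => simp
  | bit b n h ih =>
    rw [Nat.bits_append_bit _ _ h, List.foldr_cons, ih, Nat.bit_val]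
    omega

theorem cappedValue_bits (N k : ℕ) :
    (k ≤ N → cappedValue N k.bits = k) ∧ (N < k → N < cappedValue N k.bits) := by
  simpa only [value_bits] using cappedValue_spec N k.bits

open Classical in
/-- The list of binary digits as a unary number, capped by the length of a list. -/
noncomputable def cappedUnary (N l : Data) : Data :=
  num (cappedValue N.toList.length (l.toList.map fun b => decide (b ≠ .nil)))

theorem PT.cappedUnary {N l : Data → Data} (hN : PT N) (hl : PT l) :
    PT fun x => LocDom.cappedUnary (N x) (l x) := by
  classical
  let step : Data → Data := fun y => if (y.tail.head).toList.length ≤ (N y.head).toList.length then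
      (if y.tail.tail ≠ .nil then
        .cons .nil (.ofList (y.tail.head.toList ++ y.tail.head.toList)) else
        (.ofList (y.tail.head.toList ++ y.tail.head.toList))) else y.tail.head
  have hacc : PT fun y => y.tail.head := PT.id.tail.head
  have hstep : PT step := (PT.ite (PTP.length_le hacc (hN.comp PT.id.head))
    (PT.cond PT.id.tail.tail (PT.nil.cons (hacc.append hacc)) (hacc.append hacc)) hacc).congr
    fun y => by
      simp only [step]
      congr
  have hone : ∀ x a b, step (.cons x (.cons (num a) b)) = num (if (N x).toList.length < a then a
      else a + a + (decide (b ≠ .nil)).toNat) := by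
    intro x a b
    simp only [step, head_cons, tail_cons, length_toList_num, num_add]
    by_cases h1 : a ≤ (N x).toList.length
    · rw [if_pos h1, if_neg (not_lt.2 h1)]
      by_cases h2 : b = .nil
      · simp [h2]
      · simp [h2, num_succ]
    · rw [if_neg h1, if_pos (not_le.1 h1)]
  have key : ∀ x (l : List Data) a, l.foldl (fun acc a => step (.cons x (.cons acc a))) (num a) =
      num (l.foldl (fun a b => if (N x).toList.length < a then a
        else a + a + (decide (b ≠ .nil)).toNat) a) := by
    intro x l
    induction l with
    | nil => simp
    | cons b l ih => intro a; rw [List.foldl_cons, hone, ih, List.foldl_cons]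
  -- Only values up to `N` are doubled, so no value exceeds `2 * N + 1`.
  have hbd : ∀ x (l : List Data) a, a ≤ 2 * (N x).toList.length + 1 →
      l.foldl (fun a b => if (N x).toList.length < a then a
        else a + a + (decide (b ≠ .nil)).toNat) a ≤ 2 * (N x).toList.length + 1 := by
    intro x l
    induction l with
    | nil => simp
    | cons b l ih =>
      intro a ha
      rw [List.foldl_cons]
      apply ih
      have := Bool.toNat_le (decide (b ≠ .nil))
      split_ifs <;> omega
  refine (PT.fold hstep (.const (num 0)) hl.reverse
    (B := fun x => (N x).size * 4 + 4) ((hN.polyBdd.mul (.const 4)).add (.const 4))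
    fun x l _ => ?_).congr fun x => ?_
  · rw [key, size_num]
    have h1 := hbd x l 0 (by omega)
    have h2 := length_toList_lt (N x)
    omega
  · rw [key, toList_ofList, List.foldl_reverse]
    unfold LocDom.cappedUnary cappedValue
    rw [List.foldr_map]

/-- Addition of a carry to a list of binary digits. -/
def addCarry : Bool → List Bool → List Bool
  | true, [] => [true]
  | false, l => l
  | true, true :: l => false :: addCarry true l
  | true, false :: l => true :: l

theorem addCarry_bits (k : ℕ) : addCarry true k.bits = (k + 1).bits := by
  induction k using Nat.binaryRec' with
  | zero => simp [addCarry]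
  | bit b n h ih =>
    rw [Nat.bits_append_bit _ _ h]
    cases b with
    | true =>
      rw [addCarry, ih, show Nat.bit true n + 1 = Nat.bit false (n + 1) by
        simp only [Nat.bit_val, Bool.toNat_true, Bool.toNat_false]; omega,
        Nat.bits_append_bit _ _ (by omega)]
    | false =>
      rw [addCarry, show Nat.bit false n + 1 = Nat.bit true n by simp [Nat.bit_val],
        Nat.bits_append_bit _ _ (by simp)]

/-- A list of binary digits as a tree. -/
def ofBits (l : List Bool) : Data := .ofList (l.map ofBool)

/-- One pass over the digits, least significant first: the head of the accumulator is the carry, and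
its tail is the output in reverse. -/
theorem PT.exists_increment : ∃ F : Data → Data, PT F ∧
    ∀ l, F (ofBits l) = ofBits (addCarry true l) := by
  classical
  let one : Data := ofBool true
  let step : Data → Data := fun y => if y.tail.head.head ≠ .nil then
      (if y.tail.tail ≠ .nil then .cons one (.cons .nil y.tail.head.tail) else
        .cons .nil (.cons one y.tail.head.tail)) else
      .cons .nil (.cons (if y.tail.tail ≠ .nil then one else .nil) y.tail.head.tail)
  have hstep : PT step := PT.cond PT.id.tail.head.head
    (PT.cond PT.id.tail.tail ((PT.const one).cons (PT.nil.cons PT.id.tail.head.tail))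
      (PT.nil.cons ((PT.const one).cons PT.id.tail.head.tail)))
    (PT.nil.cons ((PT.cond PT.id.tail.tail (.const one) .nil).cons PT.id.tail.head.tail))
  let out : Data → Data := fun s => if s.head ≠ .nil then .cons one s.tail else s.tail
  have hone : one.size = 3 := by simp [one, ofBool, Data.size]
  have hfold := PT.fold_of_size_add hstep (start := fun _ => .cons one .nil) (.const _) PT.id
    (.const 9) (fun _ _ => True) (fun _ => trivial) fun _ acc a _ => by
      refine ⟨trivial, ?_⟩
      have := size_tail_le acc
      simp only [step, head_cons, tail_cons]
      by_cases h1 : acc.head = .nil <;> by_cases h2 : a = .nil <;>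
        simp [h1, h2, Data.size, hone] <;> omega
  have hout : PT out := PT.cond PT.id.head ((PT.const one).cons PT.id.tail) PT.id.tail
  refine ⟨_, (hout.comp hfold).reverse, ?_⟩
  have key : ∀ (x : Data) (l : List Bool) (c : Bool) (o : Data),
      (out ((l.map ofBool).foldl (fun acc a => step (.cons x (.cons acc a)))
        (.cons (ofBool c) o))).toList.reverse =
        o.toList.reverse ++ (addCarry c l).map ofBool := by
    intro x l
    induction l with
    | nil =>
      intro c o
      cases c <;> simp [out, addCarry, ofBool, one]
    | cons b l ih =>
      intro c o
      rw [List.map_cons, List.foldl_cons]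
      have h1 : step (.cons x (.cons (.cons (ofBool c) o) (ofBool b))) =
          .cons (ofBool (c && b)) (.cons (ofBool (c ^^ b)) o) := by
        cases c <;> cases b <;> simp [step, ofBool, one]
      rw [h1, ih]
      cases c <;> cases b <;> simp [addCarry]
  intro l
  have := key (ofBits l) l true .nil
  simp only [ofBits, toList_ofList, toList_nil, List.reverse_nil, List.nil_append] at this ⊢
  rw [← this]

/-- Unary to binary by counting: one increment for each member of the list. -/
theorem PT.bits {U : Data → Data} (hU : PT U) :
    PT fun x => ofBits (U x).toList.length.bits := by
  obtain ⟨F, hF, hFs⟩ := exists_increment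
  have key : ∀ k, F^[k] .nil = ofBits k.bits := by
    intro k
    induction k with
    | zero => rfl
    | succ k ih => rw [Function.iterate_succ_apply', ih, hFs, addCarry_bits]
  have hfoldl : ∀ l : List Data, l.foldl (fun acc _ => F acc) .nil = ofBits l.length.bits :=
    fun l => (List.foldl_const _ _ _).trans (key _)
  refine (PT.fold (step := fun y => F y.tail.head) (hF.comp PT.id.tail.head) PT.nil hU
    (B := fun x => 1 + (U x).size * 4) ((PolyBdd.const 1).add (hU.polyBdd.mul (.const 4)))
    fun x l hl => ?_).congr fun x => hfoldl _
  refine (congrArg Data.size (hfoldl l)).trans_le ?_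
  refine (size_ofList_le (c := 3) ?_).trans ?_
  · intro a ha
    obtain ⟨b, -, rfl⟩ := List.mem_map.1 ha
    cases b <;> simp [ofBool, Data.size]
  · have h1 := hl.length_le
    have h2 := length_toList_lt (U x)
    have h3 : l.length.bits.length ≤ l.length := by
      rw [Nat.size_eq_bits_len]
      exact Nat.size_le.2 Nat.lt_two_pow_self
    rw [List.length_map]
    omega

/-! ### Graphs as adjacency matrices -/

/-- The adjacency matrix of a graph. -/
noncomputable def matrix {n : ℕ} (G : SimpleGraph (Fin n)) : Data :=
  .ofList (List.ofFn fun i => .ofList (List.ofFn fun j => ofProp (G.Adj i j)))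

/-- The graph `G` with the requirement that there is a locating-dominating set `S` such that
`|S| + k ≤ l`. -/
noncomputable def encodeState {n : ℕ} (G : SimpleGraph (Fin n)) (k l : ℕ) : Data :=
  .cons (matrix G) (.cons (num k) (num l))

/-- The entry of an adjacency matrix at `u`, `v`. -/
def adjD (M u v : Data) : Prop :=
  (Data.ofList ((Data.ofList (M.toList.drop u.toList.length)).head.toList.drop
    v.toList.length)).head ≠ .nil

/-- The list of the vertices, in unary. -/
def verts (M : Data) : Data := .ofList ((List.range M.toList.length).map num)

/-- Equality of numbers in unary. -/
def eqD (u v : Data) : Prop := u.toList.length = v.toList.length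

theorem PTP.adjD {M U V : Data → Data} (hM : PT M) (hU : PT U) (hV : PT V) :
    PTP fun x => adjD (M x) (U x) (V x) :=
  .ne_nil ((hM.drop hU).head.drop hV).head

theorem PTP.eqD {U V : Data → Data} (hU : PT U) (hV : PT V) : PTP fun x => eqD (U x) (V x) :=
  .length_eq hU hV

/-- Each round puts the successor of the head in front. As the head of `nil` is `nil`, the loop
produces n, …, 1; reversal and a final decrement give 0, …, n - 1. -/
theorem PT.verts {M : Data → Data} (hM : PT M) : PT fun x => verts (M x) := by
  have key : ∀ l : List Data, l.foldl (fun acc _ => Data.cons (.cons .nil acc.head) acc) .nil =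
      .ofList ((List.range l.length).map fun i => num (i + 1)).reverse := by
    intro l
    induction l using List.reverseRecOn with
    | nil => rfl
    | append_singleton l a ih =>
      rw [List.foldl_append, ih, List.length_append, List.length_singleton, List.range_succ,
        List.map_append, List.reverse_append]
      simp only [List.foldl_cons, List.foldl_nil, List.map_cons, List.map_nil,
        List.reverse_singleton, List.singleton_append, ofList_cons]
      congr 1
      rw [num_succ]
      congr 1
      rcases hl : l.length with _ | k
      · rfl
      · rw [List.range_succ, List.map_append, List.reverse_append]
        rfl
  have h1 := PT.fold (step := fun y => .cons (.cons .nil y.tail.head.head) y.tail.head)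
    (start := fun _ => .nil) ((PT.nil.cons PT.id.tail.head.head).cons PT.id.tail.head) PT.nil hM
    (B := fun x => 1 + (M x).size * (2 * (M x).size + 2))
    ((PolyBdd.const 1).add (hM.polyBdd.mul (((PolyBdd.const 2).mul hM.polyBdd).add (.const 2))))
    fun x l hl => by
      refine (congrArg Data.size (key l)).trans_le ?_
      have h1 := hl.length_le
      have h2 := length_toList_lt (M x)
      refine (size_ofList_le (c := 2 * (M x).size + 1) ?_).trans ?_
      · intro a ha
        simp only [List.mem_reverse, List.mem_map, List.mem_range] at ha
        obtain ⟨i, hi, rfl⟩ := ha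
        rw [size_num]
        omega
      · simp only [List.length_reverse, List.length_map, List.length_range]
        gcongr
        omega
  have h2 : PT fun x => Data.ofList
      ((List.range (M x).toList.length).map fun i => num (i + 1)).reverse :=
    h1.congr fun x => key _
  refine (PT.map₂ (f := fun _ a => a.tail) PT.id.tail.tail h2.reverse).congr fun x => ?_
  simp [LocDom.verts, Function.comp_def, num_succ]

section Matrix

variable {n : ℕ} {G : SimpleGraph (Fin n)}

theorem length_matrix : (matrix G).toList.length = n := by simp [matrix]

theorem verts_matrix :
    verts (matrix G) = .ofList ((List.finRange n).map fun i : Fin n => num i) := by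
  rw [verts, length_matrix, ← List.map_coe_finRange_eq_range, List.map_map]
  rfl

theorem mem_verts_matrix {a : Data} : a ∈ (verts (matrix G)).toList ↔ ∃ i : Fin n, a = num i := by
  simp [verts_matrix, eq_comm]

theorem exists_verts {P : Data → Prop} :
    (∃ a ∈ (verts (matrix G)).toList, P a) ↔ ∃ i : Fin n, P (num i) := by
  simp [verts_matrix]

theorem forall_verts {P : Data → Prop} :
    (∀ a ∈ (verts (matrix G)).toList, P a) ↔ ∀ i : Fin n, P (num i) := by
  simp [verts_matrix]

theorem head_drop_ofFn {n : ℕ} (f : Fin n → Data) (i : Fin n) :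
    (Data.ofList ((List.ofFn f).drop i)).head = f i := by
  rw [List.drop_eq_getElem_cons (by simp)]
  simp

theorem adjD_matrix {i j : Fin n} : adjD (matrix G) (num i) (num j) ↔ G.Adj i j := by
  rw [adjD, length_toList_num, length_toList_num, matrix, toList_ofList, head_drop_ofFn,
    toList_ofList, head_drop_ofFn, ofProp_ne_nil]

theorem eqD_num {i j : Fin n} : eqD (num i) (num j) ↔ i = j := by
  simp [eqD, Fin.ext_iff]

end Matrix

/-! ### Tuples of vertices -/

/-- The list of all tuples of length `s` of members of a list. -/
def tuples (s : ℕ) (l : Data) : Data :=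
  match s with
  | 0 => .cons .nil .nil
  | s + 1 => .ofList (l.toList.flatMap fun a => (tuples s l).toList.map fun b => .cons a b)

theorem PT.tuples (s : ℕ) {F : Data → Data} (hF : PT F) : PT fun x => tuples s (F x) := by
  induction s with
  | zero => exact PT.const _
  | succ s ih => exact hF.product ih

/-- A coordinate of a tuple. -/
def coord (t : Data) (i : ℕ) : Data := (Data.tail^[i] t).head

theorem PT.coord (i : ℕ) {F : Data → Data} (hF : PT F) : PT fun x => coord (F x) i := by
  refine PT.head (F := fun x => Data.tail^[i] (F x)) ?_
  induction i with
  | zero => exact hF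
  | succ i ih => exact ih.tail.congr fun x => by rw [Function.iterate_succ_apply']

/-- A tuple of vertices as a tree. -/
def tupleData {n s : ℕ} (x : Fin s → Fin n) : Data := .ofList (List.ofFn fun i => num (x i))

theorem coord_tupleData {n s : ℕ} (x : Fin s → Fin n) (i : Fin s) :
    coord (tupleData x) i = num (x i) := by
  have key : ∀ (k : ℕ) (l : List Data), Data.tail^[k] (.ofList l) = .ofList (l.drop k) := by
    intro k
    induction k with
    | zero => simp
    | succ k ih =>
      intro l
      cases l with
      | nil => simpa using ih []
      | cons a l => simpa using ih l
  rw [coord, tupleData, key, head_drop_ofFn]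

theorem mem_tuples {n : ℕ} {G : SimpleGraph (Fin n)} (s : ℕ) {t : Data} :
    t ∈ (tuples s (verts (matrix G))).toList ↔ ∃ x : Fin s → Fin n, t = tupleData x := by
  induction s generalizing t with
  | zero => simp [tuples, tupleData]
  | succ s ih =>
    simp only [tuples, toList_ofList, List.mem_flatMap, List.mem_map, mem_verts_matrix, ih]
    constructor
    · rintro ⟨_, ⟨i, rfl⟩, _, ⟨x, rfl⟩, rfl⟩
      exact ⟨Fin.cons i x, by simp [tupleData]⟩
    · rintro ⟨x, rfl⟩
      exact ⟨_, ⟨x 0, rfl⟩, _, ⟨fun i => x i.succ, rfl⟩, by simp [tupleData]⟩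

/-! ### Application of a rule -/

namespace Rule

variable {m : ℕ} (R : Rule m)

/-- The test whether a rule is applicable. -/
def matchesD (M t : Data) : Prop :=
  (∀ i j : Fin R.s, (eqD (coord t i) (coord t j) ↔ i = j) ∧
    (adjD M (coord t i) (coord t j) ↔ R.pattern.Adj i j)) ∧
  ∀ w ∈ (verts M).toList, (∃ i : Fin R.s, eqD (coord t i) w) ∨
    ∀ i : Fin R.s, i ∈ R.boundary ∨ ¬adjD M (coord t i) w

theorem ptp_matchesD : PTP fun y => R.matchesD y.head y.tail := by
  have hc : ∀ i : Fin R.s, PT fun y => coord y.tail i := fun i => PT.id.tail.coord i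
  have hc' : ∀ i : Fin R.s, PT fun y => coord y.head.tail i := fun i => PT.id.head.tail.coord i
  refine PTP.and (PTP.forall_finite fun i => PTP.forall_finite fun j =>
    ((PTP.eqD (hc i) (hc j)).iff_const _).and
      ((PTP.adjD PT.id.head (hc i) (hc j)).iff_const _)) ?_
  refine PTP.forall_mem₂ (P := fun y w => (∃ i : Fin R.s, eqD (coord y.tail i) w) ∨
    ∀ i : Fin R.s, i ∈ R.boundary ∨ ¬adjD y.head (coord y.tail i) w) ?_ PT.id.head.verts
  exact (PTP.exists_finite fun i => PTP.eqD (hc' i) PT.id.tail).or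
    (PTP.forall_finite fun i => (PTP.const _).or (PTP.adjD PT.id.head.head (hc' i) PT.id.tail).not)

theorem matchesD_iff {n : ℕ} {G : SimpleGraph (Fin n)} {x : Fin R.s → Fin n} :
    R.matchesD (matrix G) (tupleData x) ↔ R.Matches G x := by
  simp only [matchesD, forall_verts, coord_tupleData, eqD_num, adjD_matrix]
  constructor
  · rintro ⟨h1, h2⟩
    refine ⟨fun i j h => (h1 i j).1.1 h, fun i j => (h1 i j).2, fun i hi w hw => ?_⟩
    exact ((h2 w).resolve_left hw i).resolve_left hi
  · intro h
    refine ⟨fun i j => ⟨h.injective.eq_iff, h.adj i j⟩, fun w => ?_⟩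
    by_cases hw : w ∈ Set.range x
    · exact Or.inl hw
    · exact Or.inr fun i => or_iff_not_imp_left.2 fun hi => h.closed i hi w hw

/-- Membership in the pattern. -/
def inX (t u : Data) : Prop := ∃ i : Fin R.s, eqD (coord t i) u

/-- Membership in the kept part. -/
def inY (t u : Data) : Prop := ∃ i : Fin R.s, i ∈ R.kept ∧ eqD (coord t i) u

/-- The vertex `u` is sent to `v`. -/
def mapsD (t u v : Data) : Prop :=
  ((R.inX t u ∧ ¬R.inY t u) ∧ eqD (coord t R.root) v) ∨ (¬(R.inX t u ∧ ¬R.inY t u) ∧ eqD u v)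

/-- Adjacency after the application of the rule. -/
def applyD (M t u v : Data) : Prop :=
  ¬eqD u v ∧ ∃ u' ∈ (verts M).toList, ∃ v' ∈ (verts M).toList, adjD M u' v' ∧
    (R.inX t u' → R.inX t v' → R.inY t u' ∧ R.inY t v') ∧ R.mapsD t u' u ∧ R.mapsD t v' v

variable {R} in
theorem ptp_inX {T U : Data → Data} (hT : PT T) (hU : PT U) : PTP fun x => R.inX (T x) (U x) :=
  PTP.exists_finite fun i => PTP.eqD (hT.coord i) hU

variable {R} in
theorem ptp_inY {T U : Data → Data} (hT : PT T) (hU : PT U) : PTP fun x => R.inY (T x) (U x) :=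
  PTP.exists_finite fun i => (PTP.const _).and (PTP.eqD (hT.coord i) hU)

variable {R} in
theorem ptp_mapsD {T U V : Data → Data} (hT : PT T) (hU : PT U) (hV : PT V) :
    PTP fun x => R.mapsD (T x) (U x) (V x) :=
  have h := (ptp_inX (R := R) hT hU).and (ptp_inY (R := R) hT hU).not
  (h.and (PTP.eqD (hT.coord _) hV)).or (h.not.and (PTP.eqD hU hV))

variable {R} in
theorem ptp_applyD {M T U V : Data → Data} (hM : PT M) (hT : PT T) (hU : PT U) (hV : PT V) :
    PTP fun x => R.applyD (M x) (T x) (U x) (V x) := by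
  refine (PTP.eqD hU hV).not.and ?_
  refine PTP.exists_mem₂ (P := fun x u' => ∃ v' ∈ (verts (M x)).toList, adjD (M x) u' v' ∧
    (R.inX (T x) u' → R.inX (T x) v' → R.inY (T x) u' ∧ R.inY (T x) v') ∧
      R.mapsD (T x) u' (U x) ∧ R.mapsD (T x) v' (V x)) ?_ hM.verts
  refine PTP.exists_mem₂ (P := fun y v' => adjD (M y.head) y.tail v' ∧
    (R.inX (T y.head) y.tail → R.inX (T y.head) v' →
      R.inY (T y.head) y.tail ∧ R.inY (T y.head) v') ∧
      R.mapsD (T y.head) y.tail (U y.head) ∧ R.mapsD (T y.head) v' (V y.head)) ?_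
    (hM.comp PT.id.head).verts
  have hx : PT fun y => y.head.head := PT.id.head.head
  have hu : PT fun y => y.head.tail := PT.id.head.tail
  have hv : PT fun y => y.tail := PT.id.tail
  have ht := hT.comp hx
  exact (PTP.adjD (hM.comp hx) hu hv).and
    (((ptp_inX ht hu).imp ((ptp_inX ht hv).imp ((ptp_inY ht hu).and (ptp_inY ht hv)))).and
      ((ptp_mapsD ht hu (hU.comp hx)).and (ptp_mapsD ht hv (hV.comp hx))))

theorem applyD_iff {n : ℕ} {G : SimpleGraph (Fin n)} {x : Fin R.s → Fin n} {i j : Fin n} :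
    R.applyD (matrix G) (tupleData x) (num i) (num j) ↔ (R.apply G x).Adj i j := by
  have hX : ∀ i : Fin n, R.inX (tupleData x) (num i) ↔ i ∈ Set.range x := by
    intro i
    simp [inX, coord_tupleData, eqD_num]
  have hY : ∀ i : Fin n, R.inY (tupleData x) (num i) ↔ i ∈ x '' R.kept := by
    intro i
    simp only [inY, coord_tupleData, eqD_num]
    rfl
  have hmap : ∀ i j : Fin n, R.mapsD (tupleData x) (num i) (num j) ↔
      collapseMap (Set.range x) (x '' R.kept) (x R.root) i = j := by
    intro i j
    simp only [mapsD, hX, hY, coord_tupleData, eqD_num, collapseMap]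
    split_ifs with h <;> simp only [h, true_and, not_true_eq_false, false_and, or_false,
      not_false_eq_true, false_or]
  simp only [applyD, exists_verts, adjD_matrix, hX, hY, hmap, eqD_num]
  rfl

/-- The adjacency matrix after the application of the rule. -/
noncomputable def applyMatrix (M t : Data) : Data :=
  .ofList ((verts M).toList.map fun u =>
    .ofList ((verts M).toList.map fun v => ofProp (R.applyD M t u v)))

theorem pt_applyMatrix {M T : Data → Data} (hM : PT M) (hT : PT T) :
    PT fun x => R.applyMatrix (M x) (T x) := by
  refine PT.map₂ (f := fun x u => .ofList ((verts (M x)).toList.map fun v =>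
    ofProp (R.applyD (M x) (T x) u v))) ?_ hM.verts
  refine PT.map₂ (f := fun y v => ofProp (R.applyD (M y.head) (T y.head) y.tail v)) ?_
    (hM.comp PT.id.head).verts
  exact ptp_applyD (hM.comp PT.id.head.head) (hT.comp PT.id.head.head) PT.id.head.tail PT.id.tail

theorem matrix_eq_map {n : ℕ} {G H : SimpleGraph (Fin n)} {P : Data → Data → Prop}
    (h : ∀ i j : Fin n, P (num i) (num j) ↔ H.Adj i j) :
    Data.ofList ((verts (matrix G)).toList.map fun u =>
      .ofList ((verts (matrix G)).toList.map fun v => ofProp (P u v))) = matrix H := by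
  simp only [verts_matrix, toList_ofList, List.map_map]
  simp only [matrix, List.ofFn_eq_map]
  refine congrArg Data.ofList (List.map_congr_left fun i _ => ?_)
  refine congrArg Data.ofList (List.map_congr_left fun j _ => ?_)
  simp only [Function.comp_apply, h]

theorem applyMatrix_eq {n : ℕ} (G : SimpleGraph (Fin n)) (x : Fin R.s → Fin n) :
    R.applyMatrix (matrix G) (tupleData x) = matrix (R.apply G x) :=
  matrix_eq_map fun _ _ => R.applyD_iff

end Rule

/-! ### Exhaustive reduction -/

theorem length_verts (M : Data) : (verts M).toList.length = M.toList.length := by simp [verts]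

theorem size_num_append (k : ℕ) (x : Data) :
    (Data.ofList ((num k).toList ++ x.toList)).size = x.size + 2 * k := by
  induction k with
  | zero => simp [num]
  | succ k ih =>
    rw [num_succ, toList_cons, List.cons_append, ofList_cons, Data.size, ih, Data.size]
    omega

theorem size_cons_head_tail_le (x : Data) : x.head.size + x.tail.size ≤ x.size + 1 := by
  cases x <;> simp [Data.size]; omega

/-- The size of an adjacency matrix. -/
theorem size_map_map_le {P : Data → Data → Prop} (l : List Data) :
    (Data.ofList (l.map fun u => .ofList (l.map fun v => ofProp (P u v)))).size ≤
      1 + l.length * (4 * l.length + 2) := by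
  refine (size_ofList_le (c := 4 * l.length + 1) ?_).trans ?_
  · intro a ha
    obtain ⟨u, -, rfl⟩ := List.mem_map.1 ha
    refine (size_ofList_le (c := 3) ?_).trans ?_
    · intro b hb
      obtain ⟨v, -, rfl⟩ := List.mem_map.1 hb
      exact size_ofProp_le _
    · rw [List.length_map]
      omega
  · rw [List.length_map]

section Step

variable {m : ℕ}

open Classical in
/-- The places at which a rule is applicable. -/
noncomputable def Rule.places (R : Rule m) (M : Data) : Data :=
  .ofList ((tuples R.s (verts M)).toList.filter fun t => R.matchesD M t)

theorem Rule.pt_places (R : Rule m) {M : Data → Data} (hM : PT M) : PT fun x => R.places (M x) :=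
  PT.filter₂ (P := fun x t => R.matchesD (M x) t)
    (R.ptp_matchesD.comp ((hM.comp PT.id.head).cons PT.id.tail)) (hM.verts.tuples R.s)

open Classical in
/-- One application of the first applicable rule of a list. -/
noncomputable def stepD : List (Rule m) → Data → Data
  | [], d => d
  | R :: l, d => if R.places d.head ≠ .nil then
      .cons (R.applyMatrix d.head (R.places d.head).head)
        (.cons (.ofList ((num R.p).toList ++ d.tail.head.toList))
          (.ofList ((num R.q).toList ++ d.tail.tail.toList)))
      else stepD l d

theorem pt_stepD (l : List (Rule m)) : PT (stepD l) := by
  induction l with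
  | nil => exact PT.id
  | cons R l ih =>
    have hp := R.pt_places PT.id.head
    exact PT.cond hp ((R.pt_applyMatrix PT.id.head hp.head).cons
      (((PT.const (num R.p)).append PT.id.tail.head).cons
        ((PT.const (num R.q)).append PT.id.tail.tail))) ih

theorem length_head_stepD (l : List (Rule m)) (d : Data) :
    (stepD l d).head.toList.length = d.head.toList.length := by
  induction l with
  | nil => rfl
  | cons R l ih =>
    rw [stepD]
    split_ifs with h
    · simp [Rule.applyMatrix, length_verts]
    · exact ih

theorem size_stepD_le (l : List (Rule m)) (d : Data) : (stepD l d).size ≤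
    d.size + (1 + d.head.toList.length * (4 * d.head.toList.length + 2) + 4 * m + 3) := by
  induction l with
  | nil => exact Nat.le_add_right _ _
  | cons R l ih =>
    rw [stepD]
    split_ifs with h
    · have h1 := size_map_map_le (P := R.applyD d.head (R.places d.head).head) (verts d.head).toList
      have h2 := size_cons_head_tail_le d.tail
      have h3 := size_tail_le d
      have h4 := R.p.is_lt
      have h5 := R.q.is_lt
      rw [length_verts] at h1
      change (R.applyMatrix d.head (R.places d.head).head).size ≤ _ at h1
      rw [Data.size, Data.size, size_num_append, size_num_append]
      omega
    · exact ih

theorem stepD_encodeState (rs : List (Rule m)) (hrs : ∀ R ∈ rs, R.Sound) {n : ℕ}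
    (G : SimpleGraph (Fin n)) (k l : ℕ) :
    (stepD rs (encodeState G k l) = encodeState G k l ∧ ∀ R ∈ rs, ∀ x, ¬R.Matches G x) ∨
    ∃ G' p q, Reduces G G' p q ∧ ¬Irreducible m G ∧
      stepD rs (encodeState G k l) = encodeState G' (p + k) (q + l) := by
  classical
  induction rs with
  | nil => exact Or.inl ⟨rfl, by simp⟩
  | cons R rs ih =>
    have hmem : ∀ t, t ∈ (R.places (matrix G)).toList ↔ ∃ x, t = tupleData x ∧ R.Matches G x := by
      intro t
      simp only [Rule.places, toList_ofList, List.mem_filter, mem_tuples, decide_eq_true_eq]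
      constructor
      · rintro ⟨⟨x, rfl⟩, h⟩
        exact ⟨x, rfl, R.matchesD_iff.1 h⟩
      · rintro ⟨x, rfl, h⟩
        exact ⟨⟨x, rfl⟩, R.matchesD_iff.2 h⟩
    have hhead : (encodeState G k l).head = matrix G := rfl
    rw [stepD, hhead]
    rcases hp : R.places (matrix G) with _ | ⟨t, r⟩
    · rw [if_neg (not_not.2 rfl)]
      refine (ih fun R hR => hrs R (List.mem_cons_of_mem _ hR)).imp_left ?_
      refine fun ⟨h1, h2⟩ => ⟨h1, fun R' hR' => ?_⟩
      rcases List.mem_cons.1 hR' with rfl | hR'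
      · intro x hx
        have := (hmem _).2 ⟨x, rfl, hx⟩
        rw [hp] at this
        simp at this
      · exact h2 R' hR'
    · right
      obtain ⟨x, rfl, hx⟩ := (hmem t).1 (by simp [hp])
      refine ⟨_, _, _, hrs R List.mem_cons_self n G x hx,
        fun hG => hG R (hrs R List.mem_cons_self) x hx, ?_⟩
      rw [if_pos (by simp), head_cons, Rule.applyMatrix_eq]
      simp only [encodeState, tail_cons, head_cons, num_add]

end Step

/-- The list of all sound rules. -/
noncomputable def rules (m : ℕ) : List (Rule m) :=
  (Set.toFinite {R : Rule m | R.Sound}).toFinset.toList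

theorem mem_rules {m : ℕ} {R : Rule m} : R ∈ rules m ↔ R.Sound := by simp [rules]

/-- There is a locating-dominating set `S` such that `|S| + k ≤ l`. -/
def Solvable {V : Type*} (G : SimpleGraph V) (k l : ℕ) : Prop :=
  ∃ S, IsLocatingDominating G S ∧ S.ncard + k ≤ l

/-- Gain and loss are accumulated in two counters, which avoids truncated subtraction. -/
theorem Reduces.solvable_iff {V : Type*} {G G' : SimpleGraph V} {p q : ℕ} (h : Reduces G G' p q)
    (k l : ℕ) : Solvable G k l ↔ Solvable G' (p + k) (q + l) := by
  constructor
  · rintro ⟨S, hS, hle⟩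
    obtain ⟨S', hS', hle'⟩ := h.forth S hS
    exact ⟨S', hS', by omega⟩
  · rintro ⟨S, hS, hle⟩
    obtain ⟨S', hS', hle'⟩ := h.back S hS
    exact ⟨S', hS', by omega⟩

/-- An irreducible graph is a fixed point of the step, so as long as none has been reached, every
step has removed a dart. -/
theorem iterate_stepD (m : ℕ) {n : ℕ} (G : SimpleGraph (Fin n)) (k l t : ℕ) :
    ∃ (G' : SimpleGraph (Fin n)) (k' l' : ℕ),
      (stepD (rules m))^[t] (encodeState G k l) = encodeState G' k' l' ∧
      (Solvable G k l ↔ Solvable G' k' l') ∧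
      darts G' + 2 * comps G' ≤ darts G + 2 * comps G ∧
      (Irreducible m G' ∨ darts G' + t ≤ darts G) := by
  induction t with
  | zero => exact ⟨G, k, l, rfl, Iff.rfl, le_rfl, Or.inr le_rfl⟩
  | succ t ih =>
    obtain ⟨G', k', l', h1, h2, h3, h4⟩ := ih
    rw [Function.iterate_succ_apply', h1]
    obtain ⟨h5, h6⟩ | ⟨G'', p, q, h5, h7, h6⟩ :=
      stepD_encodeState (rules m) (fun R => mem_rules.1) G' k' l'
    · exact ⟨G', k', l', h5, h2, h3, Or.inl fun R hR => h6 R (mem_rules.2 hR)⟩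
    · refine ⟨G'', _, _, h6, h2.trans (h5.solvable_iff _ _), h5.darts_add_comps_le.trans h3, ?_⟩
      have := h5.darts_lt
      have := h4.resolve_left h7
      exact Or.inr (by omega)

/-- The list of the entries of a matrix. -/
def entries (M : Data) : Data := .ofList (M.toList.map toList).flatten

theorem length_entries_matrix {n : ℕ} (G : SimpleGraph (Fin n)) :
    (entries (matrix G)).toList.length = n * n := by
  simp [entries, matrix, List.length_flatten, Function.comp_def]

theorem darts_le {n : ℕ} (G : SimpleGraph (Fin n)) : darts G ≤ n * n := by
  simpa [darts] using Set.ncard_le_card {p : Fin n × Fin n | G.Adj p.1 p.2}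

/-- Exhaustive application of the rules. -/
noncomputable def reduceD (m : ℕ) (d : Data) : Data :=
  (stepD (rules m))^[(entries d.head).toList.length] d

theorem pt_reduceD (m : ℕ) {M K L : Data → Data} (hM : PT M) (hK : PT K) (hL : PT L) :
    PT fun x => reduceD m (.cons (M x) (.cons (K x) (L x))) := by
  refine PT.iterate (F := stepD (rules m)) (lst := fun x => entries (M x)) (pt_stepD _)
    (hM.cons (hK.cons hL)) hM.flatten
    (C := fun x => 1 + (M x).size * (4 * (M x).size + 2) + 4 * m + 3) ?_
    (fun x acc => acc.head.toList.length = (M x).toList.length) (fun x => rfl) fun x acc h => ?_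
  · exact (((PolyBdd.const 1).add (hM.polyBdd.mul
      (((PolyBdd.const 4).mul hM.polyBdd).add (.const 2)))).add (.const _)).add (.const 3)
  · refine ⟨(length_head_stepD _ _).trans h, (size_stepD_le _ _).trans ?_⟩
    have := (length_toList_lt (M x)).le
    rw [h]
    gcongr

theorem reduceD_encodeState (m : ℕ) {n : ℕ} (G : SimpleGraph (Fin n)) (k l : ℕ) :
    ∃ (G' : SimpleGraph (Fin n)) (k' l' : ℕ),
      reduceD m (encodeState G k l) = encodeState G' k' l' ∧
      (Solvable G k l ↔ Solvable G' k' l') ∧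
      darts G' + 2 * comps G' ≤ darts G + 2 * comps G ∧ Irreducible m G' := by
  obtain ⟨G', k', l', h1, h2, h3, h4⟩ := iterate_stepD m G k l (n * n)
  refine ⟨G', k', l', ?_, h2, h3, h4.elim id fun h => ?_⟩
  · rw [← h1, reduceD, encodeState, head_cons, length_entries_matrix]
  -- After `n * n` steps, each of which removed a dart, no dart is left for a further application.
  · intro R hR x hx
    have h5 := (hR n G' x hx).darts_lt
    have h6 := darts_le G
    omega

/-! ### Removal of isolated vertices -/

section Core

variable {V W : Type*}

theorem IsLocatingDominating.mono {G : SimpleGraph V} {S T : Set V} (h : IsLocatingDominating G S)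
    (hST : S ⊆ T) : IsLocatingDominating G T := by
  refine ⟨fun v => (h.1 v).imp (fun hv => hST hv) fun ⟨u, hu, huv⟩ => ⟨u, hST hu, huv⟩,
    fun u v hu hv huv he => h.2 u v (fun h => hu (hST h)) (fun h => hv (hST h)) huv ?_⟩
  rw [← Set.inter_eq_self_of_subset_right hST, ← Set.inter_assoc, he, Set.inter_assoc]

theorem isLocatingDominating_iff_valid {G : SimpleGraph V} {S : Set V} (b : Empty → V) :
    IsLocatingDominating G S ↔ Valid G Set.univ b S := by
  simp [isLocatingDominating_iff Set.univ, Valid, trace, Set.range_eq_empty]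

variable {G : SimpleGraph W} {e : V → W}

theorem isCopy_comap (he : Function.Injective e) (hr : Set.range e = {v | ∃ w, G.Adj v w}) :
    IsCopy (G.comap e) Set.univ G Set.univ e (Set.range e)ᶜ where
  injOn := he.injOn
  eq := by simp
  disj := by simp [disjoint_compl_right]
  adj u _ v _ := Iff.rfl
  isolated z hz u _ h := hz (hr ▸ ⟨u, h⟩)

/-- Isolated vertices belong to every locating-dominating set and neither dominate nor separate
other vertices; their number goes to the counter. Formally, the whole graph is a copy of its core
with empty boundary. -/
theorem solvable_comap [Finite V] [Finite W] (he : Function.Injective e)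
    (hr : Set.range e = {v | ∃ w, G.Adj v w}) (k l : ℕ) :
    Solvable G k l ↔ Solvable (G.comap e) (k + (Set.range e)ᶜ.ncard) l := by
  have h := isCopy_comap he hr
  constructor
  · rintro ⟨T, hT, hle⟩
    rw [isLocatingDominating_iff_valid (e ∘ Empty.elim)] at hT
    obtain ⟨S, hS, rfl⟩ := h.exists_of_valid (fun i => i.elim) (Set.subset_univ _) hT
    rw [h.valid_iff (fun i => i.elim) hS, ← isLocatingDominating_iff_valid] at hT
    rw [h.ncard_eq hS] at hle
    exact ⟨S, hT, by omega⟩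
  · rintro ⟨S, hS, hle⟩
    refine ⟨e '' S ∪ (Set.range e)ᶜ, ?_, ?_⟩
    · rw [isLocatingDominating_iff_valid (e ∘ Empty.elim),
        h.valid_iff (fun i => i.elim) (Set.subset_univ _), ← isLocatingDominating_iff_valid]
      exact hS
    · rw [h.ncard_eq (Set.subset_univ _)]
      omega

theorem darts_comap_le [Finite W] (he : Function.Injective e) : darts (G.comap e) ≤ darts G := by
  refine Set.ncard_le_ncard_of_injOn (Prod.map e e) (fun p hp => hp)
    (he.prodMap he).injOn (Set.toFinite _)

theorem ncard_isolated_le_comps [Finite W] : {v | ∃ w, G.Adj v w}ᶜ.ncard ≤ comps G := by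
  rw [comps, ← Set.ncard_univ]
  refine Set.ncard_le_ncard_of_injOn G.connectedComponentMk (fun _ _ => Set.mem_univ _) ?_
    (Set.toFinite _)
  intro u hu v hv huv
  obtain ⟨p⟩ := SimpleGraph.ConnectedComponent.exact huv
  cases p with
  | nil => rfl
  | cons h _ => exact absurd ⟨_, h⟩ hu

end Core

/-- Supersets of locating-dominating sets are locating-dominating, so a smaller solution can be
enlarged to size exactly `k` as long as there are `k` vertices. -/
theorem Instance.isYes_iff (I : Instance) : I.IsYes ↔ I.k ≤ I.n ∧ Solvable I.graph 0 I.k := by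
  constructor
  · rintro ⟨S, hS, hk⟩
    refine ⟨?_, S, hS, by simp [hk]⟩
    rw [← hk]
    simpa using Finset.card_le_univ S
  · rintro ⟨hk, S, hS, hle⟩
    classical
    obtain ⟨T, hST, -, hT⟩ := Finset.exists_subsuperset_card_eq (s := S.toFinset)
      (t := Finset.univ) (n := I.k) (Finset.subset_univ _)
      (by rwa [← Set.ncard_eq_toFinset_card']) (by simpa using hk)
    exact ⟨T, hS.mono fun v hv => hST (by simpa using hv), hT⟩

/-! ### The kernelization -/

/-- A vertex has a neighbour. -/
def coveredD (M u : Data) : Prop := ∃ w ∈ (verts M).toList, adjD M u w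

theorem PTP.coveredD {M U : Data → Data} (hM : PT M) (hU : PT U) :
    PTP fun x => coveredD (M x) (U x) :=
  PTP.exists_mem₂ (P := fun x w => LocDom.adjD (M x) (U x) w)
    (PTP.adjD (hM.comp PT.id.head) (hU.comp PT.id.head) PT.id.tail) hM.verts

open Classical in
/-- The list of the vertices that are not isolated. -/
noncomputable def coreD (M : Data) : Data :=
  .ofList ((verts M).toList.filter fun u => coveredD M u)

open Classical in
/-- The list of the isolated vertices. -/
noncomputable def isolatedD (M : Data) : Data :=
  .ofList ((verts M).toList.filter fun u => ¬coveredD M u)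

theorem PT.coreD {M : Data → Data} (hM : PT M) : PT fun x => coreD (M x) :=
  PT.filter₂ (P := fun x u => LocDom.coveredD (M x) u)
    (PTP.coveredD (hM.comp PT.id.head) PT.id.tail) hM.verts

theorem PT.isolatedD {M : Data → Data} (hM : PT M) : PT fun x => isolatedD (M x) :=
  (PT.filter₂ (P := fun x u => ¬LocDom.coveredD (M x) u)
    (PTP.coveredD (hM.comp PT.id.head) PT.id.tail).not hM.verts).congr fun x => by
      unfold LocDom.isolatedD
      congr!

/-- The adjacency matrix of an induced subgraph. -/
noncomputable def submatrix (M L : Data) : Data :=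
  .ofList (L.toList.map fun u => .ofList (L.toList.map fun v => ofProp (adjD M u v)))

theorem PT.submatrix {M L : Data → Data} (hM : PT M) (hL : PT L) :
    PT fun x => submatrix (M x) (L x) := by
  refine PT.map₂ (f := fun x u =>
    .ofList ((L x).toList.map fun v => ofProp (LocDom.adjD (M x) u v)))
    ?_ hL
  refine PT.map₂ (f := fun y v => ofProp (LocDom.adjD (M y.head) y.tail v)) ?_ (hL.comp PT.id.head)
  exact PTP.adjD (hM.comp PT.id.head.head) PT.id.head.tail PT.id.tail

/-- A no-instance. -/
def noInstance : Instance := ⟨0, ⊥, 1⟩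

theorem not_isYes_noInstance : ¬noInstance.IsYes := fun h => by
  have := (noInstance.isYes_iff.1 h).1
  simp [noInstance] at this

/-- The encoding of the instance that is obtained from a state by the removal of the isolated
vertices. -/
noncomputable def finishD (M K L : Data) : Data :=
  if K.toList.length + (isolatedD M).toList.length ≤ L.toList.length then
    .cons (submatrix M (coreD M))
      -- The target is capped at the number of remaining vertices. Beyond it the size bound is void,
      -- while `IsYes` asks for the exact size and would fail. The cap also bounds the encoding of
      -- the output.
      (if L.toList.length - (K.toList.length + (isolatedD M).toList.length) ≤
          (coreD M).toList.length then
        ofBits (L.toList.length - (K.toList.length + (isolatedD M).toList.length)).bits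
      else ofBits (coreD M).toList.length.bits)
  else noInstance.encode

theorem PT.finishD {M K L : Data → Data} (hM : PT M) (hK : PT K) (hL : PT L) :
    PT fun x => finishD (M x) (K x) (L x) := by
  have h1 := hK.append hM.isolatedD
  have h2 := hL.drop h1
  refine (PT.ite (PTP.length_le h1 hL) ((hM.submatrix hM.coreD).cons
    (PT.ite (PTP.length_le h2 hM.coreD) h2.bits hM.coreD.bits)) (.const noInstance.encode)).congr
      fun x => ?_
  simp only [toList_ofList, List.length_append, List.length_drop]
  unfold LocDom.finishD
  congr!

theorem Instance.encode_eq (I : Instance) : I.encode = .cons (matrix I.graph) (ofBits I.k.bits) :=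
  rfl

theorem finishD_encodeState {n : ℕ} (G : SimpleGraph (Fin n)) (k l : ℕ) :
    ∃ J : Instance, finishD (matrix G) (num k) (num l) = J.encode ∧
      (Solvable G k l ↔ J.IsYes) ∧ J.n ≤ {v | ∃ w, G.Adj v w}.ncard ∧
      2 * J.graph.edgeSet.ncard + 2 * n ≤
        darts G + 2 * comps G + 2 * {v | ∃ w, G.Adj v w}.ncard ∧ J.k ≤ J.n + 1 := by
  classical
  let L : List (Fin n) := (List.finRange n).filter fun v => ∃ w, G.Adj v w
  have hcov : ∀ i : Fin n, coveredD (matrix G) (num i) ↔ ∃ w, G.Adj i w := fun i => by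
    simp only [coveredD, exists_verts, adjD_matrix]
  have hcore : coreD (matrix G) = .ofList (L.map fun i : Fin n => num i) := by
    simp only [coreD, verts_matrix, toList_ofList, List.filter_map, L, Function.comp_def, hcov]
  have hiso : (isolatedD (matrix G)).toList.length + L.length = n := by
    simp only [isolatedD, verts_matrix, toList_ofList, List.filter_map, List.length_map,
      Function.comp_def, hcov, L]
    have h := List.length_eq_length_filter_add (l := List.finRange n)
      fun v => decide (∃ w, G.Adj v w)
    rw [List.length_finRange] at h
    simp only [decide_not]
    omega
  have hnd : L.Nodup := (List.nodup_finRange n).filter _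
  have hinj : Function.Injective L.get := List.nodup_iff_injective_get.1 hnd
  have hrange : Set.range L.get = {v | ∃ w, G.Adj v w} := by
    ext v
    rw [Set.range_list_get]
    simp [L]
  have hcard : {v | ∃ w, G.Adj v w}.ncard = L.length := by
    rw [← hrange, ← Set.image_univ, Set.ncard_image_of_injective _ hinj, Set.ncard_univ,
      Nat.card_eq_fintype_card, Fintype.card_fin]
  have hcompl : (Set.range L.get)ᶜ.ncard = (isolatedD (matrix G)).toList.length := by
    have h := Set.ncard_add_ncard_compl (Set.range L.get)
    rw [hrange, hcard, Nat.card_eq_fintype_card, Fintype.card_fin] at h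
    rw [hrange]
    omega
  have hsub : submatrix (matrix G) (coreD (matrix G)) = matrix (G.comap L.get) := by
    have hmap : ∀ f : Fin n → Data, L.map f = List.ofFn fun i => f (L.get i) := fun f => by
      conv_lhs => rw [← List.ofFn_get L]
      rw [List.map_ofFn]
      rfl
    simp only [submatrix, hcore, toList_ofList, List.map_map]
    simp only [hmap, Function.comp_def, adjD_matrix]
    rfl
  have hsol := solvable_comap hinj hrange k l
  rw [hcompl] at hsol
  rw [finishD, length_toList_num, length_toList_num]
  set c := (isolatedD (matrix G)).toList.length with hc
  -- Isolated vertices are components of their own, so `n` is at most `comps G` plus the number of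
  -- other vertices.
  have hedges : 2 * (G.comap L.get).edgeSet.ncard + 2 * n ≤
      darts G + 2 * comps G + 2 * {v | ∃ w, G.Adj v w}.ncard := by
    have h1 := darts_comap_le (G := G) hinj
    have h2 := ncard_isolated_le_comps (G := G)
    rw [darts_eq_two_mul] at h1
    rw [← hrange, hcompl] at h2
    omega
  have main : ∀ κ, κ ≤ L.length →
      (Solvable (G.comap L.get) (k + c) l ↔ Solvable (G.comap L.get) 0 κ) →
      (Instance.IsYes ⟨L.length, G.comap L.get, κ⟩ ↔ Solvable G k l) := fun κ h1 h2 => by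
    rw [Instance.isYes_iff, hsol, h2, and_iff_right h1]
  have hle : ∀ S : Set (Fin L.length), S.ncard ≤ L.length := fun S => by
    simpa using Set.ncard_le_card S
  have hcl : (coreD (matrix G)).toList.length = L.length := by simp [hcore]
  rw [hcl]
  split_ifs with h1 h2
  · refine ⟨⟨L.length, G.comap L.get, l - (k + c)⟩, ?_, (main _ h2 ?_).symm, hcard.ge, hedges, by
      dsimp only; omega⟩
    · rw [hsub, Instance.encode_eq]
    · exact exists_congr fun S => and_congr_right fun _ => by omega
  · refine ⟨⟨L.length, G.comap L.get, L.length⟩, ?_, (main _ le_rfl ?_).symm, hcard.ge, hedges,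
      Nat.le_succ _⟩
    · rw [hsub, Instance.encode_eq]
    · exact exists_congr fun S => and_congr_right fun _ => by
        have := hle S
        omega
  · refine ⟨noInstance, rfl, iff_of_false ?_ not_isYes_noInstance, Nat.zero_le _, ?_, le_rfl⟩
    · rw [hsol]
      rintro ⟨S, -, hS⟩
      omega
    · have : noInstance.graph.edgeSet.ncard = 0 := by simp [noInstance]
      omega

/-- The graph after the exhaustive reduction of an instance, and the two numbers. -/
noncomputable def reducedD (x : Data) : Data :=
  reduceD ruleSize (.cons x.head (.cons .nil (cappedUnary x.head x.tail)))

/-- The kernelization, on encodings of instances. -/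
noncomputable def kernelD (x : Data) : Data :=
  if (cappedUnary x.head x.tail).toList.length ≤ x.head.toList.length then
    finishD (reducedD x).head (reducedD x).tail.head (reducedD x).tail.tail
  else noInstance.encode

theorem pt_kernelD : PT kernelD := by
  have h1 : PT fun x => cappedUnary x.head x.tail := PT.id.head.cappedUnary PT.id.tail
  have h2 : PT reducedD := pt_reduceD _ PT.id.head PT.nil h1
  refine (PT.ite (PTP.length_le h1 PT.id.head) (h2.head.finishD h2.tail.head h2.tail.tail)
    (.const noInstance.encode)).congr fun x => ?_
  unfold kernelD
  congr!

/-- The constant of the linear kernel. -/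
noncomputable def kernelConst : ℕ := 4 * (kinds * 2 ^ kinds) + 1

theorem cappedUnary_encode (I : Instance) :
    (I.k ≤ I.n → cappedUnary (matrix I.graph) (ofBits I.k.bits) = num I.k) ∧
    (I.n < I.k → I.n < (cappedUnary (matrix I.graph) (ofBits I.k.bits)).toList.length) := by
  classical
  have h : (ofBits I.k.bits).toList.map (fun b => decide (b ≠ .nil)) = I.k.bits := by
    rw [ofBits, toList_ofList, List.map_map]
    conv_rhs => rw [← List.map_id I.k.bits]
    refine List.map_congr_left fun b _ => ?_
    cases b <;> simp [ofBool]
  have h' := cappedValue_bits I.n I.k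
  have h'' : cappedUnary (matrix I.graph) (ofBits I.k.bits) = num (cappedValue I.n I.k.bits) := by
    rw [cappedUnary, length_matrix]
    congr 2
  rw [h'', length_toList_num]
  exact ⟨fun h => congrArg num (h'.1 h), h'.2⟩

/-- With `K = kinds * 2 ^ kinds`, irreducibility leaves at most `2 * K` vertices per unit of `darts
+ 2 * comps - 2 * n`, which is at most `2 * fes`. The edges exceed this bound for the vertices by at
most `fes`, whence `kernelConst`. The bound `J.n + 1` for `J.k` is attained by `noInstance`. -/
theorem exists_kernel (I : Instance) : ∃ J : Instance, kernelD I.encode = J.encode ∧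
    (I.IsYes ↔ J.IsYes) ∧ J.n ≤ kernelConst * fes I.graph ∧
    J.graph.edgeSet.ncard ≤ kernelConst * fes I.graph ∧ J.k ≤ J.n + 1 := by
  obtain ⟨hcap, hcap'⟩ := cappedUnary_encode I
  by_cases hk : I.k ≤ I.n
  · obtain ⟨G, k, l, h1, h2, h3, h4⟩ := reduceD_encodeState ruleSize I.graph 0 I.k
    obtain ⟨J, h5, h6, h7, h8, h9⟩ := finishD_encodeState G k l
    have h10 := h4.ncard_not_isolated_le
    have h11 := darts_add_comps_le_fes I.graph
    rw [Nat.card_eq_fintype_card, Fintype.card_fin] at h11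
    have h12 : {v | ∃ w, G.Adj v w}.ncard ≤ 4 * (kinds * 2 ^ kinds) * fes I.graph := by
      have := Nat.mul_le_mul_left (2 * (kinds * 2 ^ kinds)) (h3.trans h11)
      rw [mul_add] at this
      linarith
    have h13 : kernelConst * fes I.graph = 4 * (kinds * 2 ^ kinds) * fes I.graph + fes I.graph := by
      rw [kernelConst, add_mul, one_mul]
    refine ⟨J, ?_, ?_, by omega, by omega, h9⟩
    · have hr : reducedD I.encode = encodeState G k l := by
        rw [← h1, reducedD, Instance.encode_eq, head_cons, tail_cons, hcap hk]
        rfl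
      rw [kernelD, hr, Instance.encode_eq, head_cons, tail_cons, hcap hk, length_matrix,
        length_toList_num, if_pos hk, ← h5]
      rfl
    · rw [I.isYes_iff, and_iff_right hk, h2, h6]
  · refine ⟨noInstance, ?_, iff_of_false (fun h => hk (I.isYes_iff.1 h).1) not_isYes_noInstance,
      Nat.zero_le _, by simp [noInstance], le_rfl⟩
    rw [kernelD, if_neg]
    rw [Instance.encode_eq, head_cons, tail_cons, length_matrix]
    have := hcap' (by omega)
    omega

theorem size_encode_le (J : Instance) {m : ℕ} (hn : J.n ≤ m) (hk : J.k ≤ J.n + 1) :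
    J.encode.size ≤ m * (4 * m + 2) + 4 * m + 7 := by
  have h1 : (matrix J.graph).size ≤ 1 + J.n * (4 * J.n + 2) := by
    have h := size_map_map_le (P := adjD (matrix J.graph)) (verts (matrix J.graph)).toList
    rw [length_verts, length_matrix] at h
    rwa [Rule.matrix_eq_map fun _ _ => adjD_matrix] at h
  have h2 : (ofBits J.k.bits).size ≤ 1 + J.k * 4 := by
    refine (size_ofList_le (c := 3) ?_).trans ?_
    · intro a ha
      obtain ⟨b, -, rfl⟩ := List.mem_map.1 ha
      cases b <;> simp [ofBool, Data.size]
    · have : J.k.bits.length ≤ J.k := by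
        rw [Nat.size_eq_bits_len]
        exact Nat.size_le.2 Nat.lt_two_pow_self
      rw [List.length_map]
      omega
  have h3 : J.n * (4 * J.n + 2) ≤ m * (4 * m + 2) := by gcongr
  rw [Instance.encode_eq, Data.size]
  omega

/-- Locating-Dominating Set has a kernel of size linear in the feedback edge set number. -/
theorem exists_isKernelization : ∃ f : Instance → Instance,
    IsKernelization Instance.encode Instance.IsYes (fun I => fes I.graph) f ∧
    ∃ C : ℕ, ∀ I : Instance,
      (f I).n ≤ C * fes I.graph ∧ (f I).graph.edgeSet.ncard ≤ C * fes I.graph := by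
  choose f henc hyes hn he hk using exists_kernel
  refine ⟨f, ⟨?_, hyes, ?_⟩, kernelConst, fun I => ⟨hn I, he I⟩⟩
  · obtain ⟨p, t, ⟨q, hq⟩, hp⟩ := pt_kernelD
    exact ⟨p, q, fun I => ⟨_, hq _, henc I ▸ hp _⟩⟩
  -- The first summands bound the encoding as in `size_encode_le`; the last one bounds the parameter
  -- of the output by its number of edges.
  · refine ⟨fun c => kernelConst * c * (4 * (kernelConst * c) + 2) + 4 * (kernelConst * c) + 7 +
      kernelConst * c, ?_, fun I => ?_⟩
    · have h : Primrec fun c : ℕ => kernelConst * c := Primrec.nat_mul.comp (.const _) .id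
      have h4 : Primrec fun c : ℕ => 4 * (kernelConst * c) := Primrec.nat_mul.comp (.const _) h
      exact (Primrec.nat_add.comp (Primrec.nat_add.comp (Primrec.nat_add.comp
        (Primrec.nat_mul.comp h (Primrec.nat_add.comp h4 (.const 2))) h4) (.const 7)) h).to_comp
    · exact add_le_add (size_encode_le _ (hn I) (hk I)) ((fes_le_edges _).trans (he I))

end LocDom

/-- Locating-Dominating Set, parameterized by the feedback edge set number `fes` of the input
graph, admits a kernel with `O(fes)` vertices and edges. -/
theorem theorem2 :
    ∃ f : LocDom.Instance → LocDom.Instance,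
      LocDom.IsKernelization LocDom.Instance.encode LocDom.Instance.IsYes
        (fun I => LocDom.fes I.graph) f ∧
      ∃ C : ℕ, ∀ I : LocDom.Instance,
        (f I).n ≤ C * LocDom.fes I.graph ∧
        (f I).graph.edgeSet.ncard ≤ C * LocDom.fes I.graph :=
  LocDom.exists_isKernelization
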